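/- Consider a two-user discrete memoryless multiple access channel with a wiretapper: finite alphabets $\mathcal X_1,\mathcal X_2,\mathcal Y,\mathcal Z$ and a transition matrix $p(y,z\mid x_1,x_2)$, where $y$ is received by Bob and $z$ by Eve. Assume that each user has some secrecy advantage over Eve: there are independent inputs $X_1,X_2$ with $I(X_1;Y\mid X_2)>I(X_1;Z\mid X_2)$, and there are (possibly other) independent inputs with $I(X_2;Y\mid X_1)>I(X_2;Z\mid X_1)$. Information is measured in bits. **Codes with key buffers.** Time is divided into slots of $n=n_1+n_2$ channel uses. In slot $k=1,2,\dots$ user $i\in\{1,2\}$ transmits a fresh message $\overline W^{(i)}_k=(\overline W^{(i)}_{k,1},\overline W^{(i)}_{k,2})$ of uniform independent bits, $\overline W^{(i)}_{k,1}$ of $a_i$ bits and $\overline W^{(i)}_{k,2}$ of $b_{i,k}$ bits. In the first $n_1$ channel uses it sends $\overline W^{(i)}_{k,1}$ by a stochastic encoder (the same in every slot); in the last $n_2$ channel uses it sends a word in $\mathcal X_i^{n_2}$ that is a deterministic function of $\overline W^{(i)}_{k,2}$ and a key. The key consists of the $c_{i,k}$ oldest bits of the (infinite) key buffer of user $i$,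 which are then discarded; the buffer is empty at the start, and at the end of each slot the message of that slot is appended to it. The randomness of the two users is independent. $\overline X^{(i)}_k$ is the codeword (of length $n$) of user $i$ in slot $k$, and $\overline Y_k,\overline Z_k$ are the words received by Bob and Eve. After slot $k$ Bob decodes $(\overline W^{(1)}_k,\overline W^{(2)}_k)$ from $\overline Y_1,\dots,\overline Y_k$. The rate of user $i$ in slot $k$ is $(a_i+b_{i,k})/n$. **Secrecy-rate region.** Fix $N_1\ge 0$. A pair $(R_1,R_2)$ with $R_1,R_2\ge0$ is achievable if there are $l,k_0$ and, for each $n_1$, a code with key buffers with $n_2=l\,n_1$, such that 1. for all large $n_1$ the rate of user $i$ is at least $R_i$ in every slot $k\ge k_0$, $i=1,2$; 2. for every slot $k$, the probability that Bob decodes $(\overline W^{(1)}_k,\overline W^{(2)}_k)$ wrongly tends to $0$ as $n_1\to\infty$; 3. for every $\epsilon>0$ and all large $n_1$, in every slot $k$, $$I(\overline W^{(1)}_k,\dots,\overline W^{(1)}_{k-N_1};\overline Z_1,\dots,\overline Z_k\mid \overline X^{(2)}_k)\le n_1\epsilon,$$ $$I(\overline W^{(2)}_k,\dots,\overline W^{(2)}_{k-N_1};\overline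 Z_1,\dots,\overline Z_k\mid \overline X^{(1)}_k)\le n_1\epsilon,$$ $$I(\overline W^{(1)}_k,\overline W^{(2)}_k,\dots,\overline W^{(1)}_{k-N_1},\overline W^{(2)}_{k-N_1};\overline Z_1,\dots,\overline Z_k)\le 2n_1\epsilon$$ (messages with index less than $1$ are omitted). The secrecy-rate region is the closure of the convex hull of the set of achievable pairs. **Theorem.** For every $N_1\ge 0$ the secrecy-rate region equals the Shannon capacity region of the multiple access channel from the users to Bob, i.e. the closure of the convex hull of all pairs $(R_1,R_2)$, $R_1,R_2\ge0$, such that $$R_1<I(X_1;Y\mid X_2),\qquad R_2<I(X_2;Y\mid X_1),\qquad R_1+R_2<I(X_1,X_2;Y)$$ for some independent inputs $X_1,X_2$. -/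

import Mathlib

/-! Two-user discrete memoryless multiple access wiretap channels (MAC-WT), slotted codes with
secret key buffers, and their rate regions. Information is measured in bits. -/

noncomputable section

namespace MACWT

open Finset Filter Topology

/-! ### Entropy and mutual information of random variables on a finite probability space -/

section Information

variable {Ω α β γ : Type*} [Fintype Ω] [Fintype α] [Fintype β] [Fintype γ]

open Classical in
/-- The probability `P(A = a)` of the random variable `A` under the probability mass function
`P` on `Ω`. -/
def probOf {α : Type*} (P : Ω → ℝ) (A : Ω → α) (a : α) : ℝ := ∑ ω with A ω = a, P ω

/-- Shannon entropy `H(A)` in bits. -/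
def entropy (P : Ω → ℝ) (A : Ω → α) : ℝ :=
  (∑ a, Real.negMulLog (probOf P A a)) / Real.log 2

/-- Mutual information `I(A; B) = H(A) + H(B) - H(A, B)`. -/
def mutualInfo (P : Ω → ℝ) (A : Ω → α) (B : Ω → β) : ℝ :=
  entropy P A + entropy P B - entropy P (fun ω => (A ω, B ω))

/-- Conditional mutual information
`I(A; B | C) = H(A, C) + H(B, C) - H(A, B, C) - H(C)`. -/
def condMutualInfo (P : Ω → ℝ) (A : Ω → α) (B : Ω → β) (C : Ω → γ) : ℝ :=
  entropy P (fun ω => (A ω, C ω)) + entropy P (fun ω => (B ω, C ω))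
    - entropy P (fun ω => (A ω, B ω, C ω)) - entropy P C

end Information

/-! ### The channel and the Shannon capacity region of the MAC to Bob -/

/-- A discrete memoryless MAC with a wiretapper: the transition matrix `p(y, z | x₁, x₂)`, where
`y` is received by Bob and `z` by Eve. -/
structure Channel (𝒳₁ 𝒳₂ 𝒴 𝒵 : Type*) [Fintype 𝒴] [Fintype 𝒵] where
  prob : 𝒳₁ → 𝒳₂ → 𝒴 → 𝒵 → ℝ
  prob_nonneg : ∀ x₁ x₂ y z, 0 ≤ prob x₁ x₂ y z
  prob_sum : ∀ x₁ x₂, ∑ y, ∑ z, prob x₁ x₂ y z = 1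

section SingleLetter

variable {𝒳₁ 𝒳₂ 𝒴 𝒵 : Type*} [Fintype 𝒳₁] [Fintype 𝒳₂] [Fintype 𝒴] [Fintype 𝒵]

/-- The joint law of `(X₁, X₂, Y, Z)` for independent inputs `X₁ ∼ p₁`, `X₂ ∼ p₂`. -/
def Channel.joint (V : Channel 𝒳₁ 𝒳₂ 𝒴 𝒵) (p₁ : 𝒳₁ → ℝ) (p₂ : 𝒳₂ → ℝ) :
    𝒳₁ × 𝒳₂ × 𝒴 × 𝒵 → ℝ :=
  fun ω => p₁ ω.1 * p₂ ω.2.1 * V.prob ω.1 ω.2.1 ω.2.2.1 ω.2.2.2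

/-- `I(X₁; Y | X₂)`. -/
def Channel.infoBob₁ (V : Channel 𝒳₁ 𝒳₂ 𝒴 𝒵) (p₁ : 𝒳₁ → ℝ) (p₂ : 𝒳₂ → ℝ) : ℝ :=
  condMutualInfo (V.joint p₁ p₂) (fun ω => ω.1) (fun ω => ω.2.2.1) (fun ω => ω.2.1)

/-- `I(X₂; Y | X₁)`. -/
def Channel.infoBob₂ (V : Channel 𝒳₁ 𝒳₂ 𝒴 𝒵) (p₁ : 𝒳₁ → ℝ) (p₂ : 𝒳₂ → ℝ) : ℝ :=
  condMutualInfo (V.joint p₁ p₂) (fun ω => ω.2.1) (fun ω => ω.2.2.1) (fun ω => ω.1)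

/-- `I(X₁, X₂; Y)`. -/
def Channel.infoBob (V : Channel 𝒳₁ 𝒳₂ 𝒴 𝒵) (p₁ : 𝒳₁ → ℝ) (p₂ : 𝒳₂ → ℝ) : ℝ :=
  mutualInfo (V.joint p₁ p₂) (fun ω => (ω.1, ω.2.1)) (fun ω => ω.2.2.1)

/-- `I(X₁; Z | X₂)`. -/
def Channel.infoEve₁ (V : Channel 𝒳₁ 𝒳₂ 𝒴 𝒵) (p₁ : 𝒳₁ → ℝ) (p₂ : 𝒳₂ → ℝ) : ℝ :=
  condMutualInfo (V.joint p₁ p₂) (fun ω => ω.1) (fun ω => ω.2.2.2) (fun ω => ω.2.1)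

/-- `I(X₂; Z | X₁)`. -/
def Channel.infoEve₂ (V : Channel 𝒳₁ 𝒳₂ 𝒴 𝒵) (p₁ : 𝒳₁ → ℝ) (p₂ : 𝒳₂ → ℝ) : ℝ :=
  condMutualInfo (V.joint p₁ p₂) (fun ω => ω.2.1) (fun ω => ω.2.2.2) (fun ω => ω.1)

/-- The Shannon capacity region of the MAC to Bob (no secrecy constraint). -/
def Channel.shannonRegion (V : Channel 𝒳₁ 𝒳₂ 𝒴 𝒵) : Set (ℝ × ℝ) :=
  closure (convexHull ℝ {R : ℝ × ℝ | 0 ≤ R.1 ∧ 0 ≤ R.2 ∧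
    ∃ p₁ ∈ stdSimplex ℝ 𝒳₁, ∃ p₂ ∈ stdSimplex ℝ 𝒳₂,
      R.1 < V.infoBob₁ p₁ p₂ ∧ R.2 < V.infoBob₂ p₁ p₂ ∧ R.1 + R.2 < V.infoBob p₁ p₂})

end SingleLetter

/-! ### Slotted codes with secret key buffers

Slots are numbered `0, 1, 2, …`. A slot has `n₁ + n₂` channel uses, indexed by `Fin n₁ ⊕ Fin n₂`:
the first part of length `n₁` and the second part of length `n₂`. -/

/-- The transmitter of one user with input alphabet `𝒳`.

In slot `k` the user transmits a fresh message of `a + b k` bits. Its first `a` bits `W_{k,1}` are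
sent in the first part of the slot by a stochastic (wiretap) encoder, and the other `b k` bits
`W_{k,2}` in the second part by a deterministic encoder, which also gets a key of `c k` bits.
After a slot all bits of its message are appended to the key buffer of the user. The key of a slot
consists of the `c k` oldest bits of the buffer, which are then discarded. -/
structure UserCode (𝒳 : Type*) [Fintype 𝒳] (n₁ n₂ : ℕ) where
  a : ℕ
  b : ℕ → ℕ
  c : ℕ → ℕ
  /-- The key bits used up to and including slot `k` were stored before slot `k`. -/
  key_stored : ∀ k, ∑ j ∈ range (k + 1), c j ≤ ∑ j ∈ range k, (a + b j)
  wiretapEnc : (Fin a → Bool) → (Fin n₁ → 𝒳) → ℝ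
  wiretapEnc_mem : ∀ w, wiretapEnc w ∈ stdSimplex ℝ (Fin n₁ → 𝒳)
  keyEnc : ∀ k, (Fin (b k) → Bool) → (Fin (c k) → Bool) → (Fin n₂ → 𝒳)

namespace UserCode

variable {𝒳 : Type*} [Fintype 𝒳] {n₁ n₂ : ℕ} (u : UserCode 𝒳 n₁ n₂)

/-- The number of message bits transmitted before slot `k`. -/
def sent (k : ℕ) : ℕ := ∑ j ∈ range k, (u.a + u.b j)

/-- The number of key bits used before slot `k`; the buffer then holds `sent k - used k` bits. -/
def used (k : ℕ) : ℕ := ∑ j ∈ range k, u.c j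

theorem sent_succ_le {j k : ℕ} (h : j < k) : u.sent j + (u.a + u.b j) ≤ u.sent k := by
  rw [sent, ← sum_range_succ]
  exact sum_le_sum_of_subset (range_subset_range.2 h)

theorem used_add_le {j k : ℕ} (h : j < k) : u.used j + u.c j ≤ u.sent k := by
  have h₁ := u.key_stored j
  rw [sum_range_succ] at h₁
  have h₂ := u.sent_succ_le h
  simp only [used, sent] at *
  omega

/-- The message bits of the slots `0, …, k`, in the order of transmission (which is also the order
in which they enter and leave the buffer). -/
abbrev Bits (k : ℕ) : Type := Fin (u.sent (k + 1)) → Bool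

variable {u} {k : ℕ}

/-- The message `W_j = (W_{j,1}, W_{j,2})` of slot `j`. -/
def message (s : u.Bits k) (j : Fin (k + 1)) : Fin (u.a + u.b j) → Bool :=
  fun i => s ⟨u.sent j + i, by have := u.sent_succ_le j.2; omega⟩

/-- The first part `W_{j,1}` of the message of slot `j`. -/
def part₁ (s : u.Bits k) (j : Fin (k + 1)) : Fin u.a → Bool :=
  fun i => message s j (Fin.castAdd _ i)

/-- The second part `W_{j,2}` of the message of slot `j`. -/
def part₂ (s : u.Bits k) (j : Fin (k + 1)) : Fin (u.b j) → Bool :=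
  fun i => message s j (Fin.natAdd _ i)

/-- The key of slot `j`: the `c j` oldest bits in the buffer. -/
def key (s : u.Bits k) (j : Fin (k + 1)) : Fin (u.c j) → Bool :=
  fun i => s ⟨u.used j + i, by have := u.used_add_le j.2; omega⟩

open Classical in
/-- The conditional probability that the codewords of the slots `0, …, k` are `x`, given the
message bits `s`. -/
def encProb (s : u.Bits k) (x : Fin (k + 1) → Fin n₁ ⊕ Fin n₂ → 𝒳) : ℝ :=
  ∏ j, (u.wiretapEnc (part₁ s j) (fun i => x j (Sum.inl i)) *
    if (fun i => x j (Sum.inr i)) = u.keyEnc j (part₂ s j) (key s j) then 1 else 0)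

variable (u)

/-- The rate of slot `k`, in bits per channel use. -/
def rate (k : ℕ) : ℝ := ((u.a + u.b k : ℕ) : ℝ) / ((n₁ + n₂ : ℕ) : ℝ)

end UserCode

/-- A slotted code with key buffers: the transmitters of the two users, and Bob's decoder, who
decodes the message pair of slot `k` from all that he received in the slots `0, …, k`. -/
structure BufferCode (𝒳₁ 𝒳₂ 𝒴 : Type*) [Fintype 𝒳₁] [Fintype 𝒳₂] (n₁ n₂ : ℕ) where
  user₁ : UserCode 𝒳₁ n₁ n₂
  user₂ : UserCode 𝒳₂ n₁ n₂
  decode : ∀ k, (Fin (k + 1) → Fin n₁ ⊕ Fin n₂ → 𝒴) →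
    (Fin (user₁.a + user₁.b k) → Bool) × (Fin (user₂.a + user₂.b k) → Bool)

namespace BufferCode

variable {𝒳₁ 𝒳₂ 𝒴 : Type*} [Fintype 𝒳₁] [Fintype 𝒳₂] {n₁ n₂ : ℕ}

/-- What happens in the slots `0, …, k`: the message bits of the two users, their codewords,
and the sequences received by Bob and by Eve. -/
abbrev Outcome (C : BufferCode 𝒳₁ 𝒳₂ 𝒴 n₁ n₂) (𝒵 : Type*) (k : ℕ) : Type _ :=
  (C.user₁.Bits k × C.user₂.Bits k) ×
  ((Fin (k + 1) → Fin n₁ ⊕ Fin n₂ → 𝒳₁) × (Fin (k + 1) → Fin n₁ ⊕ Fin n₂ → 𝒳₂)) ×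
  ((Fin (k + 1) → Fin n₁ ⊕ Fin n₂ → 𝒴) × (Fin (k + 1) → Fin n₁ ⊕ Fin n₂ → 𝒵))

section Variables

variable {C : BufferCode 𝒳₁ 𝒳₂ 𝒴 n₁ n₂} {𝒵 : Type*} {k : ℕ}

/-- The message of user 1 in slot `j`. -/
def msg₁ (ω : C.Outcome 𝒵 k) (j : Fin (k + 1)) : Fin (C.user₁.a + C.user₁.b j) → Bool :=
  UserCode.message ω.1.1 j

/-- The message of user 2 in slot `j`. -/
def msg₂ (ω : C.Outcome 𝒵 k) (j : Fin (k + 1)) : Fin (C.user₂.a + C.user₂.b j) → Bool :=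
  UserCode.message ω.1.2 j

/-- The codeword of user 1 in slot `j`. -/
def codeword₁ (ω : C.Outcome 𝒵 k) (j : Fin (k + 1)) : Fin n₁ ⊕ Fin n₂ → 𝒳₁ := ω.2.1.1 j

/-- The codeword of user 2 in slot `j`. -/
def codeword₂ (ω : C.Outcome 𝒵 k) (j : Fin (k + 1)) : Fin n₁ ⊕ Fin n₂ → 𝒳₂ := ω.2.1.2 j

/-- Bob's observations in the slots `0, …, k`. -/
def bob (ω : C.Outcome 𝒵 k) : Fin (k + 1) → Fin n₁ ⊕ Fin n₂ → 𝒴 := ω.2.2.1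

/-- Eve's observations in the slots `0, …, k`. -/
def eve (ω : C.Outcome 𝒵 k) : Fin (k + 1) → Fin n₁ ⊕ Fin n₂ → 𝒵 := ω.2.2.2

/-- The slots `k - N, …, k` (all slots up to `k` if `k < N`). -/
abbrev Recent (N k : ℕ) : Type := {j : Fin (k + 1) // k ≤ (j : ℕ) + N}

/-- The messages of user 1 in the slots `k - N, …, k`. -/
def recent₁ (N : ℕ) (ω : C.Outcome 𝒵 k) :
    ∀ j : Recent N k, Fin (C.user₁.a + C.user₁.b j.1) → Bool :=
  fun j => msg₁ ω j.1

/-- The messages of user 2 in the slots `k - N, …, k`. -/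
def recent₂ (N : ℕ) (ω : C.Outcome 𝒵 k) :
    ∀ j : Recent N k, Fin (C.user₂.a + C.user₂.b j.1) → Bool :=
  fun j => msg₂ ω j.1

end Variables

variable {𝒵 : Type*} [Fintype 𝒴] [Fintype 𝒵]
variable (C : BufferCode 𝒳₁ 𝒳₂ 𝒴 n₁ n₂) (V : Channel 𝒳₁ 𝒳₂ 𝒴 𝒵)

/-- The joint law in the slots `0, …, k`: the message bits of the two users are independent and
uniform, each user encodes them with its own independent randomness, and the channel is
memoryless. -/
def law (k : ℕ) (ω : C.Outcome 𝒵 k) : ℝ :=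
  ((1 / 2) ^ C.user₁.sent (k + 1) * (1 / 2) ^ C.user₂.sent (k + 1)) *
  (UserCode.encProb ω.1.1 (codeword₁ ω) * UserCode.encProb ω.1.2 (codeword₂ ω)) *
  ∏ j, ∏ t, V.prob (codeword₁ ω j t) (codeword₂ ω j t) (bob ω j t) (eve ω j t)

open Classical in
/-- The probability that Bob decodes the message pair of slot `k` wrongly. -/
def errorProb (k : ℕ) : ℝ :=
  ∑ ω : C.Outcome 𝒵 k with
    C.decode k (bob ω) ≠ (msg₁ ω (Fin.last k), msg₂ ω (Fin.last k)), C.law V k ω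

/-- `I(W⁽¹⁾_k, …, W⁽¹⁾_{k-N}; Z_0, …, Z_k | X⁽²⁾_k)`. -/
def leakage₁ (N k : ℕ) : ℝ :=
  condMutualInfo (C.law V k) (recent₁ N) eve (fun ω => codeword₂ ω (Fin.last k))

/-- `I(W⁽²⁾_k, …, W⁽²⁾_{k-N}; Z_0, …, Z_k | X⁽¹⁾_k)`. -/
def leakage₂ (N k : ℕ) : ℝ :=
  condMutualInfo (C.law V k) (recent₂ N) eve (fun ω => codeword₁ ω (Fin.last k))

/-- `I(W⁽¹⁾_k, W⁽²⁾_k, …, W⁽¹⁾_{k-N}, W⁽²⁾_{k-N}; Z_0, …, Z_k)`. -/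
def leakage (N k : ℕ) : ℝ :=
  mutualInfo (C.law V k) (fun ω => (recent₁ N ω, recent₂ N ω)) eve

end BufferCode

section Region

variable {𝒳₁ 𝒳₂ 𝒴 𝒵 : Type*} [Fintype 𝒳₁] [Fintype 𝒳₂] [Fintype 𝒴] [Fintype 𝒵]

/-- `R` is an achievable secrecy-rate pair when the last `N + 1` messages have to be secured: there
are slotted codes with key buffers (`n₂ = l n₁`, `n₁ → ∞`, with `l` fixed) whose rates in all slots
from some fixed slot `k₀` on are at least `R`, whose error probability in every slot tends to zero,
and whose leakage in all slots is at most `n₁ ε` for each user and at most `2 n₁ ε` for both users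
jointly, for every `ε > 0` and all large `n₁`. -/
def Channel.IsAchievable (V : Channel 𝒳₁ 𝒳₂ 𝒴 𝒵) (N : ℕ) (R : ℝ × ℝ) : Prop :=
  0 ≤ R.1 ∧ 0 ≤ R.2 ∧
  ∃ (l k₀ : ℕ) (C : ∀ n₁ : ℕ, BufferCode 𝒳₁ 𝒳₂ 𝒴 n₁ (l * n₁)),
    (∀ᶠ n₁ in atTop, ∀ k, k₀ ≤ k →
      R.1 ≤ (C n₁).user₁.rate k ∧ R.2 ≤ (C n₁).user₂.rate k) ∧
    (∀ k, Tendsto (fun n₁ => (C n₁).errorProb V k) atTop (𝓝 0)) ∧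
    ∀ ε : ℝ, 0 < ε → ∀ᶠ n₁ in atTop, ∀ k,
      (C n₁).leakage₁ V N k ≤ n₁ * ε ∧
      (C n₁).leakage₂ V N k ≤ n₁ * ε ∧
      (C n₁).leakage V N k ≤ 2 * n₁ * ε

/-- The secrecy-rate region with key buffers: the closure of the convex hull of the achievable
secrecy-rate pairs. -/
def Channel.secrecyRegion (V : Channel 𝒳₁ 𝒳₂ 𝒴 𝒵) (N : ℕ) : Set (ℝ × ℝ) :=
  closure (convexHull ℝ {R | V.IsAchievable N R})

end Region

end MACWT

end

/-!
Both inclusions compare secrecy rates with the pentagon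
`R₁ < I(X₁;Y|X₂)`, `R₂ < I(X₂;Y|X₁)`, `R₁ + R₂ < I(X₁,X₂;Y)` of a pair of independent inputs. The
single-letter quantities are handled as relative entropies in nats (`macInfo`, `macSumInfo`), so
that rates in bits carry a factor `Real.log 2`.

**Achievability.** Every point strictly inside a pentagon is an achievable pair
(`isAchievable_of_lt`). Put `Δ = N₁ + 1`. In slot `k` the key is the whole message of slot `k - Δ`
(`schemeUser`). A message consists of a part of `a` bits, called layer `0`, and of up to `D` further
layers of `a` bits each. Layer `0` is sent by a wiretap code in the first `n₁` channel uses; layer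
`d + 1` is encrypted with layer `d` of slot `k - Δ` as a one-time pad, and the encrypted bits are
sent by an ordinary code for the multiple access channel (`mac_coding`) in the other `l n₁` channel
uses. A large `l` makes the loss of rate in the first part negligible, and a large `D` brings `a`
below the small positive rate at which wiretap coding is available. The wiretap code
(`wiretap_mac_coding`) gives each user half of the time, while the other user sends one fixed
symbol; random coding and soft covering produce an encoder for which the divergence of the law of
Eve's output from a fixed product law is `O(√n₁)`, whatever the message (`wiretap_coding`, `Hides`).

For secrecy, the true law is compared with a reference law in which the wiretap outputs of the last
`Δ (D + 1)` slots are replaced by noise that is independent of the messages. The bits form chains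
through the slots `j, j + Δ, j + 2Δ, …`, each encrypted with the preceding one. Any change of the
last `Δ` messages can be compensated along these chains without changing an encrypted bit, and only
wiretap parts of the last `Δ (D + 1)` slots are affected (`exists_chain_symmetry`). So under the
reference law the last `Δ` messages are independent of Eve's observation, even if she knows
everything about the other user. The leakage is therefore at most the divergence between the two
laws, which is `Δ (D + 1)` times that of the wiretap code, hence `O(√n₁) = o(n₁)` uniformly in the
slot (`mutualInfo_recent_le`). Bob decodes the component codes of all slots up to the present one
and recovers the messages by undoing the encryption (`message_eq_of_cipher_eq`).

**Converse.** Only the rates and the error probability in one late slot matter. Averaging over the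
bits and outputs of the earlier slots shows that some fixed past does not increase the error
probability (`exists_past`); given that past the two codewords are independent, and the slot is a
block code for the multiple access channel. Comparing the true law with laws under which the output
ignores one or both codewords gives Fano-type bounds by sums of single-letter quantities
(`prob_mul_log_le`, `mac_converse`). An average of pentagons lies in the convex closure because its
dominant points are averages of corners (`average_mem`). A corner of a pentagon can have a vanishing
rate, whereas the region is generated by strict inequalities; the corner is reached by mixing the
inputs with inputs for which both users have positive rates (`corners_mem`), and those exist because
both users have a secrecy advantage. Letting `n₁ → ∞` gives `mem_shannonRegion_of_isAchievable`.
-/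

noncomputable section

namespace MACWT

open Finset Filter Topology

/-! ### Sums of products over function spaces -/

open Classical in
/-- The real-valued indicator of a proposition. -/
def ind (s : Prop) : ℝ := if s then 1 else 0

theorem ind_pos {s : Prop} (h : s) : ind s = 1 := by simp [ind, h]

theorem ind_neg {s : Prop} (h : ¬ s) : ind s = 0 := by simp [ind, h]

theorem ind_nonneg (s : Prop) : 0 ≤ ind s := by unfold ind; split_ifs <;> norm_num

theorem ind_le_one (s : Prop) : ind s ≤ 1 := by unfold ind; split_ifs <;> norm_num

theorem ind_mono {s t : Prop} (h : s → t) : ind s ≤ ind t := by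
  by_cases hs : s
  · rw [ind_pos hs, ind_pos (h hs)]
  · rw [ind_neg hs]; exact ind_nonneg t

theorem sum_ind_eq {α : Type*} [Fintype α] (a₀ : α) : ∑ a, ind (a = a₀) = 1 := by
  classical
  simp [ind]

theorem sum_mul_ind_eq {α : Type*} [Fintype α] (f : α → ℝ) (a₀ : α) :
    ∑ a, f a * ind (a = a₀) = f a₀ := by
  classical
  simp [ind]

section ProductSums

variable {ι α β : Type*} [Fintype ι] [DecidableEq ι] [Fintype α] [Fintype β]

theorem sum_pi_prod (κ : ι → α → ℝ) : ∑ f : ι → α, ∏ i, κ i (f i) = ∏ i, ∑ a, κ i a := by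
  rw [Finset.prod_univ_sum, Fintype.piFinset_univ]

theorem sum_pi_prod_eq_one {κ : ι → α → ℝ} (h : ∀ i, ∑ a, κ i a = 1) :
    ∑ f : ι → α, ∏ i, κ i (f i) = 1 := by
  rw [sum_pi_prod]; simp [h]

/-- Marginalization of a product weight to one coordinate. -/
theorem sum_pi_eval {κ : ι → α → ℝ} (h : ∀ i, ∑ a, κ i a = 1) (i₀ : ι) (g : α → ℝ) :
    ∑ f : ι → α, (∏ i, κ i (f i)) * g (f i₀) = ∑ a, κ i₀ a * g a := by
  have h₁ : ∀ f : ι → α, (∏ i, κ i (f i)) * g (f i₀) =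
      ∏ i, (κ i (f i) * if i = i₀ then g (f i) else 1) := by
    intro f
    rw [prod_mul_distrib]
    simp
  simp_rw [h₁]
  rw [sum_pi_prod (fun i a => κ i a * if i = i₀ then g a else 1), Finset.prod_eq_single i₀]
  · simp
  · intro i _ hi
    simp [hi, h]
  · simp

/-- Marginalization of a product weight to two different coordinates. -/
theorem sum_pi_eval₂ {κ : ι → α → ℝ} (h : ∀ i, ∑ a, κ i a = 1) {i₁ i₂ : ι} (hi : i₁ ≠ i₂)
    (g : α → α → ℝ) :
    ∑ f : ι → α, (∏ i, κ i (f i)) * g (f i₁) (f i₂) =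
      ∑ a, ∑ b, κ i₁ a * κ i₂ b * g a b := by
  classical
  have h₁ : ∀ f : ι → α, (∏ i, κ i (f i)) * g (f i₁) (f i₂) =
      ∑ a, ∏ i, (κ i (f i) * ((if i = i₁ then (if f i = a then 1 else 0) else 1) *
        (if i = i₂ then g a (f i) else 1))) := by
    intro f
    simp_rw [prod_mul_distrib]
    simp
  simp_rw [h₁]
  rw [sum_comm]
  refine sum_congr rfl fun a _ => ?_
  rw [sum_pi_prod (fun i x => κ i x * ((if i = i₁ then (if x = a then 1 else 0) else 1) *
        (if i = i₂ then g a x else 1)))]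
  rw [← Finset.mul_prod_erase univ _ (mem_univ i₁),
    ← Finset.mul_prod_erase (univ.erase i₁) _ (mem_erase.2 ⟨hi.symm, mem_univ i₂⟩),
    Finset.prod_eq_one]
  · simp [hi, hi.symm, mul_sum, mul_assoc]
  · intro i hi'
    simp only [mem_erase, mem_univ, and_true, ne_eq] at hi'
    simp [hi'.1, hi'.2, h]

omit [Fintype ι] in
theorem sum_arrow_prod [Fintype ι] (F : (ι → α) → (ι → β) → ℝ) :
    ∑ f : ι → α, ∑ g : ι → β, F f g = ∑ h : ι → α × β, F (fun i => (h i).1) (fun i => (h i).2) := by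
  rw [← Fintype.sum_prod_type' (f := fun f g => F f g)]
  exact (Fintype.sum_equiv (Equiv.arrowProdEquivProdArrow ι (fun _ => α) (fun _ => β)) _ _
    fun h => rfl).symm

/-- Second moment of a sum of independent centred terms. -/
theorem sum_pi_sq {p : α → ℝ} (hp : ∑ a, p a = 1) {g : α → ℝ} (hg : ∑ a, p a * g a = 0) :
    ∑ f : ι → α, (∏ i, p (f i)) * (∑ i, g (f i)) ^ 2 =
      Fintype.card ι * ∑ a, p a * g a ^ 2 := by
  have h₁ : ∀ f : ι → α, (∏ i, p (f i)) * (∑ i, g (f i)) ^ 2 =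
      ∑ i, ∑ j, (∏ i, p (f i)) * (g (f i) * g (f j)) := by
    intro f
    rw [sq, sum_mul_sum, mul_sum]
    simp_rw [mul_sum]
  simp_rw [h₁]
  rw [sum_comm]
  have h₂ : ∀ i, ∑ f : ι → α, ∑ j, (∏ i, p (f i)) * (g (f i) * g (f j)) =
      ∑ a, p a * g a ^ 2 := by
    intro i
    rw [sum_comm, Finset.sum_eq_single i]
    · simp_rw [← sq]
      exact sum_pi_eval (κ := fun _ => p) (fun _ => hp) i (fun a => g a ^ 2)
    · intro j _ hj
      rw [sum_pi_eval₂ (κ := fun _ => p) (fun _ => hp) hj.symm (fun a b => g a * g b)]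
      have : ∀ a b, p a * p b * (g a * g b) = (p a * g a) * (p b * g b) := fun a b => by ring
      simp_rw [this, ← mul_sum, hg]
      simp
    · simp
  simp_rw [h₂]
  simp

end ProductSums

/-! ### Entropy, mutual information and relative entropy -/

section Information

variable {Ω Ω' α β γ : Type*} [Fintype Ω] [Fintype Ω'] [Fintype α] [Fintype β] [Fintype γ]

omit [Fintype α] in
theorem probOf_nonneg {P : Ω → ℝ} (hP : ∀ ω, 0 ≤ P ω) (A : Ω → α) (a : α) : 0 ≤ probOf P A a :=
  sum_nonneg fun ω _ => hP ω

omit [Fintype α] in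
theorem le_probOf {P : Ω → ℝ} (hP : ∀ ω, 0 ≤ P ω) (A : Ω → α) (ω : Ω) :
    P ω ≤ probOf P A (A ω) := by
  classical
  exact single_le_sum (f := P) (fun ω _ => hP ω) (by simp)

omit [Fintype α] in
theorem exists_of_probOf_ne_zero {P : Ω → ℝ} {A : Ω → α} {a : α} (h : probOf P A a ≠ 0) :
    ∃ ω, A ω = a ∧ P ω ≠ 0 := by
  obtain ⟨ω, hω, h0⟩ := exists_ne_zero_of_sum_ne_zero h
  exact ⟨ω, by simpa using hω, h0⟩

theorem sum_probOf_mul (P : Ω → ℝ) (A : Ω → α) (g : α → ℝ) :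
    ∑ a, probOf P A a * g a = ∑ ω, P ω * g (A ω) := by
  classical
  rw [← Finset.sum_fiberwise univ A (fun ω => P ω * g (A ω))]
  refine sum_congr rfl fun a _ => ?_
  rw [probOf, sum_mul]
  refine sum_congr (by congr) fun ω hω => ?_
  rw [(mem_filter.1 hω).2]

theorem sum_probOf (P : Ω → ℝ) (A : Ω → α) : ∑ a, probOf P A a = ∑ ω, P ω := by
  simpa using sum_probOf_mul P A (fun _ => 1)

omit [Fintype β] in
theorem probOf_map (P : Ω → ℝ) (π : Ω → α) (A : α → β) (b : β) :
    probOf (probOf P π) A b = probOf P (fun ω => A (π ω)) b := by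
  classical
  have := sum_probOf_mul P π (fun a => if A a = b then 1 else 0)
  rw [probOf, probOf, sum_filter, sum_filter]
  simpa using this

theorem entropy_eq (P : Ω → ℝ) (A : Ω → α) :
    entropy P A = (-∑ ω, P ω * Real.log (probOf P A (A ω))) / Real.log 2 := by
  rw [entropy, ← sum_probOf_mul P A (fun a => Real.log (probOf P A a)), ← sum_neg_distrib]
  simp [Real.negMulLog]

theorem mutualInfo_eq (P : Ω → ℝ) (A : Ω → α) (B : Ω → β) :
    mutualInfo P A B = (∑ ω, P ω * (Real.log (probOf P (fun ω => (A ω, B ω)) (A ω, B ω)) -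
      Real.log (probOf P A (A ω)) - Real.log (probOf P B (B ω)))) / Real.log 2 := by
  simp only [mutualInfo, entropy_eq, mul_sub, sum_sub_distrib]
  ring

theorem condMutualInfo_eq (P : Ω → ℝ) (A : Ω → α) (B : Ω → β) (C : Ω → γ) :
    condMutualInfo P A B C =
      (∑ ω, P ω * (Real.log (probOf P (fun ω => (A ω, B ω, C ω)) (A ω, B ω, C ω)) +
      Real.log (probOf P C (C ω)) - Real.log (probOf P (fun ω => (A ω, C ω)) (A ω, C ω)) -
      Real.log (probOf P (fun ω => (B ω, C ω)) (B ω, C ω)))) / Real.log 2 := by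
  simp only [condMutualInfo, entropy_eq, mul_sub, mul_add, sum_sub_distrib, sum_add_distrib]
  ring

theorem entropy_map (P : Ω → ℝ) (π : Ω → Ω') (A : Ω' → α) :
    entropy (probOf P π) A = entropy P (fun ω => A (π ω)) := by
  simp only [entropy, probOf_map]

theorem mutualInfo_map (P : Ω → ℝ) (π : Ω → Ω') (A : Ω' → α) (B : Ω' → β) :
    mutualInfo (probOf P π) A B = mutualInfo P (fun ω => A (π ω)) (fun ω => B (π ω)) := by
  simp only [mutualInfo, entropy_map]

omit [Fintype α] [Fintype β] in
theorem probOf_comp_injective (P : Ω → ℝ) (A : Ω → α) {e : α → β} (he : e.Injective) (a : α) :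
    probOf P (fun ω => e (A ω)) (e a) = probOf P A a := by
  refine sum_congr ?_ fun _ _ => rfl
  ext ω
  simp [he.eq_iff]

theorem entropy_comp_injective (P : Ω → ℝ) (A : Ω → α) {e : α → β} (he : e.Injective) :
    entropy P (fun ω => e (A ω)) = entropy P A := by
  rw [entropy_eq, entropy_eq]
  simp only [probOf_comp_injective P A he]

/-- Gibbs' inequality: relative entropy with respect to a subprobability is nonnegative. -/
theorem gibbs {P Q : Ω → ℝ} (hP : ∀ ω, 0 ≤ P ω) (hQ : ∀ ω, 0 ≤ Q ω)
    (hPQ : ∀ ω, P ω ≠ 0 → Q ω ≠ 0) (hle : ∑ ω, Q ω ≤ ∑ ω, P ω) :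
    0 ≤ ∑ ω, P ω * Real.log (P ω / Q ω) := by
  have h : ∀ ω, P ω - Q ω ≤ P ω * Real.log (P ω / Q ω) := by
    intro ω
    rcases eq_or_ne (P ω) 0 with h0 | h0
    · simp [h0, hQ ω]
    · have hp : 0 < P ω := lt_of_le_of_ne (hP ω) h0.symm
      have hq : 0 < Q ω := lt_of_le_of_ne (hQ ω) (hPQ ω h0).symm
      have := Real.one_sub_inv_le_log_of_pos (div_pos hp hq)
      calc P ω - Q ω = P ω * (1 - (P ω / Q ω)⁻¹) := by field_simp
        _ ≤ _ := mul_le_mul_of_nonneg_left this hp.le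
  calc 0 ≤ ∑ ω, (P ω - Q ω) := by rw [sum_sub_distrib]; linarith
    _ ≤ _ := sum_le_sum fun ω _ => h ω

/-- The mutual information of `A` and `O` under `P` is at most the relative entropy of `P` with
respect to any law `Q` that makes `A` and `O` independent and gives `A` the same law as `P`. -/
theorem mutualInfo_le_of_indep {P Q : Ω → ℝ} (hP : ∀ ω, 0 ≤ P ω) (hQ : ∀ ω, 0 ≤ Q ω)
    (hP₁ : ∑ ω, P ω = 1) (hQ₁ : ∑ ω, Q ω ≤ 1) (hPQ : ∀ ω, P ω ≠ 0 → Q ω ≠ 0)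
    (A : Ω → α) (O : Ω → β)
    (hind : ∀ a o, probOf Q (fun ω => (A ω, O ω)) (a, o) ≤ probOf P A a * probOf Q O o) :
    mutualInfo P A O ≤ (∑ ω, P ω * Real.log (P ω / Q ω)) / Real.log 2 := by
  rw [mutualInfo_eq]
  refine div_le_div_of_nonneg_right ?_ (Real.log_nonneg (by norm_num))
  set J : α × β → ℝ := probOf P (fun ω => (A ω, O ω)) with hJ
  have hJ0 : ∀ c, 0 ≤ J c := probOf_nonneg hP _
  -- the reference weight `Q · P_{AO} / (P_A P_O)` has total mass at most one
  let R : Ω → ℝ := fun ω => Q ω * (J (A ω, O ω) / (probOf P A (A ω) * probOf P O (O ω)))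
  have hpos : ∀ ω, P ω ≠ 0 → 0 < P ω ∧ 0 < Q ω ∧ 0 < J (A ω, O ω) ∧ 0 < probOf P A (A ω) ∧
      0 < probOf P O (O ω) := by
    intro ω h
    have hp : 0 < P ω := lt_of_le_of_ne (hP ω) h.symm
    exact ⟨hp, lt_of_le_of_ne (hQ ω) (hPQ ω h).symm,
      hp.trans_le (le_probOf hP (fun ω => (A ω, O ω)) ω),
      hp.trans_le (le_probOf hP A ω), hp.trans_le (le_probOf hP O ω)⟩
  have hR : ∑ ω, R ω ≤ 1 := by
    rw [← sum_probOf_mul Q (fun ω => (A ω, O ω))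
      (fun c => J c / (probOf P A c.1 * probOf P O c.2)), Fintype.sum_prod_type_right]
    calc _ ≤ ∑ o, probOf Q O o := by
          refine sum_le_sum fun o _ => ?_
          have h₁ : ∑ a, J (a, o) = probOf P O o := by
            have := sum_probOf_mul P (fun ω => (A ω, O ω))
              (fun c => by classical exact if c.2 = o then 1 else 0)
            rw [Fintype.sum_prod_type_right, Finset.sum_eq_single o] at this
            · simp only [if_true, mul_one] at this
              rw [hJ, this, probOf, sum_filter]
              simp
            · intro b _ hb
              simp [hb]
            · simp
          have h₂ : ∀ a, probOf Q (fun ω => (A ω, O ω)) (a, o) *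
              (J (a, o) / (probOf P A a * probOf P O o)) ≤
              probOf Q O o * (J (a, o) / probOf P O o) := by
            intro a
            have hA := probOf_nonneg hP A a
            have hO := probOf_nonneg hP O o
            have hQO := probOf_nonneg hQ O o
            refine (mul_le_mul_of_nonneg_right (hind a o)
              (div_nonneg (hJ0 _) (mul_nonneg hA hO))).trans ?_
            rcases hA.eq_or_lt with h0 | h0
            · rw [← h0]; simp only [zero_mul]
              exact mul_nonneg hQO (div_nonneg (hJ0 _) hO)
            · refine le_of_eq ?_
              rcases hO.eq_or_lt with h3 | h3
              · simp [← h3]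
              · field_simp
          refine (sum_le_sum fun a _ => h₂ a).trans ?_
          rw [← mul_sum, ← sum_div, h₁]
          exact mul_le_of_le_one_right (probOf_nonneg hQ O o) (div_self_le_one _)
      _ ≤ 1 := by rw [sum_probOf]; exact hQ₁
  have hg := gibbs (P := P) (Q := R) hP
    (fun ω => mul_nonneg (hQ ω) (div_nonneg (hJ0 _)
      (mul_nonneg (probOf_nonneg hP _ _) (probOf_nonneg hP _ _))))
    (fun ω h => by
      obtain ⟨_, h1, h2, h3, h4⟩ := hpos ω h
      positivity) (by rw [hP₁]; exact hR)
  rw [← sub_nonneg, ← sum_sub_distrib]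
  refine hg.trans (le_of_eq (sum_congr rfl fun ω _ => ?_))
  rcases eq_or_ne (P ω) 0 with h0 | h0
  · simp [h0]
  · obtain ⟨h1, h2, h3, h4, h5⟩ := hpos ω h0
    rw [← mul_sub]
    congr 1
    simp only [R]
    rw [Real.log_div h1.ne' (by positivity), Real.log_mul h2.ne' (by positivity),
      Real.log_div h3.ne' (by positivity), Real.log_mul h4.ne' h5.ne', Real.log_div h1.ne' h2.ne']
    ring

omit [Fintype α] [Fintype γ] in
theorem probOf_pair_comp (P : Ω → ℝ) (A : Ω → α) (O : Ω → β) (g : β → γ) (a : α) (c : γ) :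
    probOf P (fun ω => (A ω, g (O ω))) (a, c) =
      ∑ o, (by classical exact if g o = c then probOf P (fun ω => (A ω, O ω)) (a, o) else 0) := by
  classical
  simp only [probOf, sum_filter, Prod.mk.injEq]
  have : ∀ o, (if g o = c then ∑ ω, (if A ω = a ∧ O ω = o then P ω else 0) else 0) =
      ∑ ω, if O ω = o then (if A ω = a ∧ g (O ω) = c then P ω else 0) else 0 := by
    intro o
    split_ifs with h
    · refine sum_congr rfl fun ω _ => ?_
      by_cases h1 : O ω = o <;> simp [h1, h]
    · symm
      refine sum_eq_zero fun ω _ => ?_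
      by_cases h1 : O ω = o <;> simp [h1, h]
  refine Eq.trans ?_ (sum_congr rfl fun o _ => (this o).symm)
  rw [sum_comm]
  simp

/-- Gibbs' inequality for the joint law against the product of its marginals. -/
theorem mutualInfo_nonneg {P : Ω → ℝ} (hP : ∀ ω, 0 ≤ P ω) (hP₁ : ∑ ω, P ω = 1)
    (A : Ω → α) (B : Ω → β) : 0 ≤ mutualInfo P A B := by
  rw [← mutualInfo_map P (fun ω => (A ω, B ω)) Prod.fst Prod.snd, mutualInfo_eq]
  refine div_nonneg ?_ (Real.log_nonneg (by norm_num))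
  simp only [probOf_map]
  set J : α × β → ℝ := probOf P (fun ω => (A ω, B ω)) with hJ
  have hpos : ∀ c, J c ≠ 0 → 0 < probOf P A c.1 ∧ 0 < probOf P B c.2 := by
    intro c hc
    obtain ⟨ω, rfl, h0⟩ := exists_of_probOf_ne_zero hc
    have : 0 < P ω := lt_of_le_of_ne (hP ω) h0.symm
    exact ⟨this.trans_le (le_probOf hP A ω), this.trans_le (le_probOf hP B ω)⟩
  have hJ0 : ∀ c, 0 ≤ J c := probOf_nonneg hP _
  have hg := gibbs (P := J) (Q := fun c => probOf P A c.1 * probOf P B c.2) hJ0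
    (fun c => mul_nonneg (probOf_nonneg hP _ _) (probOf_nonneg hP _ _))
    (fun c hc => (mul_pos (hpos c hc).1 (hpos c hc).2).ne') (by
      rw [Fintype.sum_prod_type]
      simp only [← mul_sum, sum_probOf, hP₁, ← sum_mul, hJ]
      simp)
  refine hg.trans (le_of_eq (sum_congr rfl fun c _ => ?_))
  rcases eq_or_ne (J c) 0 with h0 | h0
  · simp [h0]
  · obtain ⟨h1, h2⟩ := hpos c h0
    rw [Real.log_div h0 (by positivity), Real.log_mul h1.ne' h2.ne']
    simp only [J, Prod.mk.eta]
    ring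

theorem condMutualInfo_le {P : Ω → ℝ} (hP : ∀ ω, 0 ≤ P ω) (hP₁ : ∑ ω, P ω = 1)
    (A : Ω → α) (B : Ω → β) (C : Ω → γ) :
    condMutualInfo P A B C ≤ mutualInfo P A (fun ω => (B ω, C ω)) := by
  have := mutualInfo_nonneg hP hP₁ A C
  simp only [condMutualInfo, mutualInfo] at *
  linarith

/-- The chain rule for mutual information, where revealing `B` can only help to learn `A`. -/
theorem mutualInfo_pair_le {P : Ω → ℝ} (hP : ∀ ω, 0 ≤ P ω) (hP₁ : ∑ ω, P ω = 1)
    (A : Ω → α) (B : Ω → β) (C : Ω → γ) :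
    mutualInfo P (fun ω => (A ω, B ω)) C ≤
      mutualInfo P A (fun ω => (C ω, B ω)) + mutualInfo P B C := by
  have h := mutualInfo_nonneg hP hP₁ A B
  have h₁ := entropy_comp_injective P (fun ω => ((A ω, B ω), C ω))
    (e := fun x : (α × β) × γ => (x.1.1, x.2, x.1.2)) (by
      rintro ⟨⟨_, _⟩, _⟩ ⟨⟨_, _⟩, _⟩ h; simpa [and_comm, and_assoc, and_left_comm] using h)
  have h₂ := entropy_comp_injective P (fun ω => (B ω, C ω))
    (e := fun x : β × γ => (x.2, x.1)) (by
      rintro ⟨_, _⟩ ⟨_, _⟩ h; simpa [and_comm] using h)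
  simp only [mutualInfo] at *
  linarith

end Information

/-! ### Single-letter information quantities -/

section SingleLetterInfo

variable {α β γ : Type*} [Fintype α] [Fintype β] [Fintype γ]

/-- The output law of the channel `W` for the input law `p`. -/
def outLaw (p : α → ℝ) (W : α → β → ℝ) (b : β) : ℝ := ∑ a, p a * W a b

/-- The mutual information, in nats, between the input and the output of the channel `W` for the
input law `p`. -/
def info (p : α → ℝ) (W : α → β → ℝ) : ℝ :=
  ∑ a, ∑ b, p a * W a b * Real.log (W a b / outLaw p W b)

/-- `I(X₁; Y | X₂)`, in nats, for a two-input channel and independent inputs. Its value for the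
channel with swapped inputs is `I(X₂; Y | X₁)`. -/
def macInfo (W : α → β → γ → ℝ) (p : α → ℝ) (q : β → ℝ) : ℝ :=
  ∑ x₂, q x₂ * info p (fun x₁ => W x₁ x₂)

/-- The law of a pair of independent inputs. -/
def prodLaw (p : α → ℝ) (q : β → ℝ) : α × β → ℝ := fun x => p x.1 * q x.2

/-- `I(X₁, X₂; Y)`, in nats, for a two-input channel and independent inputs. -/
def macSumInfo (W : α → β → γ → ℝ) (p : α → ℝ) (q : β → ℝ) : ℝ :=
  info (prodLaw p q) (fun x => W x.1 x.2)

variable {p : α → ℝ} {q : β → ℝ} {W : α → β → ℝ} {U : α → β → γ → ℝ}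

theorem prodLaw_mem (hp : p ∈ stdSimplex ℝ α) (hq : q ∈ stdSimplex ℝ β) :
    prodLaw p q ∈ stdSimplex ℝ (α × β) := by
  refine ⟨fun x => mul_nonneg (hp.1 _) (hq.1 _), ?_⟩
  simp only [prodLaw, Fintype.sum_prod_type, ← mul_sum, hq.2, mul_one, hp.2]

theorem outLaw_mem (hp : p ∈ stdSimplex ℝ α) (hW : ∀ a, W a ∈ stdSimplex ℝ β) :
    outLaw p W ∈ stdSimplex ℝ β := by
  refine ⟨fun b => sum_nonneg fun a _ => mul_nonneg (hp.1 a) ((hW a).1 b), ?_⟩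
  simp only [outLaw]
  rw [sum_comm]
  simp only [← mul_sum, (hW _).2, mul_one, hp.2]

omit [Fintype β] in
theorem outLaw_pos (hp : ∀ a, 0 ≤ p a) (hW : ∀ a b, 0 ≤ W a b) {a : α} {b : β}
    (h : p a * W a b ≠ 0) : 0 < outLaw p W b :=
  (lt_of_le_of_ne (mul_nonneg (hp a) (hW a b)) h.symm).trans_le
    (single_le_sum (f := fun a => p a * W a b) (fun a _ => mul_nonneg (hp a) (hW a b))
      (mem_univ a))

/-- The output law minimizes the average divergence of the channel from a fixed law. -/
theorem info_le (hp : p ∈ stdSimplex ℝ α) (hW : ∀ a, W a ∈ stdSimplex ℝ β) {Q : β → ℝ}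
    (hQ : Q ∈ stdSimplex ℝ β) (h : ∀ a b, p a * W a b ≠ 0 → Q b ≠ 0) :
    info p W ≤ ∑ a, ∑ b, p a * W a b * Real.log (W a b / Q b) := by
  have ho := outLaw_mem hp hW
  have hg := gibbs (P := outLaw p W) (Q := Q) ho.1 hQ.1 (fun b hb => by
    obtain ⟨a, _, ha⟩ := exists_ne_zero_of_sum_ne_zero hb
    exact h a b ha) (by rw [hQ.2, ho.2])
  have h₁ : ∑ a, ∑ b, p a * W a b * Real.log (W a b / Q b) - info p W =
      ∑ b, outLaw p W b * Real.log (outLaw p W b / Q b) := by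
    simp only [info]
    rw [sum_comm, sum_comm (f := fun a b => p a * W a b * Real.log (W a b / outLaw p W b)),
      ← sum_sub_distrib]
    refine sum_congr rfl fun b _ => ?_
    rw [← sum_sub_distrib, outLaw, sum_mul]
    refine sum_congr rfl fun a _ => ?_
    rcases eq_or_ne (p a * W a b) 0 with h0 | h0
    · simp [h0]
    · have hpos := outLaw_pos hp.1 (fun a => (hW a).1) h0
      have hW0 : W a b ≠ 0 := right_ne_zero_of_mul h0
      rw [← outLaw, Real.log_div hW0 (h a b h0), Real.log_div hW0 hpos.ne',
        Real.log_div hpos.ne' (h a b h0)]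
      ring
  linarith

theorem info_nonneg (hp : p ∈ stdSimplex ℝ α) (hW : ∀ a, W a ∈ stdSimplex ℝ β) :
    0 ≤ info p W := by
  have ho := outLaw_mem hp hW
  have hg := gibbs (P := fun x : α × β => p x.1 * W x.1 x.2)
    (Q := fun x => p x.1 * outLaw p W x.2)
    (fun x => mul_nonneg (hp.1 _) ((hW _).1 _)) (fun x => mul_nonneg (hp.1 _) (ho.1 _))
    (fun x hx => mul_ne_zero (left_ne_zero_of_mul hx)
      (outLaw_pos hp.1 (fun a => (hW a).1) hx).ne') (by
      simp only [Fintype.sum_prod_type, ← mul_sum, ho.2, (hW _).2]; rfl)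
  rw [Fintype.sum_prod_type] at hg
  refine hg.trans (le_of_eq (sum_congr rfl fun a _ => sum_congr rfl fun b _ => ?_))
  rcases eq_or_ne (p a) 0 with h0 | h0
  · simp [h0]
  · simp only
    rw [mul_div_mul_left _ _ h0]

/-- The mutual information of a mixture of input laws dominates the weighted mutual information
of each component. -/
theorem mul_info_le_info_mix (hp : p ∈ stdSimplex ℝ α) {u : α → ℝ} (hu : u ∈ stdSimplex ℝ α)
    (hW : ∀ a, W a ∈ stdSimplex ℝ β) {s t : ℝ} (hs : 0 ≤ s) (ht : 0 < t) (hst : s + t = 1) :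
    t * info u W ≤ info (fun a => s * p a + t * u a) W := by
  set m : α → ℝ := fun a => s * p a + t * u a with hm
  have hmem : m ∈ stdSimplex ℝ α := convex_stdSimplex ℝ α hp hu hs ht.le hst
  have hQ := outLaw_mem hmem hW
  have hmix : info m W = s * (∑ a, ∑ b, p a * W a b * Real.log (W a b / outLaw m W b)) +
      t * (∑ a, ∑ b, u a * W a b * Real.log (W a b / outLaw m W b)) := by
    rw [info, mul_sum, mul_sum, ← sum_add_distrib]
    refine sum_congr rfl fun a _ => ?_
    rw [mul_sum, mul_sum, ← sum_add_distrib]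
    refine sum_congr rfl fun b _ => ?_
    simp only [hm]; ring
  have h₁ := info_le hu hW hQ (fun a b h => (outLaw_pos hmem.1 (fun a => (hW a).1) (a := a) (by
    have h1 : 0 < u a := lt_of_le_of_ne (hu.1 a) (left_ne_zero_of_mul h).symm
    have h2 := hp.1 a
    refine mul_ne_zero ?_ (right_ne_zero_of_mul h)
    simp only [hm]; positivity)).ne')
  have h₂ : 0 ≤ s * (∑ a, ∑ b, p a * W a b * Real.log (W a b / outLaw m W b)) := by
    rcases hs.eq_or_lt with h0 | h0
    · simp [← h0]
    · refine mul_nonneg hs ((info_nonneg hp hW).trans (info_le hp hW hQ (fun a b h =>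
        (outLaw_pos hmem.1 (fun a => (hW a).1) (a := a) (by
          have h1 : 0 < p a := lt_of_le_of_ne (hp.1 a) (left_ne_zero_of_mul h).symm
          have h2 := hu.1 a
          refine mul_ne_zero ?_ (right_ne_zero_of_mul h)
          simp only [hm]; positivity)).ne')))
  rw [hmix]
  nlinarith [mul_le_mul_of_nonneg_left h₁ ht.le]

theorem info_eq (hp : ∀ a, 0 ≤ p a) (hW : ∀ a b, 0 ≤ W a b) :
    info p W = ∑ a, p a * ∑ b, W a b * Real.log (W a b) +
      ∑ b, Real.negMulLog (outLaw p W b) := by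
  have h₁ : ∑ b, Real.negMulLog (outLaw p W b) =
      ∑ a, ∑ b, -(p a * W a b) * Real.log (outLaw p W b) := by
    rw [sum_comm]
    refine sum_congr rfl fun b _ => ?_
    rw [← sum_mul, sum_neg_distrib]
    rfl
  rw [h₁, ← sum_add_distrib]
  refine sum_congr rfl fun a _ => ?_
  rw [mul_sum, ← sum_add_distrib]
  refine sum_congr rfl fun b _ => ?_
  rcases eq_or_ne (p a * W a b) 0 with h0 | h0
  · rw [h0]; simp [← mul_assoc, h0]
  · rw [Real.log_div (right_ne_zero_of_mul h0) (outLaw_pos hp hW h0).ne']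
    ring

/-- Continuity of mutual information along a curve of input laws. -/
theorem continuous_info {X : Type*} [TopologicalSpace X] {P : X → α → ℝ} (hP : Continuous P)
    (h0 : ∀ x a, 0 ≤ P x a) (hW : ∀ a b, 0 ≤ W a b) : Continuous fun x => info (P x) W := by
  have h₁ : (fun x => info (P x) W) = fun x => ∑ a, P x a * ∑ b, W a b * Real.log (W a b) +
      ∑ b, Real.negMulLog (outLaw (P x) W b) := funext fun x => info_eq (h0 x) hW
  rw [h₁]
  have hPa : ∀ a, Continuous fun x => P x a := fun a => (continuous_apply a).comp hP
  refine (continuous_finsetSum _ fun a _ => (hPa a).mul_const _).add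
    (continuous_finsetSum _ fun b _ => Real.continuous_negMulLog.comp
      (continuous_finsetSum _ fun a _ => (hPa a).mul_const _))

/-! ### Two-input channels -/

theorem macInfo_nonneg (hU : ∀ a b, U a b ∈ stdSimplex ℝ γ) (hp : p ∈ stdSimplex ℝ α)
    (hq : q ∈ stdSimplex ℝ β) : 0 ≤ macInfo U p q :=
  sum_nonneg fun b _ => mul_nonneg (hq.1 b) (info_nonneg hp fun a => hU a b)

theorem macSumInfo_eq : macSumInfo U p q = ∑ b, q b * ∑ a, ∑ c, p a * U a b c *
      Real.log (U a b c / outLaw (prodLaw p q) (fun x => U x.1 x.2) c) := by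
  rw [macSumInfo, info, Fintype.sum_prod_type, sum_comm]
  refine sum_congr rfl fun b _ => ?_
  rw [mul_sum]
  refine sum_congr rfl fun a _ => ?_
  rw [mul_sum]
  refine sum_congr rfl fun c _ => ?_
  simp only [prodLaw]; ring

theorem macSumInfo_swap : macSumInfo (fun b a => U a b) q p = macSumInfo U p q := by
  have h : outLaw (prodLaw q p) (fun x => U x.2 x.1) = outLaw (prodLaw p q) (fun x => U x.1 x.2) := by
    funext c
    simp only [outLaw, prodLaw, Fintype.sum_prod_type]
    rw [sum_comm]
    exact sum_congr rfl fun a _ => sum_congr rfl fun b _ => by ring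
  simp only [macSumInfo, info, h, Fintype.sum_prod_type]
  rw [sum_comm]
  exact sum_congr rfl fun a _ => sum_congr rfl fun b _ => sum_congr rfl fun c _ => by
    simp only [prodLaw]; ring

theorem macInfo_le_sum (hU : ∀ a b, U a b ∈ stdSimplex ℝ γ) (hp : p ∈ stdSimplex ℝ α)
    (hq : q ∈ stdSimplex ℝ β) : macInfo U p q ≤ macSumInfo U p q := by
  rw [macSumInfo_eq]
  refine sum_le_sum fun b _ => ?_
  rcases (hq.1 b).eq_or_lt with h0 | h0
  · simp [← h0]
  · refine mul_le_mul_of_nonneg_left (info_le hp (fun a => hU a b)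
      (outLaw_mem (prodLaw_mem hp hq) fun x => hU _ _) fun a c h => ?_) h0.le
    refine (outLaw_pos (prodLaw_mem hp hq).1 (fun x => (hU x.1 x.2).1) (a := (a, b)) ?_).ne'
    simp only [prodLaw]
    rw [mul_right_comm]
    exact mul_ne_zero h h0.ne'

/-- The constraint on the sum rate lies below the sum of the individual ones, because the inputs
are independent: granting a user the input of the other one does not reduce information. -/
theorem macSumInfo_le_add (hU : ∀ a b, U a b ∈ stdSimplex ℝ γ) (hp : p ∈ stdSimplex ℝ α)
    (hq : q ∈ stdSimplex ℝ β) :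
    macSumInfo U p q ≤ macInfo U p q + macInfo (fun b a => U a b) q p := by
  set o := outLaw (prodLaw p q) (fun x => U x.1 x.2) with ho
  have hoe : ∀ c, o c = ∑ a, ∑ b, p a * q b * U a b c := fun c => by
    rw [ho, outLaw, Fintype.sum_prod_type]; rfl
  have hom : o ∈ stdSimplex ℝ γ := outLaw_mem (prodLaw_mem hp hq) fun x => hU _ _
  set o₁ : β → γ → ℝ := fun b => outLaw p (fun a => U a b) with ho₁
  set o₂ : α → γ → ℝ := fun a => outLaw q (fun b => U a b) with ho₂
  have h1m : ∀ b, o₁ b ∈ stdSimplex ℝ γ := fun b => outLaw_mem hp fun a => hU a b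
  have h2m : ∀ a, o₂ a ∈ stdSimplex ℝ γ := fun a => outLaw_mem hq fun b => hU a b
  have hpos : ∀ a b c, p a * q b * U a b c ≠ 0 →
      0 < p a * q b ∧ 0 < U a b c ∧ 0 < o c ∧ 0 < o₁ b c ∧ 0 < o₂ a c := by
    intro a b c h
    have hp0 := left_ne_zero_of_mul (left_ne_zero_of_mul h)
    have hq0 := right_ne_zero_of_mul (left_ne_zero_of_mul h)
    have hU0 := right_ne_zero_of_mul h
    exact ⟨lt_of_le_of_ne (mul_nonneg (hp.1 a) (hq.1 b)) (mul_ne_zero hp0 hq0).symm,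
      lt_of_le_of_ne ((hU a b).1 c) hU0.symm,
      outLaw_pos (prodLaw_mem hp hq).1 (fun x => (hU x.1 x.2).1) (a := (a, b)) h,
      outLaw_pos hp.1 (fun a => (hU a b).1) (mul_ne_zero hp0 hU0),
      outLaw_pos hq.1 (fun b => (hU a b).1) (mul_ne_zero hq0 hU0)⟩
  -- compare the joint law with `p q · P(y|x₁) P(y|x₂) / P(y)`, which is again a (sub)probability
  have hg := gibbs (P := fun x : α × β × γ => p x.1 * q x.2.1 * U x.1 x.2.1 x.2.2)
    (Q := fun x => p x.1 * q x.2.1 * (o₁ x.2.1 x.2.2 * o₂ x.1 x.2.2 / o x.2.2))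
    (fun x => mul_nonneg (mul_nonneg (hp.1 _) (hq.1 _)) ((hU _ _).1 _))
    (fun x => mul_nonneg (mul_nonneg (hp.1 _) (hq.1 _))
      (div_nonneg (mul_nonneg ((h1m _).1 _) ((h2m _).1 _)) (hom.1 _)))
    (fun x hx => by
      obtain ⟨h1, h2, h3, h4, h5⟩ := hpos _ _ _ hx
      positivity)
    (by
      have e1 : ∑ x : α × β × γ, p x.1 * q x.2.1 * U x.1 x.2.1 x.2.2 = 1 := by
        simp only [Fintype.sum_prod_type, ← mul_sum, (hU _ _).2, mul_one, hq.2, hp.2]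
      have e2 : ∑ x : α × β × γ, p x.1 * q x.2.1 * (o₁ x.2.1 x.2.2 * o₂ x.1 x.2.2 / o x.2.2) =
          ∑ c, (∑ b, q b * o₁ b c) * (∑ a, p a * o₂ a c) / o c := by
        simp only [Fintype.sum_prod_type]
        simp_rw [sum_comm (s := (univ : Finset β)) (t := (univ : Finset γ))]
        rw [sum_comm]
        refine sum_congr rfl fun c _ => ?_
        rw [mul_comm (∑ b, q b * o₁ b c), sum_mul_sum, sum_div]
        refine sum_congr rfl fun a _ => ?_
        rw [sum_div]
        exact sum_congr rfl fun b _ => by ring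
      have e3 : ∀ c, ∑ b, q b * o₁ b c = o c := fun c => by
        rw [hoe, sum_comm]
        refine sum_congr rfl fun b _ => ?_
        simp only [ho₁, outLaw, mul_sum]
        exact sum_congr rfl fun a _ => by ring
      have e4 : ∀ c, ∑ a, p a * o₂ a c = o c := fun c => by
        rw [hoe]
        refine sum_congr rfl fun a _ => ?_
        simp only [ho₂, outLaw, mul_sum]
        exact sum_congr rfl fun b _ => by ring
      rw [e1, e2]
      simp only [e3, e4, mul_self_div_self, hom.2, le_refl])
  rw [← sub_nonneg]
  refine hg.trans (le_of_eq ?_)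
  have i1 : macInfo U p q = ∑ a, ∑ b, ∑ c, p a * q b * U a b c * Real.log (U a b c / o₁ b c) := by
    simp only [macInfo, info, mul_sum]
    rw [sum_comm]
    exact sum_congr rfl fun a _ => sum_congr rfl fun b _ => sum_congr rfl fun c _ => by
      simp only [ho₁]; ring
  have i2 : macInfo (fun b a => U a b) q p =
      ∑ a, ∑ b, ∑ c, p a * q b * U a b c * Real.log (U a b c / o₂ a c) := by
    simp only [macInfo, info, mul_sum]
    exact sum_congr rfl fun a _ => sum_congr rfl fun b _ => sum_congr rfl fun c _ => by
      simp only [ho₂]; ring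
  have i3 : macSumInfo U p q = ∑ a, ∑ b, ∑ c, p a * q b * U a b c * Real.log (U a b c / o c) := by
    rw [macSumInfo, info, Fintype.sum_prod_type]; rfl
  rw [i1, i2, i3]
  simp only [Fintype.sum_prod_type, ← sum_add_distrib, ← sum_sub_distrib]
  refine sum_congr rfl fun a _ => sum_congr rfl fun b _ => sum_congr rfl fun c _ => ?_
  rcases eq_or_ne (p a * q b * U a b c) 0 with h0 | h0
  · simp [h0]
  · obtain ⟨h1, h2, h3, h4, h5⟩ := hpos _ _ _ h0
    rw [Real.log_div h2.ne' h4.ne', Real.log_div h2.ne' h5.ne', Real.log_div h2.ne' h3.ne',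
      mul_div_mul_left _ _ h1.ne', Real.log_div h2.ne' (by positivity),
      Real.log_div (by positivity) h3.ne', Real.log_mul h4.ne' h5.ne']
    ring

end SingleLetterInfo

/-! ### The single-letter quantities as entropy expressions -/

section Conversion

variable {α β γ δ : Type*} [Fintype α] [Fintype β] [Fintype γ] [Fintype δ]

theorem condMutualInfo_map {Ω Ω' : Type*} [Fintype Ω] [Fintype Ω'] (P : Ω → ℝ) (π : Ω → Ω')
    (A : Ω' → α) (B : Ω' → β) (C : Ω' → γ) : condMutualInfo (probOf P π) A B C =
      condMutualInfo P (fun ω => A (π ω)) (fun ω => B (π ω)) (fun ω => C (π ω)) := by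
  simp only [condMutualInfo, entropy_map]

theorem condMutualInfo_mac {U : α → β → γ → ℝ} {p : α → ℝ} {q : β → ℝ}
    (hU : ∀ a b, U a b ∈ stdSimplex ℝ γ) (hp : p ∈ stdSimplex ℝ α) :
    condMutualInfo (fun ω : α × β × γ => p ω.1 * q ω.2.1 * U ω.1 ω.2.1 ω.2.2)
      (fun ω => ω.1) (fun ω => ω.2.2) (fun ω => ω.2.1) = macInfo U p q / Real.log 2 := by
  classical
  set P : α × β × γ → ℝ := fun ω => p ω.1 * q ω.2.1 * U ω.1 ω.2.1 ω.2.2 with hP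
  have h1 : ∀ a b c, probOf P (fun ω => (ω.1, ω.2.2, ω.2.1)) (a, c, b) = p a * q b * U a b c := by
    intro a b c
    simp [probOf, hP, sum_filter, Fintype.sum_prod_type, ite_and]
  have h2 : ∀ b, probOf P (fun ω => ω.2.1) b = q b := by
    intro b
    simp only [probOf, hP, sum_filter, Fintype.sum_prod_type]
    simp only [sum_ite_irrel, sum_const_zero, sum_ite_eq', mem_univ, if_true, ← mul_sum,
      (hU _ _).2, mul_one, ← sum_mul, hp.2, one_mul]
  have h3 : ∀ a b, probOf P (fun ω => (ω.1, ω.2.1)) (a, b) = p a * q b := by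
    intro a b
    simp only [probOf, hP, sum_filter, Fintype.sum_prod_type, Prod.mk.injEq, ite_and]
    simp only [sum_ite_irrel, sum_const_zero, sum_ite_eq', mem_univ, if_true, ← mul_sum,
      (hU _ _).2, mul_one]
  have h4 : ∀ b c, probOf P (fun ω => (ω.2.2, ω.2.1)) (c, b) =
      q b * outLaw p (fun a => U a b) c := by
    intro b c
    simp only [probOf, hP, sum_filter, Fintype.sum_prod_type, Prod.mk.injEq, ite_and]
    simp only [sum_ite_eq', mem_univ, if_true, outLaw, mul_sum]
    exact sum_congr rfl fun a _ => by ring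
  rw [condMutualInfo_eq]
  congr 1
  have h5 : ∀ a b c, P (a, b, c) = p a * q b * U a b c := fun _ _ _ => rfl
  simp only [Fintype.sum_prod_type, h1, h2, h3, h4, h5, macInfo, info, mul_sum]
  rw [sum_comm]
  refine sum_congr rfl fun b _ => sum_congr rfl fun a _ => sum_congr rfl fun c _ => ?_
  rcases eq_or_ne (p a * q b * U a b c) 0 with h0 | h0
  · have : q b * (p a * U a b c) = 0 := by rw [← h0]; ring
    simp [h0, ← mul_assoc, ← mul_assoc] at this ⊢
    tauto
  · have hp0 := left_ne_zero_of_mul (left_ne_zero_of_mul h0)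
    have hq0 := right_ne_zero_of_mul (left_ne_zero_of_mul h0)
    have hU0 := right_ne_zero_of_mul h0
    have ho := outLaw_pos hp.1 (fun a => (hU a b).1) (mul_ne_zero hp0 hU0)
    rw [Real.log_div hU0 ho.ne', Real.log_mul (mul_ne_zero hp0 hq0) hU0,
      Real.log_mul hq0 ho.ne']
    ring

theorem mutualInfo_channel {W : α → β → ℝ} {p : α → ℝ}
    (hW : ∀ a, W a ∈ stdSimplex ℝ β) (hp : p ∈ stdSimplex ℝ α) :
    mutualInfo (fun ω : α × β => p ω.1 * W ω.1 ω.2) (fun ω => ω.1) (fun ω => ω.2) =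
      info p W / Real.log 2 := by
  classical
  set P : α × β → ℝ := fun ω => p ω.1 * W ω.1 ω.2 with hP
  have h1 : ∀ a b, probOf P (fun ω => (ω.1, ω.2)) (a, b) = p a * W a b := by
    intro a b
    simp [probOf, hP, sum_filter]
  have h2 : ∀ a, probOf P (fun ω => ω.1) a = p a := by
    intro a
    simp only [probOf, hP, sum_filter, Fintype.sum_prod_type]
    simp only [sum_ite_irrel, sum_const_zero, sum_ite_eq', mem_univ, if_true, ← mul_sum,
      (hW _).2, mul_one]
  have h3 : ∀ b, probOf P (fun ω => ω.2) b = outLaw p W b := by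
    intro b
    simp [probOf, hP, sum_filter, Fintype.sum_prod_type, outLaw]
  rw [mutualInfo_eq]
  congr 1
  have h4 : ∀ a b, P (a, b) = p a * W a b := fun _ _ => rfl
  simp only [Fintype.sum_prod_type, h1, h2, h3, h4, info]
  refine sum_congr rfl fun a _ => sum_congr rfl fun b _ => ?_
  rcases eq_or_ne (p a * W a b) 0 with h0 | h0
  · rw [h0]; simp
  · have ho := outLaw_pos hp.1 (fun a => (hW a).1) h0
    rw [Real.log_div (right_ne_zero_of_mul h0) ho.ne', Real.log_mul (left_ne_zero_of_mul h0)
      (right_ne_zero_of_mul h0)]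
    ring

end Conversion

section ChannelInfo

variable {𝒳₁ 𝒳₂ 𝒴 𝒵 : Type*} [Fintype 𝒳₁] [Fintype 𝒳₂] [Fintype 𝒴] [Fintype 𝒵]
variable (V : Channel 𝒳₁ 𝒳₂ 𝒴 𝒵)

/-- The channel from the users to Bob. -/
def Channel.bob (x₁ : 𝒳₁) (x₂ : 𝒳₂) (y : 𝒴) : ℝ := ∑ z, V.prob x₁ x₂ y z

/-- The channel from the users to Eve. -/
def Channel.eve (x₁ : 𝒳₁) (x₂ : 𝒳₂) (z : 𝒵) : ℝ := ∑ y, V.prob x₁ x₂ y z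

omit [Fintype 𝒳₁] [Fintype 𝒳₂] in
theorem Channel.bob_mem (x₁ : 𝒳₁) (x₂ : 𝒳₂) : V.bob x₁ x₂ ∈ stdSimplex ℝ 𝒴 :=
  ⟨fun _ => sum_nonneg fun _ _ => V.prob_nonneg _ _ _ _, V.prob_sum x₁ x₂⟩

omit [Fintype 𝒳₁] [Fintype 𝒳₂] in
theorem Channel.eve_mem (x₁ : 𝒳₁) (x₂ : 𝒳₂) : V.eve x₁ x₂ ∈ stdSimplex ℝ 𝒵 :=
  ⟨fun _ => sum_nonneg fun _ _ => V.prob_nonneg _ _ _ _, by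
    simp only [Channel.eve]; rw [sum_comm]; exact V.prob_sum x₁ x₂⟩

variable {p₁ : 𝒳₁ → ℝ} {p₂ : 𝒳₂ → ℝ}

theorem Channel.infoBob₁_eq (h₁ : p₁ ∈ stdSimplex ℝ 𝒳₁) :
    V.infoBob₁ p₁ p₂ = macInfo V.bob p₁ p₂ / Real.log 2 := by
  classical
  rw [← condMutualInfo_mac V.bob_mem h₁, Channel.infoBob₁,
    ← condMutualInfo_map _ (fun ω : 𝒳₁ × 𝒳₂ × 𝒴 × 𝒵 => (ω.1, ω.2.1, ω.2.2.1))
      (fun ω => ω.1) (fun ω => ω.2.2) (fun ω => ω.2.1)]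
  congr 1
  funext ⟨a, b, c⟩
  simp [probOf, sum_filter, Fintype.sum_prod_type, ite_and, Channel.joint, Channel.bob, mul_sum]

theorem Channel.infoBob₂_eq (h₂ : p₂ ∈ stdSimplex ℝ 𝒳₂) :
    V.infoBob₂ p₁ p₂ = macInfo (fun x₂ x₁ => V.bob x₁ x₂) p₂ p₁ / Real.log 2 := by
  classical
  rw [← condMutualInfo_mac (fun x₂ x₁ => V.bob_mem x₁ x₂) h₂, Channel.infoBob₂,
    ← condMutualInfo_map _ (fun ω : 𝒳₁ × 𝒳₂ × 𝒴 × 𝒵 => (ω.2.1, ω.1, ω.2.2.1))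
      (fun ω => ω.1) (fun ω => ω.2.2) (fun ω => ω.2.1)]
  congr 1
  funext ⟨a, b, c⟩
  simp [probOf, sum_filter, Fintype.sum_prod_type, ite_and, Channel.joint, Channel.bob, mul_sum,
    mul_comm (p₁ _)]

theorem Channel.infoEve₁_eq (h₁ : p₁ ∈ stdSimplex ℝ 𝒳₁) :
    V.infoEve₁ p₁ p₂ = macInfo V.eve p₁ p₂ / Real.log 2 := by
  classical
  rw [← condMutualInfo_mac V.eve_mem h₁, Channel.infoEve₁,
    ← condMutualInfo_map _ (fun ω : 𝒳₁ × 𝒳₂ × 𝒴 × 𝒵 => (ω.1, ω.2.1, ω.2.2.2))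
      (fun ω => ω.1) (fun ω => ω.2.2) (fun ω => ω.2.1)]
  congr 1
  funext ⟨a, b, c⟩
  simp [probOf, sum_filter, Fintype.sum_prod_type, ite_and, Channel.joint, Channel.eve, mul_sum]

theorem Channel.infoEve₂_eq (h₂ : p₂ ∈ stdSimplex ℝ 𝒳₂) :
    V.infoEve₂ p₁ p₂ = macInfo (fun x₂ x₁ => V.eve x₁ x₂) p₂ p₁ / Real.log 2 := by
  classical
  rw [← condMutualInfo_mac (fun x₂ x₁ => V.eve_mem x₁ x₂) h₂, Channel.infoEve₂,
    ← condMutualInfo_map _ (fun ω : 𝒳₁ × 𝒳₂ × 𝒴 × 𝒵 => (ω.2.1, ω.1, ω.2.2.2))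
      (fun ω => ω.1) (fun ω => ω.2.2) (fun ω => ω.2.1)]
  congr 1
  funext ⟨a, b, c⟩
  simp [probOf, sum_filter, Fintype.sum_prod_type, ite_and, Channel.joint, Channel.eve, mul_sum,
    mul_comm (p₁ _)]

theorem Channel.infoBob_eq (h₁ : p₁ ∈ stdSimplex ℝ 𝒳₁) (h₂ : p₂ ∈ stdSimplex ℝ 𝒳₂) :
    V.infoBob p₁ p₂ = macSumInfo V.bob p₁ p₂ / Real.log 2 := by
  classical
  rw [macSumInfo, ← mutualInfo_channel (fun x => V.bob_mem x.1 x.2) (prodLaw_mem h₁ h₂),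
    Channel.infoBob, ← mutualInfo_map _ (fun ω : 𝒳₁ × 𝒳₂ × 𝒴 × 𝒵 => ((ω.1, ω.2.1), ω.2.2.1))
      (fun ω => ω.1) (fun ω => ω.2)]
  congr 1
  funext ⟨⟨a, b⟩, c⟩
  simp [probOf, sum_filter, Fintype.sum_prod_type, ite_and, Channel.joint, Channel.bob, mul_sum,
    prodLaw]

end ChannelInfo

/-! ### Random coding -/

section OneShot

variable {𝒜 ℬ 𝒞 𝒟 M : Type*} [Fintype 𝒜] [Fintype ℬ] [Fintype 𝒞] [Fintype 𝒟] [Fintype M]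

theorem exists_le_of_sum_le {S : Type*} [Fintype S] {w F : S → ℝ} (hw : ∀ s, 0 ≤ w s)
    (hw₁ : ∑ s, w s = 1) {b : ℝ} (h : ∑ s, w s * F s ≤ b) : ∃ s, 0 < w s ∧ F s ≤ b := by
  by_contra! hc
  have h₁ : ∑ s, w s * b < ∑ s, w s * F s := by
    obtain ⟨s, _, hs⟩ : ∃ s ∈ univ, w s ≠ 0 := exists_ne_zero_of_sum_ne_zero (by rw [hw₁]; simp)
    have hs' : 0 < w s := lt_of_le_of_ne (hw s) hs.symm
    refine sum_lt_sum (fun s _ => ?_) ⟨s, mem_univ s, mul_lt_mul_of_pos_left (hc s hs') hs'⟩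
    rcases (hw s).eq_or_lt with h0 | h0
    · simp [← h0]
    · exact (mul_lt_mul_of_pos_left (hc s h0) h0).le
  rw [← sum_mul, hw₁] at h₁
  linarith

/-- Union bound for the decoder that picks a message accepted by the received word. -/
theorem exists_decoder [Nonempty M] (A : M → 𝒞 → Prop) :
    ∃ dec : 𝒞 → M, ∀ (κ : 𝒞 → ℝ), (∀ c, 0 ≤ κ c) → ∀ m,
      ∑ c, κ c * ind (dec c ≠ m) ≤ ∑ c, κ c * ind (¬ A m c) +
        ∑ m', ind (m' ≠ m) * ∑ c, κ c * ind (A m' c) := by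
  classical
  refine ⟨fun c => if h : ∃ m, A m c then h.choose else Classical.arbitrary M, fun κ hκ m => ?_⟩
  have h₁ : ∑ m', ind (m' ≠ m) * ∑ c, κ c * ind (A m' c) =
      ∑ c, κ c * ∑ m', ind (m' ≠ m) * ind (A m' c) := by
    simp_rw [mul_sum]
    rw [sum_comm]
    exact sum_congr rfl fun m' _ => sum_congr rfl fun c _ => by ring
  rw [h₁, ← sum_add_distrib]
  refine sum_le_sum fun c _ => ?_
  rw [← mul_add]
  refine mul_le_mul_of_nonneg_left ?_ (hκ c)
  have h₂ : ∀ m', 0 ≤ ind (m' ≠ m) * ind (A m' c) := fun m' =>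
    mul_nonneg (ind_nonneg _) (ind_nonneg _)
  by_cases hA : A m c
  · have hex : ∃ m, A m c := ⟨m, hA⟩
    simp only [hex, dif_pos]
    refine le_add_of_nonneg_of_le (ind_nonneg _) ?_
    by_cases hne : hex.choose ≠ m
    · refine le_trans ?_ (single_le_sum (fun m' _ => h₂ m') (mem_univ hex.choose))
      rw [ind_pos hne, ind_pos hex.choose_spec, one_mul]
    · rw [ind_neg hne]
      exact sum_nonneg fun m' _ => h₂ m'
  · rw [ind_pos hA]
    exact (ind_le_one _).trans (le_add_of_nonneg_right (sum_nonneg fun m' _ => h₂ m'))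

/-- A received word from `outLaw` passes the threshold test with probability at most `1 / g`. -/
theorem threshold_pass_le {κ o : 𝒞 → ℝ} (hκ : ∀ c, 0 ≤ κ c) 
    (hκ₁ : ∑ c, κ c = 1) {g : ℝ} (hg : 0 < g) {T : 𝒞 → Prop} (hT : ∀ c, T c → g * o c ≤ κ c) :
    ∑ c, o c * ind (T c) ≤ 1 / g := by
  rw [le_div_iff₀' hg, mul_sum]
  refine le_trans (sum_le_sum fun c _ => ?_) hκ₁.le
  by_cases h : T c
  · simpa [ind_pos h] using hT c h
  · simpa [ind_neg h] using hκ c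

/-- The threshold test of a multiple access code: each of the three information densities
exceeds its threshold. -/
def MacTest (p : 𝒜 → ℝ) (q : ℬ → ℝ) (K : 𝒜 → ℬ → 𝒞 → ℝ) (g₁ g₂ g₃ : ℝ) (a : 𝒜) (b : ℬ) (c : 𝒞) :
    Prop :=
  g₁ * outLaw p (fun a => K a b) c < K a b c ∧ g₂ * outLaw q (K a) c < K a b c ∧
    g₃ * outLaw (prodLaw p q) (fun x => K x.1 x.2) c < K a b c

/-- Random coding for the multiple access channel, in one-shot form. -/
theorem exists_mac_code {p : 𝒜 → ℝ} {q : ℬ → ℝ} {K : 𝒜 → ℬ → 𝒞 → ℝ}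
    (hp : p ∈ stdSimplex ℝ 𝒜) (hq : q ∈ stdSimplex ℝ ℬ) (hK : ∀ a b, K a b ∈ stdSimplex ℝ 𝒞)
    {g₁ g₂ g₃ : ℝ} (hg₁ : 0 < g₁) (hg₂ : 0 < g₂) (hg₃ : 0 < g₃)
    (M₁ M₂ : Type*) [Fintype M₁] [Fintype M₂] [Nonempty M₁] [Nonempty M₂] :
    ∃ (c₁ : M₁ → 𝒜) (c₂ : M₂ → ℬ) (dec : 𝒞 → M₁ × M₂),
      (∑ m₁, ∑ m₂, ∑ y, K (c₁ m₁) (c₂ m₂) y * ind (dec y ≠ (m₁, m₂))) /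
        (Fintype.card M₁ * Fintype.card M₂) ≤
      ∑ a, ∑ b, ∑ c, p a * q b * K a b c * ind (¬ MacTest p q K g₁ g₂ g₃ a b c) +
        (Fintype.card M₁ / g₁ + Fintype.card M₂ / g₂ +
          Fintype.card M₁ * Fintype.card M₂ / g₃) := by
  classical
  set T := MacTest p q K g₁ g₂ g₃ with hT
  set τ := ∑ a, ∑ b, ∑ c, p a * q b * K a b c * ind (¬ T a b c) with hτ
  set w₁ : (M₁ → 𝒜) → ℝ := fun c => ∏ m, p (c m)
  set w₂ : (M₂ → ℬ) → ℝ := fun c => ∏ m, q (c m)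
  have hw₁ : ∀ c, 0 ≤ w₁ c := fun c => prod_nonneg fun m _ => hp.1 _
  have hw₂ : ∀ c, 0 ≤ w₂ c := fun c => prod_nonneg fun m _ => hq.1 _
  have hs₁ : ∑ c, w₁ c = 1 := sum_pi_prod_eq_one (κ := fun _ => p) fun _ => hp.2
  have hs₂ : ∑ c, w₂ c = 1 := sum_pi_prod_eq_one (κ := fun _ => q) fun _ => hq.2
  choose dec hdec using fun c : (M₁ → 𝒜) × (M₂ → ℬ) =>
    exists_decoder (M := M₁ × M₂) (fun m => T (c.1 m.1) (c.2 m.2))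
  set F : 𝒜 → ℬ → ℝ := fun a b => ∑ y, K a b y * ind (¬ T a b y)
  set G : 𝒜 → ℬ → 𝒜 → ℬ → ℝ := fun a b a' b' => ∑ y, K a b y * ind (T a' b' y)
  -- the expected probability that a wrong message passes the test
  have hG₁ : ∀ b, ∑ a, ∑ a', p a * p a' * G a b a' b ≤ 1 / g₁ := by
    intro b
    have : ∀ a', ∑ a, p a * p a' * G a b a' b =
        p a' * ∑ y, outLaw p (fun a => K a b) y * ind (T a' b y) := by
      intro a'
      simp only [G, outLaw, mul_sum, sum_mul]
      rw [sum_comm]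
      exact sum_congr rfl fun y _ => sum_congr rfl fun a _ => by ring
    rw [sum_comm]
    simp_rw [this]
    calc _ ≤ ∑ a', p a' * (1 / g₁) := sum_le_sum fun a' _ => mul_le_mul_of_nonneg_left
          (threshold_pass_le (hK a' b).1 (hK a' b).2 hg₁
            fun c hc => hc.1.le) (hp.1 a')
      _ = 1 / g₁ := by rw [← sum_mul, hp.2, one_mul]
  have hG₂ : ∀ a, ∑ b, ∑ b', q b * q b' * G a b a b' ≤ 1 / g₂ := by
    intro a
    have : ∀ b', ∑ b, q b * q b' * G a b a b' =
        q b' * ∑ y, outLaw q (K a) y * ind (T a b' y) := by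
      intro b'
      simp only [G, outLaw, mul_sum, sum_mul]
      rw [sum_comm]
      exact sum_congr rfl fun y _ => sum_congr rfl fun b _ => by ring
    rw [sum_comm]
    simp_rw [this]
    calc _ ≤ ∑ b', q b' * (1 / g₂) := sum_le_sum fun b' _ => mul_le_mul_of_nonneg_left
          (threshold_pass_le (hK a b').1 (hK a b').2 hg₂
            fun c hc => hc.2.1.le) (hq.1 b')
      _ = 1 / g₂ := by rw [← sum_mul, hq.2, one_mul]
  have hG₃ : ∑ b, ∑ b', ∑ a, ∑ a', q b * q b' * (p a * p a') * G a b a' b' ≤ 1 / g₃ := by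
    have : ∀ a' b', ∑ a, ∑ b, q b * q b' * (p a * p a') * G a b a' b' = p a' * q b' *
        ∑ y, outLaw (prodLaw p q) (fun x => K x.1 x.2) y * ind (T a' b' y) := by
      intro a' b'
      simp only [G, outLaw, prodLaw, mul_sum, sum_mul, Fintype.sum_prod_type]
      conv_lhs =>
        enter [2, a]
        rw [sum_comm]
      rw [sum_comm]
      exact sum_congr rfl fun y _ => sum_congr rfl fun a _ => sum_congr rfl fun b _ => by ring
    have h₁ : ∑ b, ∑ b', ∑ a, ∑ a', q b * q b' * (p a * p a') * G a b a' b' =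
        ∑ a', ∑ b', ∑ a, ∑ b, q b * q b' * (p a * p a') * G a b a' b' := by
      rw [sum_comm]
      conv_lhs =>
        enter [2, b']
        rw [sum_comm]
        enter [2, a]
        rw [sum_comm]
      conv_lhs =>
        enter [2, b']
        rw [sum_comm]
      rw [sum_comm]
    rw [h₁]
    simp_rw [this]
    calc _ ≤ ∑ a', ∑ b', p a' * q b' * (1 / g₃) := sum_le_sum fun a' _ => sum_le_sum fun b' _ =>
          mul_le_mul_of_nonneg_left (threshold_pass_le (hK a' b').1
            (hK a' b').2 hg₃ fun c hc => hc.2.2.le) (mul_nonneg (hp.1 a') (hq.1 b'))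
      _ = 1 / g₃ := by simp only [← sum_mul, ← mul_sum, hq.2, hp.2, one_mul]
  -- expected error probability of one message pair
  have key : ∀ m₁ m₂, ∑ c₁, ∑ c₂, w₁ c₁ * w₂ c₂ * ∑ y, K (c₁ m₁) (c₂ m₂) y *
      ind (dec (c₁, c₂) y ≠ (m₁, m₂)) ≤ τ + (Fintype.card M₁ / g₁ +
        Fintype.card M₂ / g₂ + Fintype.card M₁ * Fintype.card M₂ / g₃) := by
    intro m₁ m₂
    have hE : ∀ Φ : 𝒜 → ℬ → ℝ, ∑ c₁, ∑ c₂, w₁ c₁ * w₂ c₂ * Φ (c₁ m₁) (c₂ m₂) =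
        ∑ a, ∑ b, p a * q b * Φ a b := by
      intro Φ
      have : ∀ c₁ : M₁ → 𝒜, ∑ c₂, w₁ c₁ * w₂ c₂ * Φ (c₁ m₁) (c₂ m₂) =
          w₁ c₁ * ∑ b, q b * Φ (c₁ m₁) b := by
        intro c₁
        rw [← sum_pi_eval (κ := fun _ => q) (fun _ => hq.2) m₂ (Φ (c₁ m₁)), mul_sum]
        exact sum_congr rfl fun c₂ _ => by simp only [w₂]; ring
      simp_rw [this]
      rw [sum_pi_eval (κ := fun _ => p) (fun _ => hp.2) m₁ (fun a => ∑ b, q b * Φ a b)]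
      simp only [mul_sum, mul_assoc]
    have hF : ∑ c₁, ∑ c₂, w₁ c₁ * w₂ c₂ * F (c₁ m₁) (c₂ m₂) = τ := by
      rw [hE, hτ]
      simp only [F, mul_sum, mul_assoc]
    have hm : ∀ m' : M₁ × M₂, ind (m' ≠ (m₁, m₂)) *
        ∑ c₁, ∑ c₂, w₁ c₁ * w₂ c₂ * G (c₁ m₁) (c₂ m₂) (c₁ m'.1) (c₂ m'.2) ≤
        ind (m'.2 = m₂) * (1 / g₁) + ind (m'.1 = m₁) * (1 / g₂) + 1 / g₃ := by
      rintro ⟨m₁', m₂'⟩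
      have e1 : (0 : ℝ) ≤ 1 / g₁ := by positivity
      have e2 : (0 : ℝ) ≤ 1 / g₂ := by positivity
      have e3 : (0 : ℝ) ≤ 1 / g₃ := by positivity
      have f1 : 0 ≤ ind (m₂' = m₂) * (1 / g₁) := mul_nonneg (ind_nonneg _) e1
      have f2 : 0 ≤ ind (m₁' = m₁) * (1 / g₂) := mul_nonneg (ind_nonneg _) e2
      by_cases h1 : m₁' = m₁
      · by_cases h2 : m₂' = m₂
        · rw [h1, h2, ind_neg (by simp), zero_mul]
          rw [h1] at f2
          rw [h2] at f1
          linarith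
        · -- only the second message is wrong
          subst h1
          have : ∀ c₁ : M₁ → 𝒜, ∑ c₂, w₁ c₁ * w₂ c₂ * G (c₁ m₁') (c₂ m₂) (c₁ m₁') (c₂ m₂') =
              w₁ c₁ * ∑ b, ∑ b', q b * q b' * G (c₁ m₁') b (c₁ m₁') b' := by
            intro c₁
            rw [← sum_pi_eval₂ (κ := fun _ => q) (fun _ => hq.2) (Ne.symm h2)
              (fun b b' => G (c₁ m₁') b (c₁ m₁') b'), mul_sum]
            exact sum_congr rfl fun c₂ _ => by simp only [w₂]; ring
          simp_rw [this]
          have : ∑ c₁, w₁ c₁ * ∑ b, ∑ b', q b * q b' * G (c₁ m₁') b (c₁ m₁') b' ≤ 1 / g₂ := by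
            calc _ ≤ ∑ c₁, w₁ c₁ * (1 / g₂) :=
                  sum_le_sum fun c₁ _ => mul_le_mul_of_nonneg_left (hG₂ _) (hw₁ c₁)
              _ = 1 / g₂ := by rw [← sum_mul, hs₁, one_mul]
          have h3 : (m₁', m₂') ≠ (m₁', m₂) := by simpa using h2
          rw [ind_pos h3, one_mul, ind_pos trivial, one_mul]
          linarith
      · have h3 : (m₁', m₂') ≠ (m₁, m₂) := fun h => h1 (Prod.mk.inj h).1
        rw [ind_pos h3, one_mul]
        by_cases h2 : m₂' = m₂
        · -- only the first message is wrong
          subst h2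
          have : ∀ c₂ : M₂ → ℬ, ∑ c₁, w₁ c₁ * w₂ c₂ * G (c₁ m₁) (c₂ m₂') (c₁ m₁') (c₂ m₂') =
              w₂ c₂ * ∑ a, ∑ a', p a * p a' * G a (c₂ m₂') a' (c₂ m₂') := by
            intro c₂
            rw [← sum_pi_eval₂ (κ := fun _ => p) (fun _ => hp.2) (Ne.symm h1)
              (fun a a' => G a (c₂ m₂') a' (c₂ m₂')), mul_sum]
            exact sum_congr rfl fun c₁ _ => by simp only [w₁]; ring
          rw [sum_comm]
          simp_rw [this]
          have : ∑ c₂, w₂ c₂ * ∑ a, ∑ a', p a * p a' * G a (c₂ m₂') a' (c₂ m₂') ≤ 1 / g₁ := by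
            calc _ ≤ ∑ c₂, w₂ c₂ * (1 / g₁) :=
                  sum_le_sum fun c₂ _ => mul_le_mul_of_nonneg_left (hG₁ _) (hw₂ c₂)
              _ = 1 / g₁ := by rw [← sum_mul, hs₂, one_mul]
          rw [ind_pos trivial, one_mul]
          linarith
        · have : ∀ c₂ : M₂ → ℬ, ∑ c₁, w₁ c₁ * w₂ c₂ * G (c₁ m₁) (c₂ m₂) (c₁ m₁') (c₂ m₂') =
              w₂ c₂ * ∑ a, ∑ a', p a * p a' * G a (c₂ m₂) a' (c₂ m₂') := by
            intro c₂
            rw [← sum_pi_eval₂ (κ := fun _ => p) (fun _ => hp.2) (Ne.symm h1)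
              (fun a a' => G a (c₂ m₂) a' (c₂ m₂')), mul_sum]
            exact sum_congr rfl fun c₁ _ => by simp only [w₁]; ring
          rw [sum_comm]
          simp_rw [this]
          rw [sum_pi_eval₂ (κ := fun _ => q) (fun _ => hq.2) (Ne.symm h2)
            (fun b b' => ∑ a, ∑ a', p a * p a' * G a b a' b')]
          simp only [mul_sum, ← mul_assoc] at hG₃ ⊢
          linarith
    have hsum : ∑ m' : M₁ × M₂, (ind (m'.2 = m₂) * (1 / g₁) +
        ind (m'.1 = m₁) * (1 / g₂) + 1 / g₃) = Fintype.card M₁ / g₁ +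
        Fintype.card M₂ / g₂ + Fintype.card M₁ * Fintype.card M₂ / g₃ := by
      rw [sum_add_distrib, sum_add_distrib, Fintype.sum_prod_type, Fintype.sum_prod_type,
        Fintype.sum_prod_type]
      simp only [← sum_mul, sum_ind_eq, sum_const, card_univ, nsmul_eq_mul, ← mul_sum]
      ring
    calc _ ≤ ∑ c₁, ∑ c₂, w₁ c₁ * w₂ c₂ * (F (c₁ m₁) (c₂ m₂) + ∑ m' : M₁ × M₂,
          ind (m' ≠ (m₁, m₂)) * G (c₁ m₁) (c₂ m₂) (c₁ m'.1) (c₂ m'.2)) :=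
          sum_le_sum fun c₁ _ => sum_le_sum fun c₂ _ => mul_le_mul_of_nonneg_left
            (hdec (c₁, c₂) _ (hK _ _).1 (m₁, m₂)) (mul_nonneg (hw₁ c₁) (hw₂ c₂))
      _ = τ + ∑ m' : M₁ × M₂, (ind (m' ≠ (m₁, m₂)) *
            ∑ c₁, ∑ c₂, w₁ c₁ * w₂ c₂ * G (c₁ m₁) (c₂ m₂) (c₁ m'.1) (c₂ m'.2)) := by
          simp only [mul_add, sum_add_distrib, hF, mul_sum]
          congr 1
          conv_lhs =>
            enter [2, c₁]
            rw [sum_comm]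
          rw [sum_comm]
          exact sum_congr rfl fun m' _ => sum_congr rfl fun c₁ _ => sum_congr rfl fun c₂ _ => by
            ring
      _ ≤ _ := by
          rw [← hsum]
          exact add_le_add le_rfl (sum_le_sum fun m' _ => hm m')
  obtain ⟨⟨c₁, c₂⟩, _, hc⟩ := exists_le_of_sum_le
    (w := fun c : (M₁ → 𝒜) × (M₂ → ℬ) => w₁ c.1 * w₂ c.2)
    (F := fun c => (∑ m₁, ∑ m₂, ∑ y, K (c.1 m₁) (c.2 m₂) y *
      ind (dec c y ≠ (m₁, m₂))) / (Fintype.card M₁ * Fintype.card M₂))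
    (b := τ + (Fintype.card M₁ / g₁ +
        Fintype.card M₂ / g₂ + Fintype.card M₁ * Fintype.card M₂ / g₃))
    (fun c => mul_nonneg (hw₁ _) (hw₂ _))
    (by simp only [Fintype.sum_prod_type, ← mul_sum, hs₂, mul_one, hs₁]) (by
      have hM : (0 : ℝ) < Fintype.card M₁ * Fintype.card M₂ := by
        have := Fintype.card_pos (α := M₁)
        have := Fintype.card_pos (α := M₂)
        positivity
      simp only [mul_div_assoc', ← sum_div]
      rw [div_le_iff₀ hM]
      simp only [mul_sum]
      rw [sum_comm]
      calc _ ≤ ∑ m₁ : M₁, ∑ m₂ : M₂, (τ + (Fintype.card M₁ / g₁ +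
        Fintype.card M₂ / g₂ + Fintype.card M₁ * Fintype.card M₂ / g₃)) := by
            refine sum_le_sum fun m₁ _ => ?_
            rw [sum_comm]
            refine sum_le_sum fun m₂ _ => ?_
            refine le_trans (le_of_eq ?_) (key m₁ m₂)
            simp only [Fintype.sum_prod_type, mul_sum]
        _ = _ := by simp only [sum_const, card_univ, nsmul_eq_mul]; ring)
  exact ⟨c₁, c₂, dec (c₁, c₂), hc⟩

end OneShot

section OneShotWiretap

variable {𝒜 𝒞 𝒟 : Type*} [Fintype 𝒜] [Fintype 𝒞] [Fintype 𝒟]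

/-- Soft covering: the expected divergence between the output law of a random codebook with `|L|`
codewords and the output law of the input distribution. -/
theorem soft_covering {p : 𝒜 → ℝ} {E : 𝒜 → 𝒟 → ℝ} (hp : p ∈ stdSimplex ℝ 𝒜)
    (hE : ∀ a, E a ∈ stdSimplex ℝ 𝒟) {M L : Type*} [Fintype M] [DecidableEq M] [Fintype L]
    [Nonempty L] {e : L → M} (he : e.Injective) :
    ∑ c : M → 𝒜, (∏ m, p (c m)) * ∑ z, (∑ l, E (c (e l)) z) / Fintype.card L *
      Real.log ((∑ l, E (c (e l)) z) / Fintype.card L / outLaw p E z) ≤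
    ∑ a, ∑ z, p a * E a z * Real.log (1 + E a z / (Fintype.card L * outLaw p E z)) := by
  classical
  set o := outLaw p E with ho
  set N : ℝ := ((Fintype.card L : ℕ) : ℝ) with hN
  have hN1 : 1 ≤ N := by
    rw [hN]
    exact_mod_cast Fintype.card_pos (α := L)
  have hN0 : 0 < N := by linarith
  have hom : o ∈ stdSimplex ℝ 𝒟 := outLaw_mem hp hE
  set v : 𝒜 → 𝒟 → ℝ := fun a z => 1 + E a z / (N * o z) with hv
  have hv1 : ∀ a z, 1 ≤ v a z := fun a z => by
    have : 0 ≤ E a z / (N * o z) := div_nonneg ((hE a).1 z) (mul_nonneg hN0.le (hom.1 z))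
    simp only [hv]; linarith
  set w : (M → 𝒜) → ℝ := fun c => ∏ m, p (c m) with hw
  have hw0 : ∀ c, 0 ≤ w c := fun c => prod_nonneg fun m _ => hp.1 _
  have hw1 : ∑ c, w c = 1 := sum_pi_prod_eq_one (κ := fun _ => p) fun _ => hp.2
  set A : 𝒜 → ℝ := fun a => ∑ z, E a z * Real.log (v a z) with hA
  set H : 𝒜 → 𝒜 → ℝ := fun a a' => ∑ z, E a z / v a z * (E a' z / (N * o z)) with hH
  -- `log u ≤ log v + u / v - 1`, with `v` depending on a single codeword only
  have h₁ : ∀ c, w c * ∑ z, (∑ l, E (c (e l)) z) / N *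
      Real.log ((∑ l, E (c (e l)) z) / N / o z) ≤
      w c * ((1 / N) * ∑ l, (A (c (e l)) + ∑ l', H (c (e l)) (c (e l')) - 1)) := by
    intro c
    rcases (hw0 c).eq_or_lt with h0 | h0
    · simp [← h0]
    refine mul_le_mul_of_nonneg_left ?_ h0.le
    have hpc : ∀ m, 0 < p (c m) := fun m => lt_of_le_of_ne (hp.1 _) fun h =>
      h0.ne' (prod_eq_zero (mem_univ m) h.symm)
    set u : 𝒟 → ℝ := fun z => (∑ l, E (c (e l)) z) / N / o z with hu
    have hterm : ∀ l z, E (c (e l)) z * Real.log (u z) ≤ E (c (e l)) z * Real.log (v (c (e l)) z) +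
        E (c (e l)) z / v (c (e l)) z * u z - E (c (e l)) z := by
      intro l z
      rcases ((hE (c (e l))).1 z).eq_or_lt with hz | hz
      · simp [← hz]
      have hoz : 0 < o z := outLaw_pos hp.1 (fun a => (hE a).1) (mul_pos (hpc (e l)) hz).ne'
      have hsum : 0 < ∑ l, E (c (e l)) z := hz.trans_le
        (single_le_sum (f := fun l => E (c (e l)) z) (fun l _ => (hE _).1 z) (mem_univ l))
      have huz : 0 < u z := by simp only [hu]; positivity
      have hvz : 0 < v (c (e l)) z := by linarith [hv1 (c (e l)) z]
      have := Real.log_le_sub_one_of_pos (div_pos huz hvz)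
      rw [Real.log_div huz.ne' hvz.ne'] at this
      have h2 := mul_le_mul_of_nonneg_left this hz.le
      have h3 : E (c (e l)) z * (u z / v (c (e l)) z - 1) =
        E (c (e l)) z / v (c (e l)) z * u z - E (c (e l)) z := by ring
      rw [h3] at h2
      linarith
    calc ∑ z, (∑ l, E (c (e l)) z) / N * Real.log (u z)
        = (1 / N) * ∑ l, ∑ z, E (c (e l)) z * Real.log (u z) := by
          rw [sum_comm, mul_sum]
          refine sum_congr rfl fun z _ => ?_
          rw [← sum_mul]; ring
      _ ≤ (1 / N) * ∑ l, ∑ z, (E (c (e l)) z * Real.log (v (c (e l)) z) +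
            E (c (e l)) z / v (c (e l)) z * u z - E (c (e l)) z) :=
          mul_le_mul_of_nonneg_left (sum_le_sum fun l _ => sum_le_sum fun z _ => hterm l z)
            (by positivity)
      _ = _ := by
          congr 1
          refine sum_congr rfl fun l _ => ?_
          rw [sum_sub_distrib, sum_add_distrib, (hE _).2]
          congr 2
          simp only [hH]
          rw [sum_comm]
          refine sum_congr rfl fun z _ => ?_
          rw [← mul_sum]
          simp only [hu]
          rw [div_div, ← sum_div]
  have hEA : ∀ m, ∑ c, w c * A (c m) = ∑ a, p a * A a := fun m =>
    sum_pi_eval (κ := fun _ => p) (fun _ => hp.2) m A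
  have hH' : ∀ a, ∑ a', p a' * H a a' ≤ ∑ z, E a z / v a z * (1 / N) := by
    intro a
    have : ∑ a', p a' * H a a' = ∑ z, E a z / v a z * (o z / (N * o z)) := by
      simp only [hH, mul_sum]
      rw [sum_comm]
      refine sum_congr rfl fun z _ => ?_
      conv_rhs => rw [show o z / (N * o z) = (∑ a', p a' * E a' z) / (N * o z) from rfl, sum_div,
        mul_sum]
      exact sum_congr rfl fun a' _ => by ring
    rw [this]
    refine sum_le_sum fun z _ => mul_le_mul_of_nonneg_left ?_
      (div_nonneg ((hE a).1 z) (by linarith [hv1 a z]))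
    rcases (hom.1 z).eq_or_lt with hz | hz
    · simp only [← hz, zero_div]; positivity
    · refine le_of_eq ?_; field_simp
  have hEH : ∀ l, ∑ l', ∑ c, w c * H (c (e l)) (c (e l')) ≤ 1 := by
    intro l
    rw [← Finset.add_sum_erase univ _ (mem_univ l)]
    have h2 : ∑ c, w c * H (c (e l)) (c (e l)) = ∑ a, p a * H a a :=
      sum_pi_eval (κ := fun _ => p) (fun _ => hp.2) (e l) (fun a => H a a)
    have h3 : ∀ l' ∈ univ.erase l, ∑ c, w c * H (c (e l)) (c (e l')) ≤
        ∑ a, p a * ∑ z, E a z / v a z * (1 / N) := by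
      intro l' hl'
      rw [sum_pi_eval₂ (κ := fun _ => p) (fun _ => hp.2) (he.ne (ne_of_mem_erase hl').symm) H]
      refine sum_le_sum fun a _ => ?_
      simp only [mul_assoc]
      rw [← mul_sum]
      exact mul_le_mul_of_nonneg_left (hH' a) (hp.1 a)
    have h4 := sum_le_sum h3
    rw [sum_const, card_erase_of_mem (mem_univ l), card_univ, nsmul_eq_mul,
      Nat.cast_sub Fintype.card_pos, ← hN, Nat.cast_one] at h4
    rw [h2]
    calc _ ≤ ∑ a, p a * H a a + (N - 1) * ∑ a, p a * ∑ z, E a z / v a z * (1 / N) := by linarith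
      _ = ∑ a, p a * ∑ z, E a z / v a z * (E a z / (N * o z) + (N - 1) * (1 / N)) := by
          rw [mul_sum, ← sum_add_distrib]
          refine sum_congr rfl fun a _ => ?_
          simp only [hH, mul_add, sum_add_distrib, mul_sum]
          congr 1
          exact sum_congr rfl fun z _ => by ring
      _ ≤ ∑ a, p a * ∑ z, E a z := by
          refine sum_le_sum fun a _ => mul_le_mul_of_nonneg_left (sum_le_sum fun z _ => ?_) (hp.1 a)
          have h5 := hv1 a z
          rw [div_mul_eq_mul_div, div_le_iff₀ (by linarith)]
          refine mul_le_mul_of_nonneg_left ?_ ((hE a).1 z)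
          have : (N - 1) * (1 / N) ≤ 1 := by rw [mul_one_div, div_le_one hN0]; linarith
          simp only [hv]; linarith
      _ = 1 := by simp only [(hE _).2, mul_one, hp.2]
  calc _ ≤ ∑ c, w c * ((1 / N) * ∑ l, (A (c (e l)) + ∑ l', H (c (e l)) (c (e l')) - 1)) :=
        sum_le_sum fun c _ => h₁ c
    _ = (1 / N) * ∑ l, (∑ c, w c * A (c (e l)) + ∑ l', ∑ c, w c * H (c (e l)) (c (e l')) - 1) := by
        have : ∀ c, w c * ((1 / N) * ∑ l, (A (c (e l)) + ∑ l', H (c (e l)) (c (e l')) - 1)) =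
            (1 / N) * ∑ l, (w c * A (c (e l)) + ∑ l', w c * H (c (e l)) (c (e l')) - w c) := by
          intro c
          rw [mul_left_comm, mul_sum]
          congr 1
          exact sum_congr rfl fun l _ => by rw [← mul_sum]; ring
        simp_rw [this]
        rw [← mul_sum, sum_comm]
        congr 1
        refine sum_congr rfl fun l _ => ?_
        rw [sum_sub_distrib, sum_add_distrib, hw1, sum_comm]
    _ ≤ (1 / N) * ∑ l : L, (∑ a, p a * A a) := by
        refine mul_le_mul_of_nonneg_left (sum_le_sum fun l _ => ?_) (by positivity)
        have := hEH l
        rw [hEA]; linarith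
    _ = ∑ a, p a * A a := by
        rw [sum_const, card_univ, nsmul_eq_mul, ← hN]
        field_simp
    _ = _ := by
        simp only [hA, mul_sum, hv, mul_assoc]

/-- Random coding for the point-to-point channel, in one-shot form: the error probability averaged
over all codebooks. -/
theorem random_code_error {p : 𝒜 → ℝ} {K : 𝒜 → 𝒞 → ℝ} (hp : p ∈ stdSimplex ℝ 𝒜)
    (hK : ∀ a, K a ∈ stdSimplex ℝ 𝒞) {g : ℝ} (hg : 0 < g) (M : Type*) [Fintype M] [DecidableEq M]
    [Nonempty M] : ∃ dec : (M → 𝒜) → 𝒞 → M,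
      ∑ c : M → 𝒜, (∏ m, p (c m)) * ((∑ m, ∑ y, K (c m) y * ind (dec c y ≠ m)) / Fintype.card M) ≤
      ∑ a, ∑ y, p a * K a y * ind (¬ g * outLaw p K y < K a y) + Fintype.card M / g := by
  set T : 𝒜 → 𝒞 → Prop := fun a y => g * outLaw p K y < K a y with hT
  choose dec hdec using fun c : M → 𝒜 => exists_decoder (M := M) (fun m => T (c m))
  refine ⟨dec, ?_⟩
  set w : (M → 𝒜) → ℝ := fun c => ∏ m, p (c m) with hw
  have hw0 : ∀ c, 0 ≤ w c := fun c => prod_nonneg fun m _ => hp.1 _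
  have hM : (0 : ℝ) < Fintype.card M := by exact_mod_cast Fintype.card_pos
  set F : 𝒜 → ℝ := fun a => ∑ y, K a y * ind (¬ T a y) with hF
  set G : 𝒜 → 𝒜 → ℝ := fun a a' => ∑ y, K a y * ind (T a' y) with hG
  have hG₁ : ∑ a, ∑ a', p a * p a' * G a a' ≤ 1 / g := by
    have : ∀ a', ∑ a, p a * p a' * G a a' = p a' * ∑ y, outLaw p K y * ind (T a' y) := by
      intro a'
      simp only [hG, outLaw, mul_sum, sum_mul]
      rw [sum_comm]
      exact sum_congr rfl fun y _ => sum_congr rfl fun a _ => by ring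
    rw [sum_comm]
    simp_rw [this]
    calc _ ≤ ∑ a', p a' * (1 / g) := sum_le_sum fun a' _ => mul_le_mul_of_nonneg_left
          (threshold_pass_le (hK a').1 (hK a').2 hg fun c hc => hc.le) (hp.1 a')
      _ = 1 / g := by rw [← sum_mul, hp.2, one_mul]
  have key : ∀ m, ∑ c, w c * ∑ y, K (c m) y * ind (dec c y ≠ m) ≤
      ∑ a, p a * F a + Fintype.card M / g := by
    intro m
    have hm : ∀ m', ind (m' ≠ m) * ∑ c, w c * G (c m) (c m') ≤ 1 / g := by
      intro m'
      by_cases h : m' = m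
      · rw [ind_neg (by simpa using h), zero_mul]; positivity
      · rw [ind_pos h, one_mul, sum_pi_eval₂ (κ := fun _ => p) (fun _ => hp.2) (Ne.symm h) G]
        exact hG₁
    calc _ ≤ ∑ c, w c * (F (c m) + ∑ m', ind (m' ≠ m) * G (c m) (c m')) :=
          sum_le_sum fun c _ => mul_le_mul_of_nonneg_left (hdec c _ (hK _).1 m) (hw0 c)
      _ = ∑ a, p a * F a + ∑ m', ind (m' ≠ m) * ∑ c, w c * G (c m) (c m') := by
          simp only [mul_add, sum_add_distrib, mul_sum]
          congr 1
          · rw [← sum_pi_eval (κ := fun _ => p) (fun _ => hp.2) m F]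
          · rw [sum_comm]
            exact sum_congr rfl fun m' _ => sum_congr rfl fun c _ => by ring
      _ ≤ ∑ a, p a * F a + ∑ m' : M, 1 / g := add_le_add le_rfl (sum_le_sum fun m' _ => hm m')
      _ = _ := by rw [sum_const, card_univ, nsmul_eq_mul, mul_one_div]
  have hF' : ∑ a, p a * F a = ∑ a, ∑ y, p a * K a y * ind (¬ T a y) := by
    simp only [hF, mul_sum, mul_assoc]
  rw [← hF']
  simp only [mul_div_assoc', ← sum_div]
  rw [div_le_iff₀ hM]
  simp only [mul_sum]
  rw [sum_comm]
  calc _ ≤ ∑ m : M, (∑ a, p a * F a + Fintype.card M / g) := by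
        refine sum_le_sum fun m _ => le_trans (le_of_eq ?_) (key m)
        simp only [mul_sum, hw]
    _ = _ := by rw [sum_const, card_univ, nsmul_eq_mul, mul_comm]

/-- Wiretap codes, in one-shot form: messages in `W`, local randomness in `L`. -/
theorem exists_wiretap_code {p : 𝒜 → ℝ} {K : 𝒜 → 𝒞 → ℝ} {E : 𝒜 → 𝒟 → ℝ}
    (hp : p ∈ stdSimplex ℝ 𝒜) (hK : ∀ a, K a ∈ stdSimplex ℝ 𝒞) (hE : ∀ a, E a ∈ stdSimplex ℝ 𝒟)
    {g : ℝ} (hg : 0 < g) (W L : Type*) [Fintype W] [Fintype L] [Nonempty W] [Nonempty L]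
    {ε δ : ℝ} (hε : 0 < ε) (hδ : 0 < δ)
    (hε' : ∑ a, ∑ y, p a * K a y * ind (¬ g * outLaw p K y < K a y) +
      Fintype.card W * Fintype.card L / g ≤ ε)
    (hδ' : ∑ a, ∑ z, p a * E a z * Real.log (1 + E a z / (Fintype.card L * outLaw p E z)) ≤ δ) :
    ∃ (c : W × L → 𝒜) (dec : 𝒞 → W × L), (∀ m z, E (c m) z ≠ 0 → outLaw p E z ≠ 0) ∧
      (∑ m, ∑ y, K (c m) y * ind (dec y ≠ m)) / (Fintype.card W * Fintype.card L) ≤ 2 * ε ∧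
      (∑ w, ∑ z, (∑ l, E (c (w, l)) z) / Fintype.card L *
        Real.log ((∑ l, E (c (w, l)) z) / Fintype.card L / outLaw p E z)) / Fintype.card W ≤
        2 * δ := by
  classical
  obtain ⟨dec, hdec⟩ := random_code_error hp hK hg (W × L)
  have hom := outLaw_mem hp hE
  have hW : (0 : ℝ) < Fintype.card W := by exact_mod_cast Fintype.card_pos
  have hL : (0 : ℝ) < Fintype.card L := by exact_mod_cast Fintype.card_pos
  rw [Fintype.card_prod, Nat.cast_mul] at hdec
  set err : (W × L → 𝒜) → ℝ := fun c =>
    (∑ m, ∑ y, K (c m) y * ind (dec c y ≠ m)) / (Fintype.card W * Fintype.card L) with herr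
  set D : (W × L → 𝒜) → W → ℝ := fun c w => ∑ z, (∑ l, E (c (w, l)) z) / Fintype.card L *
        Real.log ((∑ l, E (c (w, l)) z) / Fintype.card L / outLaw p E z) with hD
  set wt : (W × L → 𝒜) → ℝ := fun c => ∏ m, p (c m) with hwt
  have hcov : ∑ c, wt c * ((∑ w, D c w) / Fintype.card W) ≤ δ := by
    simp only [mul_div_assoc', ← sum_div]
    rw [div_le_iff₀ hW]
    simp only [mul_sum]
    rw [sum_comm]
    calc _ ≤ ∑ w : W, δ := sum_le_sum fun w _ =>
          (soft_covering hp hE (e := fun l : L => (w, l)) fun l l' h => by simpa using h).trans hδ'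
      _ = _ := by rw [sum_const, card_univ, nsmul_eq_mul, mul_comm]
  -- the error probability and the leakage are controlled by the same codebook
  obtain ⟨c, hc, hle⟩ := exists_le_of_sum_le (w := wt)
    (F := fun c => err c / ε + (∑ w, D c w) / Fintype.card W / δ) (b := 2)
    (fun c => prod_nonneg fun m _ => hp.1 _)
    (sum_pi_prod_eq_one (κ := fun _ => p) fun _ => hp.2) (by
      simp only [mul_add, sum_add_distrib, mul_div_assoc', ← sum_div]
      have h1 : (∑ c, wt c * err c) / ε ≤ 1 := by
        rw [div_le_one hε]; exact hdec.trans hε'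
      have h2 : (∑ c, wt c * ∑ w, D c w) / Fintype.card W / δ ≤ 1 := by
        rw [div_le_one hδ]
        refine le_trans (le_of_eq ?_) hcov
        simp only [mul_div_assoc', ← sum_div]
      linarith)
  have hpc : ∀ m, 0 < p (c m) := fun m => lt_of_le_of_ne (hp.1 _) fun h =>
    hc.ne' (prod_eq_zero (mem_univ m) h.symm)
  have hac : ∀ m z, E (c m) z ≠ 0 → outLaw p E z ≠ 0 := fun m z h =>
    (outLaw_pos hp.1 (fun a => (hE a).1) (mul_ne_zero (hpc m).ne' h)).ne'
  have herr0 : 0 ≤ err c := div_nonneg (sum_nonneg fun m _ => sum_nonneg fun y _ =>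
    mul_nonneg ((hK _).1 y) (ind_nonneg _)) (by positivity)
  have hD0 : 0 ≤ (∑ w, D c w) / Fintype.card W := by
    refine div_nonneg (sum_nonneg fun w _ => ?_) hW.le
    refine gibbs (P := fun z => (∑ l, E (c (w, l)) z) / Fintype.card L) (Q := outLaw p E)
      (fun z => div_nonneg (sum_nonneg fun l _ => (hE _).1 z) hL.le) hom.1 (fun z hz => ?_) ?_
    · obtain ⟨l, _, hl⟩ := exists_ne_zero_of_sum_ne_zero (div_ne_zero_iff.1 hz).1
      exact hac _ _ hl
    · rw [hom.2, ← sum_div, sum_comm]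
      simp [(hE _).2]
  refine ⟨c, dec c, hac, ?_, ?_⟩
  · have : 0 ≤ (∑ w, D c w) / Fintype.card W / δ := div_nonneg hD0 hδ.le
    rw [← div_le_iff₀ hε]
    exact le_trans (le_add_of_nonneg_right this) hle
  · have : 0 ≤ err c / ε := div_nonneg herr0 hε.le
    rw [← div_le_iff₀ hδ]
    exact le_trans (le_add_of_nonneg_left this) hle

end OneShotWiretap

/-! ### Block codes for memoryless channels -/

section Memoryless

variable {ι α β γ Ω : Type*} [Fintype ι] [DecidableEq ι] [Fintype α] [Fintype β] [Fintype γ]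
  [Fintype Ω]

/-- The product law of independent letters. -/
def piLaw (p : α → ℝ) (x : ι → α) : ℝ := ∏ t, p (x t)

theorem prod_mem_stdSimplex {κ : ι → α → ℝ} (h : ∀ t, κ t ∈ stdSimplex ℝ α) :
    (fun x : ι → α => ∏ t, κ t (x t)) ∈ stdSimplex ℝ (ι → α) :=
  ⟨fun _ => prod_nonneg fun t _ => (h t).1 _, sum_pi_prod_eq_one fun t => (h t).2⟩

theorem piLaw_mem {p : α → ℝ} (hp : p ∈ stdSimplex ℝ α) :
    (piLaw p : (ι → α) → ℝ) ∈ stdSimplex ℝ (ι → α) :=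
  prod_mem_stdSimplex fun _ => hp

omit [Fintype β] in
theorem outLaw_prod (p : α → ℝ) (W : ι → α → β → ℝ) (y : ι → β) :
    outLaw (piLaw p) (fun (x : ι → α) (y : ι → β) => ∏ t, W t (x t) (y t)) y =
      ∏ t, outLaw p (W t) (y t) := by
  simp only [outLaw, piLaw, ← prod_mul_distrib]
  exact sum_pi_prod fun t a => p a * W t a (y t)

/-- The variance of `f` under `P`, around `μ`. -/
def varAt (P : Ω → ℝ) (f : Ω → ℝ) (μ : ℝ) : ℝ := ∑ ω, P ω * (f ω - μ) ^ 2

theorem varAt_nonneg {P : Ω → ℝ} (hP : P ∈ stdSimplex ℝ Ω) (f : Ω → ℝ) (μ : ℝ) :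
    0 ≤ varAt P f μ := sum_nonneg fun ω _ => mul_nonneg (hP.1 ω) (sq_nonneg _)

theorem sum_pi_dev_sq {P : Ω → ℝ} (hP : P ∈ stdSimplex ℝ Ω) {f : Ω → ℝ} {μ : ℝ}
    (hμ : ∑ ω, P ω * f ω = μ) :
    ∑ x : ι → Ω, piLaw P x * (∑ t, f (x t) - Fintype.card ι * μ) ^ 2 =
      Fintype.card ι * varAt P f μ := by
  have := sum_pi_sq (ι := ι) hP.2 (g := fun ω => f ω - μ) (by
    simp only [mul_sub, sum_sub_distrib, hμ, ← sum_mul, hP.2, one_mul, sub_self])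
  simpa [sum_sub_distrib, piLaw, varAt] using this

/-- Chebyshev's inequality for the lower tail of a sum of independent terms. -/
theorem lower_tail_le {P : Ω → ℝ} (hP : P ∈ stdSimplex ℝ Ω) {f : Ω → ℝ} {μ δ : ℝ}
    (hμ : ∑ ω, P ω * f ω = μ) (hδ : 0 < δ) (hι : 0 < Fintype.card ι) :
    ∑ x : ι → Ω, piLaw P x * ind (∑ t, f (x t) ≤ Fintype.card ι * (μ - δ)) ≤
      varAt P f μ / (Fintype.card ι * δ ^ 2) := by
  set n : ℝ := ((Fintype.card ι : ℕ) : ℝ) with hn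
  have hn0 : 0 < n := by rw [hn]; exact_mod_cast hι
  have h : ∀ x : ι → Ω, ind (∑ t, f (x t) ≤ n * (μ - δ)) ≤
      (∑ t, f (x t) - n * μ) ^ 2 / (n * δ) ^ 2 := by
    intro x
    by_cases hx : ∑ t, f (x t) ≤ n * (μ - δ)
    · rw [ind_pos hx, le_div_iff₀ (by positivity), one_mul]
      refine sq_le_sq' ?_ ?_ |>.trans (le_of_eq (neg_sq (∑ t, f (x t) - n * μ)))
      · nlinarith [mul_pos hn0 hδ]
      · nlinarith
    · rw [ind_neg hx]; positivity
  calc _ ≤ ∑ x : ι → Ω, piLaw P x * ((∑ t, f (x t) - n * μ) ^ 2 / (n * δ) ^ 2) :=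
        sum_le_sum fun x _ => mul_le_mul_of_nonneg_left (h x) ((piLaw_mem hP).1 x)
    _ = _ := by
        simp only [mul_div_assoc', ← sum_div]
        rw [sum_pi_dev_sq hP hμ, ← hn]
        field_simp

/-- The expected excess of a sum of independent terms over its mean is of the order of `√n`. -/
theorem expected_excess_le {P : Ω → ℝ} (hP : P ∈ stdSimplex ℝ Ω) {f : Ω → ℝ} {μ : ℝ}
    (hμ : ∑ ω, P ω * f ω = μ) (hι : 0 < Fintype.card ι) :
    ∑ x : ι → Ω, piLaw P x * max (∑ t, f (x t) - Fintype.card ι * μ) 0 ≤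
      √(Fintype.card ι) * (varAt P f μ + 1) := by
  set n : ℝ := ((Fintype.card ι : ℕ) : ℝ) with hn
  have hn0 : 0 < n := by rw [hn]; exact_mod_cast hι
  have hs : 0 < √n := Real.sqrt_pos.2 hn0
  have h : ∀ x : ι → Ω, max (∑ t, f (x t) - n * μ) 0 ≤
      (∑ t, f (x t) - n * μ) ^ 2 / √n + √n := by
    intro x
    refine max_le ?_ (by positivity)
    rw [div_add' _ _ _ hs.ne', le_div_iff₀ hs]
    nlinarith [sq_nonneg (∑ t, f (x t) - n * μ - √n), sq_nonneg (∑ t, f (x t) - n * μ), sq_nonneg √n]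
  have hl := piLaw_mem (ι := ι) hP
  calc _ ≤ ∑ x : ι → Ω, piLaw P x * ((∑ t, f (x t) - n * μ) ^ 2 / √n + √n) :=
        sum_le_sum fun x _ => mul_le_mul_of_nonneg_left (h x) (hl.1 x)
    _ = n * varAt P f μ / √n + √n := by
        simp only [mul_add, mul_div_assoc', sum_add_distrib, ← sum_div, ← sum_mul]
        rw [sum_pi_dev_sq hP hμ, hl.2, one_mul]
    _ = _ := by
        have : n = √n * √n := (Real.mul_self_sqrt hn0.le).symm
        rw [mul_comm n, mul_div_assoc]
        conv_lhs => rw [show n / √n = √n by rw [div_eq_iff hs.ne']; exact this]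
        ring

omit [DecidableEq ι] in
theorem sum_log_le_of_prod_le {A B : ι → ℝ} (hA : ∀ t, 0 < A t) (hB : ∀ t, 0 < B t) {r : ℝ}
    (h : ∏ t, A t ≤ Real.exp r * ∏ t, B t) : ∑ t, Real.log (A t / B t) ≤ r := by
  have hBp : 0 < ∏ t, B t := prod_pos fun t _ => hB t
  rw [← Real.log_prod fun t _ => (div_pos (hA t) (hB t)).ne', prod_div_distrib,
    Real.log_le_iff_le_exp (div_pos (prod_pos fun t _ => hA t) hBp), div_le_iff₀ hBp]
  exact h

/-- The joint law of independent inputs and the output of a two-input channel. -/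
def macLaw (p : α → ℝ) (q : β → ℝ) (U : α → β → γ → ℝ) : α × β × γ → ℝ :=
  fun ω => p ω.1 * q ω.2.1 * U ω.1 ω.2.1 ω.2.2

theorem macLaw_mem {p : α → ℝ} {q : β → ℝ} {U : α → β → γ → ℝ} (hp : p ∈ stdSimplex ℝ α)
    (hq : q ∈ stdSimplex ℝ β) (hU : ∀ a b, U a b ∈ stdSimplex ℝ γ) :
    macLaw p q U ∈ stdSimplex ℝ (α × β × γ) :=
  ⟨fun _ => mul_nonneg (mul_nonneg (hp.1 _) (hq.1 _)) ((hU _ _).1 _), by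
    simp only [macLaw, Fintype.sum_prod_type, ← mul_sum, (hU _ _).2, mul_one, hq.2, hp.2]⟩

/-- The output of a memoryless channel fails a threshold test at a rate below its mean information
density with vanishing probability. -/
theorem test_fail_le {P : Ω → ℝ} (hP : P ∈ stdSimplex ℝ Ω) {A B : Ω → ℝ}
    (hA : ∀ ω, P ω ≠ 0 → 0 < A ω) (hB : ∀ ω, P ω ≠ 0 → 0 < B ω) {μ δ : ℝ}
    (hμ : ∑ ω, P ω * Real.log (A ω / B ω) = μ) (hδ : 0 < δ) (hι : 0 < Fintype.card ι) :
    ∑ x : ι → Ω, piLaw P x *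
      ind (¬ Real.exp (Fintype.card ι * (μ - δ)) * ∏ t, B (x t) < ∏ t, A (x t)) ≤
      varAt P (fun ω => Real.log (A ω / B ω)) μ / (Fintype.card ι * δ ^ 2) := by
  refine le_trans (sum_le_sum fun x _ => ?_) (lower_tail_le hP hμ hδ hι)
  rcases eq_or_ne (piLaw P x) 0 with h0 | h0
  · simp [h0]
  have hx : ∀ t, P (x t) ≠ 0 := fun t h => h0 (prod_eq_zero (mem_univ t) h)
  refine mul_le_mul_of_nonneg_left (ind_mono fun h => ?_) ((piLaw_mem hP).1 x)
  exact sum_log_le_of_prod_le (fun t => hA _ (hx t)) (fun t => hB _ (hx t)) (not_lt.1 h)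

theorem tendsto_block_error (v δ c : ℝ) (hδ : 0 < δ) :
    Tendsto (fun n : ℕ => v / (n * δ ^ 2) + c * Real.exp (-(n * δ))) atTop (𝓝 0) := by
  have h1 : Tendsto (fun n : ℕ => v / (n * δ ^ 2)) atTop (𝓝 0) :=
    tendsto_const_nhds.div_atTop
      (tendsto_natCast_atTop_atTop.atTop_mul_const (by positivity))
  have h2 : Tendsto (fun n : ℕ => Real.exp (-(n * δ))) atTop (𝓝 0) :=
    Real.tendsto_exp_neg_atTop_nhds_zero.comp (tendsto_natCast_atTop_atTop.atTop_mul_const hδ)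
  simpa using h1.add (h2.const_mul c)

/-- The coding theorem for the memoryless multiple access channel. Rates are in nats. -/
theorem mac_coding {p : α → ℝ} {q : β → ℝ} {U : α → β → γ → ℝ} (hp : p ∈ stdSimplex ℝ α)
    (hq : q ∈ stdSimplex ℝ β) (hU : ∀ a b, U a b ∈ stdSimplex ℝ γ) {r₁ r₂ : ℝ}
    (h₁ : r₁ < macInfo U p q) (h₂ : r₂ < macInfo (fun b a => U a b) q p)
    (h₃ : r₁ + r₂ < macSumInfo U p q) :
    ∃ e : ℕ → ℝ, Tendsto e atTop (𝓝 0) ∧ ∀ (ι M₁ M₂ : Type) [Fintype ι] [DecidableEq ι] [Fintype M₁]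
      [Fintype M₂] [Nonempty M₁] [Nonempty M₂], 0 < Fintype.card ι →
      Fintype.card M₁ ≤ Real.exp (Fintype.card ι * r₁) →
      Fintype.card M₂ ≤ Real.exp (Fintype.card ι * r₂) →
      ∃ (c₁ : M₁ → ι → α) (c₂ : M₂ → ι → β) (dec : (ι → γ) → M₁ × M₂),
        (∑ m₁, ∑ m₂, ∑ y : ι → γ, (∏ t, U (c₁ m₁ t) (c₂ m₂ t) (y t)) * ind (dec y ≠ (m₁, m₂))) /
          (Fintype.card M₁ * Fintype.card M₂) ≤ e (Fintype.card ι) := by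
  obtain ⟨δ, hδ, hd₁, hd₂, hd₃⟩ : ∃ δ > 0, r₁ + 2 * δ ≤ macInfo U p q ∧
      r₂ + 2 * δ ≤ macInfo (fun b a => U a b) q p ∧ r₁ + r₂ + 2 * δ ≤ macSumInfo U p q := by
    refine ⟨min (macInfo U p q - r₁) (min (macInfo (fun b a => U a b) q p - r₂)
      (macSumInfo U p q - (r₁ + r₂))) / 2, ?_, ?_, ?_, ?_⟩
    · have := lt_min (sub_pos.2 h₁) (lt_min (sub_pos.2 h₂) (sub_pos.2 h₃))
      linarith
    · have := min_le_left (macInfo U p q - r₁) (min (macInfo (fun b a => U a b) q p - r₂)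
        (macSumInfo U p q - (r₁ + r₂)))
      linarith
    · have := (min_le_right (macInfo U p q - r₁) (min (macInfo (fun b a => U a b) q p - r₂)
        (macSumInfo U p q - (r₁ + r₂)))).trans (min_le_left _ _)
      linarith
    · have := (min_le_right (macInfo U p q - r₁) (min (macInfo (fun b a => U a b) q p - r₂)
        (macSumInfo U p q - (r₁ + r₂)))).trans (min_le_right _ _)
      linarith
  set P := macLaw p q U with hP
  have hPm := macLaw_mem hp hq hU
  set A : α × β × γ → ℝ := fun ω => U ω.1 ω.2.1 ω.2.2 with hA
  set B₁ : α × β × γ → ℝ := fun ω => outLaw p (fun a => U a ω.2.1) ω.2.2 with hB₁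
  set B₂ : α × β × γ → ℝ := fun ω => outLaw q (U ω.1) ω.2.2 with hB₂
  set B₃ : α × β × γ → ℝ := fun ω => outLaw (prodLaw p q) (fun x => U x.1 x.2) ω.2.2 with hB₃
  have hA0 : ∀ ω, P ω ≠ 0 → 0 < A ω := fun ω h =>
    lt_of_le_of_ne ((hU _ _).1 _) (right_ne_zero_of_mul h).symm
  have hB₁0 : ∀ ω, P ω ≠ 0 → 0 < B₁ ω := fun ω h => outLaw_pos hp.1 (fun a => (hU a _).1)
    (mul_ne_zero (left_ne_zero_of_mul (left_ne_zero_of_mul h)) (right_ne_zero_of_mul h))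
  have hB₂0 : ∀ ω, P ω ≠ 0 → 0 < B₂ ω := fun ω h => outLaw_pos hq.1 (fun b => (hU _ b).1)
    (mul_ne_zero (right_ne_zero_of_mul (left_ne_zero_of_mul h)) (right_ne_zero_of_mul h))
  have hB₃0 : ∀ ω, P ω ≠ 0 → 0 < B₃ ω := fun ω h => outLaw_pos (prodLaw_mem hp hq).1
    (fun x => (hU x.1 x.2).1) (a := (ω.1, ω.2.1)) h
  have hμ₁ : ∑ ω, P ω * Real.log (A ω / B₁ ω) = macInfo U p q := by
    simp only [hP, macLaw, hA, hB₁, Fintype.sum_prod_type, macInfo, info, mul_sum]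
    rw [sum_comm]
    exact sum_congr rfl fun b _ => sum_congr rfl fun a _ => sum_congr rfl fun c _ => by ring
  have hμ₂ : ∑ ω, P ω * Real.log (A ω / B₂ ω) = macInfo (fun b a => U a b) q p := by
    simp only [hP, macLaw, hA, hB₂, Fintype.sum_prod_type, macInfo, info, mul_sum]
    exact sum_congr rfl fun b _ => sum_congr rfl fun a _ => sum_congr rfl fun c _ => by ring
  have hμ₃ : ∑ ω, P ω * Real.log (A ω / B₃ ω) = macSumInfo U p q := by
    simp only [hP, macLaw, hA, hB₃, Fintype.sum_prod_type, macSumInfo, info, prodLaw]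
  set v₁ := varAt P (fun ω => Real.log (A ω / B₁ ω)) (macInfo U p q) with hv₁
  set v₂ := varAt P (fun ω => Real.log (A ω / B₂ ω)) (macInfo (fun b a => U a b) q p) with hv₂
  set v₃ := varAt P (fun ω => Real.log (A ω / B₃ ω)) (macSumInfo U p q) with hv₃
  refine ⟨_, tendsto_block_error (v₁ + v₂ + v₃) δ 3 hδ, ?_⟩
  intro ι M₁ M₂ _ _ _ _ _ _ hι hM₁ hM₂
  set n : ℝ := ((Fintype.card ι : ℕ) : ℝ) with hn
  have hn0 : 0 < n := by rw [hn]; exact_mod_cast hι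
  obtain ⟨c₁, c₂, dec, hc⟩ := exists_mac_code (piLaw_mem (ι := ι) hp) (piLaw_mem (ι := ι) hq)
    (K := fun x₁ x₂ (y : ι → γ) => ∏ t, U (x₁ t) (x₂ t) (y t))
    (fun x₁ x₂ => prod_mem_stdSimplex fun t => hU (x₁ t) (x₂ t))
    (Real.exp_pos (n * (macInfo U p q - δ)))
    (Real.exp_pos (n * (macInfo (fun b a => U a b) q p - δ)))
    (Real.exp_pos (n * (macSumInfo U p q - δ))) M₁ M₂
  refine ⟨c₁, c₂, dec, hc.trans (add_le_add ?_ ?_)⟩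
  · -- the true message pair fails the test
    rw [hv₁, hv₂, hv₃, add_div, add_div]
    refine le_trans ?_ (add_le_add (add_le_add (test_fail_le (ι := ι) hPm hA0 hB₁0 hμ₁ hδ hι)
      (test_fail_le (ι := ι) hPm hA0 hB₂0 hμ₂ hδ hι)) (test_fail_le (ι := ι) hPm hA0 hB₃0 hμ₃ hδ hι))
    rw [← sum_add_distrib, ← sum_add_distrib]
    simp_rw [sum_arrow_prod (ι := ι) (α := β) (β := γ)]
    rw [sum_arrow_prod (ι := ι)]
    refine sum_le_sum fun x _ => ?_
    have e0 : piLaw p (fun i => (x i).1) * piLaw q (fun i => (x i).2.1) *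
        ∏ t, U (x t).1 (x t).2.1 (x t).2.2 = piLaw P x := by
      simp only [piLaw, hP, macLaw, prod_mul_distrib]
    rw [e0, ← mul_add, ← mul_add]
    refine mul_le_mul_of_nonneg_left ?_ ((piLaw_mem hPm).1 x)
    by_cases hT : MacTest (piLaw p) (piLaw q) (fun (x₁ : ι → α) (x₂ : ι → β) (y : ι → γ) =>
        ∏ t, U (x₁ t) (x₂ t) (y t)) (Real.exp (n * (macInfo U p q - δ)))
        (Real.exp (n * (macInfo (fun b a => U a b) q p - δ)))
        (Real.exp (n * (macSumInfo U p q - δ))) (fun i => (x i).1) (fun i => (x i).2.1)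
        (fun i => (x i).2.2)
    · rw [ind_neg (not_not.2 hT)]
      exact add_nonneg (add_nonneg (ind_nonneg _) (ind_nonneg _)) (ind_nonneg _)
    · rw [ind_pos hT]
      have o1 : outLaw (piLaw p) (fun (x₁ : ι → α) (y : ι → γ) =>
          ∏ t, U (x₁ t) (x t).2.1 (y t)) (fun i => (x i).2.2) = ∏ t, B₁ (x t) :=
        outLaw_prod p (fun t a => U a (x t).2.1) _
      have o2 : outLaw (piLaw q) (fun (x₂ : ι → β) (y : ι → γ) =>
          ∏ t, U (x t).1 (x₂ t) (y t)) (fun i => (x i).2.2) = ∏ t, B₂ (x t) :=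
        outLaw_prod q (fun t => U (x t).1) _
      have o3 : outLaw (prodLaw (piLaw p) (piLaw q)) (fun (z : (ι → α) × (ι → β)) (y : ι → γ) =>
          ∏ t, U (z.1 t) (z.2 t) (y t)) (fun i => (x i).2.2) = ∏ t, B₃ (x t) := by
        rw [← outLaw_prod (prodLaw p q) (fun _ x => U x.1 x.2)]
        simp only [outLaw, prodLaw, Fintype.sum_prod_type, piLaw]
        rw [sum_arrow_prod (ι := ι)]
        simp only [prod_mul_distrib]
      simp only [MacTest] at hT
      rw [o1, o2, o3] at hT
      rw [not_and_or, not_and_or] at hT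
      rcases hT with h | h | h
      · rw [ind_pos h]
        linarith [ind_nonneg (¬ Real.exp (n * (macInfo (fun b a => U a b) q p - δ)) *
          ∏ t, B₂ (x t) < ∏ t, A (x t)), ind_nonneg (¬ Real.exp (n * (macSumInfo U p q - δ)) *
          ∏ t, B₃ (x t) < ∏ t, A (x t))]
      · rw [ind_pos h]
        linarith [ind_nonneg (¬ Real.exp (n * (macInfo U p q - δ)) *
          ∏ t, B₁ (x t) < ∏ t, A (x t)), ind_nonneg (¬ Real.exp (n * (macSumInfo U p q - δ)) *
          ∏ t, B₃ (x t) < ∏ t, A (x t))]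
      · rw [ind_pos h]
        linarith [ind_nonneg (¬ Real.exp (n * (macInfo U p q - δ)) *
          ∏ t, B₁ (x t) < ∏ t, A (x t)), ind_nonneg (¬ Real.exp (n * (macInfo (fun b a => U a b) q p
          - δ)) * ∏ t, B₂ (x t) < ∏ t, A (x t))]
  · -- there are few enough wrong message pairs
    have key : ∀ {r I k : ℝ}, r + 2 * δ ≤ I → k ≤ Real.exp (n * r) →
        k / Real.exp (n * (I - δ)) ≤ Real.exp (-(n * δ)) := by
      intro r I k h hk
      rw [div_le_iff₀ (Real.exp_pos _), ← Real.exp_add]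
      refine hk.trans (Real.exp_le_exp.2 ?_)
      nlinarith
    have k1 := key hd₁ hM₁
    have k2 := key hd₂ hM₂
    have k3 := key hd₃ (k := Fintype.card M₁ * Fintype.card M₂) (by
      rw [mul_add, Real.exp_add]
      exact mul_le_mul hM₁ hM₂ (Nat.cast_nonneg _) (Real.exp_pos _).le)
    linarith

/-- The joint law of the input and the output of a channel. -/
def chanLaw (p : α → ℝ) (W : α → β → ℝ) : α × β → ℝ := fun ω => p ω.1 * W ω.1 ω.2

theorem chanLaw_mem {p : α → ℝ} {W : α → β → ℝ} (hp : p ∈ stdSimplex ℝ α)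
    (hW : ∀ a, W a ∈ stdSimplex ℝ β) : chanLaw p W ∈ stdSimplex ℝ (α × β) :=
  ⟨fun _ => mul_nonneg (hp.1 _) ((hW _).1 _), by
    simp only [chanLaw, Fintype.sum_prod_type, ← mul_sum, (hW _).2, mul_one, hp.2]⟩

/-- Wiretap coding for memoryless channels at small positive rates: the divergence between the
output law of a message at Eve and the product law `outLaw p E` is of the order of `√n`. -/
theorem wiretap_coding {p : α → ℝ} {K : α → β → ℝ} {E : α → γ → ℝ} (hp : p ∈ stdSimplex ℝ α)
    (hK : ∀ a, K a ∈ stdSimplex ℝ β) (hE : ∀ a, E a ∈ stdSimplex ℝ γ) (h : info p E < info p K) :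
    ∃ (r κ : ℝ) (e : ℕ → ℝ), 0 < r ∧ Tendsto e atTop (𝓝 0) ∧
      ∀ (ι W : Type) [Fintype ι] [DecidableEq ι] [Fintype W] [Nonempty W], 0 < Fintype.card ι →
      Fintype.card W ≤ Real.exp (Fintype.card ι * r) →
      ∃ (enc : W → (ι → α) → ℝ) (dec : (ι → β) → W), (∀ w, enc w ∈ stdSimplex ℝ (ι → α)) ∧
        (∑ w, ∑ x, ∑ y : ι → β, enc w x * (∏ t, K (x t) (y t)) * ind (dec y ≠ w)) /
          Fintype.card W ≤ e (Fintype.card ι) ∧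
        (∀ w x (z : ι → γ), enc w x ≠ 0 → ∏ t, E (x t) (z t) ≠ 0 → ∏ t, outLaw p E (z t) ≠ 0) ∧
        (∑ w, ∑ z : ι → γ, (∑ x, enc w x * ∏ t, E (x t) (z t)) *
          Real.log ((∑ x, enc w x * ∏ t, E (x t) (z t)) / ∏ t, outLaw p E (z t))) /
          Fintype.card W ≤ κ * √(Fintype.card ι) := by
  set δ : ℝ := (info p K - info p E) / 3 with hδd
  have hδ : 0 < δ := by rw [hδd]; linarith
  have hI0 := info_nonneg hp hE
  set v := varAt (chanLaw p K) (fun ω => Real.log (K ω.1 ω.2 / outLaw p K ω.2)) (info p K) with hv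
  set s := varAt (chanLaw p E) (fun ω => Real.log (E ω.1 ω.2 / outLaw p E ω.2)) (info p E) with hs
  have hs0 : 0 ≤ s := varAt_nonneg (chanLaw_mem hp hE) _ _
  have hv0 : 0 ≤ v := varAt_nonneg (chanLaw_mem hp hK) _ _
  have hl2 : 0 < Real.log 2 := Real.log_pos (by norm_num)
  refine ⟨δ, 2 * (s + 1 + Real.log 2), fun n => 2 * (v / (n * δ ^ 2) + 2 * Real.exp (-(n * δ))), hδ,
    by simpa using (tendsto_block_error v δ 2 hδ).const_mul 2, ?_⟩
  intro ι W _ _ _ _ hι hW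
  classical
  set n : ℝ := ((Fintype.card ι : ℕ) : ℝ) with hn
  have hn1 : 1 ≤ n := by rw [hn]; exact_mod_cast hι
  have hn0 : 0 < n := by linarith
  set N : ℕ := ⌈Real.exp (n * info p E)⌉₊ with hN
  have hN1 : Real.exp (n * info p E) ≤ N := Nat.le_ceil _
  have hNpos : 0 < N := by
    have := (Real.exp_pos (n * info p E)).trans_le hN1
    exact_mod_cast this
  have hN2 : (N : ℝ) ≤ 2 * Real.exp (n * info p E) := by
    have h1 := Nat.ceil_lt_add_one (Real.exp_pos (n * info p E)).le
    have h2 := Real.one_le_exp (mul_nonneg hn0.le hI0)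
    rw [← hN] at h1
    linarith
  have : Nonempty (Fin N) := ⟨⟨0, hNpos⟩⟩
  have hcardL : ((Fintype.card (Fin N) : ℕ) : ℝ) = N := by rw [Fintype.card_fin]
  obtain ⟨c, dec, hac, herr, hleak⟩ := exists_wiretap_code (piLaw_mem (ι := ι) hp)
    (K := fun x (y : ι → β) => ∏ t, K (x t) (y t)) (E := fun x (z : ι → γ) => ∏ t, E (x t) (z t))
    (fun x => prod_mem_stdSimplex fun t => hK (x t))
    (fun x => prod_mem_stdSimplex fun t => hE (x t))
    (Real.exp_pos (n * (info p K - δ))) W (Fin N)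
    (ε := v / (n * δ ^ 2) + 2 * Real.exp (-(n * δ))) (δ := √n * (s + 1 + Real.log 2))
    (by positivity) (by have := Real.sqrt_pos.2 hn0; positivity)
    (by
      refine add_le_add ?_ ?_
      · refine le_trans ?_ (test_fail_le (ι := ι) (chanLaw_mem hp hK)
          (A := fun ω => K ω.1 ω.2) (B := fun ω => outLaw p K ω.2)
          (fun ω h => lt_of_le_of_ne ((hK _).1 _) (right_ne_zero_of_mul h).symm)
          (fun ω h => outLaw_pos hp.1 (fun a => (hK a).1) h) (μ := info p K) (by
            simp only [Fintype.sum_prod_type, chanLaw, info]) hδ hι)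
        rw [sum_arrow_prod (ι := ι)]
        refine le_of_eq (sum_congr rfl fun x _ => ?_)
        rw [outLaw_prod p (fun _ => K)]
        simp only [piLaw, chanLaw, prod_mul_distrib]
        rfl
      · rw [hcardL, div_le_iff₀ (Real.exp_pos _), mul_assoc, ← Real.exp_add]
        calc (Fintype.card W : ℝ) * N ≤ Real.exp (n * δ) * (2 * Real.exp (n * info p E)) :=
              mul_le_mul hW hN2 (Nat.cast_nonneg _) (Real.exp_pos _).le
          _ = 2 * Real.exp (n * δ + n * info p E) := by rw [Real.exp_add]; ring
          _ ≤ _ := by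
              refine mul_le_mul_of_nonneg_left (Real.exp_le_exp.2 (le_of_eq ?_)) (by norm_num)
              rw [hδd]; ring)
    (by
      have hex := expected_excess_le (ι := ι) (chanLaw_mem hp hE)
        (f := fun ω => Real.log (E ω.1 ω.2 / outLaw p E ω.2)) (μ := info p E) (by
            simp only [Fintype.sum_prod_type, chanLaw, info]) hι
      rw [← hs, ← hn] at hex
      rw [sum_arrow_prod (ι := ι)]
      have hsq : 1 ≤ √n := by rw [Real.one_le_sqrt]; exact hn1
      refine le_trans (b := ∑ x : ι → α × γ, piLaw (chanLaw p E) x * (max (∑ t, Real.log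
        (E (x t).1 (x t).2 / outLaw p E (x t).2) - n * info p E) 0 + Real.log 2)) ?_ ?_
      · refine sum_le_sum fun x _ => ?_
        have e0 : piLaw p (fun i => (x i).1) * ∏ t, E (x t).1 (x t).2 = piLaw (chanLaw p E) x := by
          simp only [piLaw, chanLaw, prod_mul_distrib]
        rw [e0]
        rcases eq_or_ne (piLaw (chanLaw p E) x) 0 with h0 | h0
        · simp [h0]
        refine mul_le_mul_of_nonneg_left ?_ ((piLaw_mem (chanLaw_mem hp hE)).1 x)
        have hx : ∀ t, chanLaw p E (x t) ≠ 0 := fun t h => h0 (prod_eq_zero (mem_univ t) h)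
        have hEx : ∀ t, 0 < E (x t).1 (x t).2 := fun t =>
          lt_of_le_of_ne ((hE _).1 _) (right_ne_zero_of_mul (hx t)).symm
        have hox : ∀ t, 0 < outLaw p E (x t).2 := fun t =>
          outLaw_pos hp.1 (fun a => (hE a).1) (hx t)
        rw [outLaw_prod p (fun _ => E), hcardL]
        set S := ∑ t, Real.log (E (x t).1 (x t).2 / outLaw p E (x t).2) with hS
        have hexpS : (∏ t, E (x t).1 (x t).2) / ∏ t, outLaw p E (x t).2 = Real.exp S := by
          rw [hS, Real.exp_sum, ← prod_div_distrib]
          exact prod_congr rfl fun t _ => (Real.exp_log (div_pos (hEx t) (hox t))).symm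
        have hNp : (0 : ℝ) < N := by exact_mod_cast hNpos
        have e1 : (∏ t, E (x t).1 (x t).2) / (N * ∏ t, outLaw p E (x t).2) = Real.exp S / N := by
          rw [← hexpS, div_div, mul_comm]
        rw [e1]
        have hm0 := le_max_right (S - n * info p E) 0
        have e2 : Real.exp S / N ≤ Real.exp (max (S - n * info p E) 0) := by
          rw [div_le_iff₀ hNp]
          calc Real.exp S = Real.exp (S - n * info p E) * Real.exp (n * info p E) := by
                rw [← Real.exp_add]; congr 1; ring
            _ ≤ _ := mul_le_mul (Real.exp_le_exp.2 (le_max_left _ _)) hN1 (Real.exp_pos _).le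
                (Real.exp_pos _).le
        have e3 := Real.one_le_exp hm0
        calc Real.log (1 + Real.exp S / N) ≤ Real.log (Real.exp (max (S - n * info p E) 0) * 2) :=
              Real.log_le_log (by positivity) (by linarith)
          _ = _ := by rw [Real.log_mul (Real.exp_pos _).ne' (by norm_num), Real.log_exp]
      · simp only [mul_add, sum_add_distrib, ← sum_mul, (piLaw_mem (chanLaw_mem hp hE)).2]
        nlinarith)
  -- the encoder draws a codeword of the message uniformly at random
  have hNp : (0 : ℝ) < N := by exact_mod_cast hNpos
  have hsum : ∀ (w : W) (F : (ι → α) → ℝ), ∑ x, (∑ l : Fin N, ind (x = c (w, l))) / N * F x =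
      (∑ l, F (c (w, l))) / N := by
    intro w F
    have : ∀ x, (∑ l : Fin N, ind (x = c (w, l))) / N * F x =
        (∑ l : Fin N, F x * ind (x = c (w, l))) / N := fun x => by
      rw [← mul_sum]; ring
    simp_rw [this]
    rw [← sum_div, sum_comm]
    simp_rw [sum_mul_ind_eq]
  refine ⟨fun w x => (∑ l : Fin N, ind (x = c (w, l))) / N, fun y => (dec y).1, fun w => ⟨fun x =>
    div_nonneg (sum_nonneg fun l _ => ind_nonneg _) hNp.le, ?_⟩, ?_, ?_, ?_⟩
  · have := hsum w (fun _ => 1)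
    simp only [mul_one] at this
    rw [this]
    simp [hNp.ne']
  · refine le_trans ?_ herr
    rw [hcardL, Fintype.sum_prod_type, mul_comm, ← div_div]
    refine div_le_div_of_nonneg_right ?_ (Nat.cast_nonneg _)
    rw [sum_div]
    refine sum_le_sum fun w _ => ?_
    have := hsum w (fun x => ∑ y : ι → β, (∏ t, K (x t) (y t)) * ind ((dec y).1 ≠ w))
    simp only [mul_sum, ← mul_assoc] at this
    rw [this]
    refine div_le_div_of_nonneg_right (sum_le_sum fun l _ => sum_le_sum fun y _ => ?_) hNp.le
    refine mul_le_mul_of_nonneg_left (ind_mono fun h1 h2 => h1 (by rw [h2]))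
      (prod_nonneg fun t _ => (hK _).1 _)
  · intro w x z hx hz
    obtain ⟨l, _, hl⟩ := exists_ne_zero_of_sum_ne_zero (div_ne_zero_iff.1 hx).1
    have hxl : x = c (w, l) := by by_contra h; exact hl (ind_neg h)
    rw [← outLaw_prod p (fun _ => E)]
    exact hac (w, l) z (by rw [← hxl]; exact hz)
  · refine le_trans (le_of_eq ?_) (hleak.trans (le_of_eq (by ring)))
    congr 1
    refine sum_congr rfl fun w _ => sum_congr rfl fun z _ => ?_
    rw [hsum w (fun x => ∏ t, E (x t) (z t)), outLaw_prod p (fun _ => E), hcardL]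

end Memoryless

/-! ### Bits, messages and keys -/

namespace UserCode

variable {𝒳 : Type*} [Fintype 𝒳] {n₁ n₂ : ℕ} {u : UserCode 𝒳 n₁ n₂} {k : ℕ}

/-- The bit at position `p` of the stream of message bits, and `false` beyond its end. -/
def bitAt (s : u.Bits k) (p : ℕ) : Bool := if h : p < u.sent (k + 1) then s ⟨p, h⟩ else false

theorem message_apply (s : u.Bits k) (j : Fin (k + 1)) (i : Fin (u.a + u.b j)) :
    message s j i = bitAt s (u.sent j + i) := by
  have := u.sent_succ_le j.2
  rw [bitAt, dif_pos (by omega)]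
  rfl

theorem key_apply (s : u.Bits k) (j : Fin (k + 1)) (i : Fin (u.c j)) :
    key s j i = bitAt s (u.used j + i) := by
  have := u.used_add_le j.2
  rw [bitAt, dif_pos (by omega)]
  rfl

theorem part₁_apply (s : u.Bits k) (j : Fin (k + 1)) (i : Fin u.a) :
    part₁ s j i = bitAt s (u.sent j + i) := message_apply s j _

theorem part₂_apply (s : u.Bits k) (j : Fin (k + 1)) (i : Fin (u.b j)) :
    part₂ s j i = bitAt s (u.sent j + (u.a + i)) := message_apply s j _

/-- Bitwise addition of two streams, as a permutation of the first one. -/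
def addBits (v : u.Bits k) : u.Bits k ≃ u.Bits k :=
  Function.Involutive.toPerm (fun s p => xor (s p) (v p)) fun s => by funext p; simp

theorem bitAt_addBits (v s : u.Bits k) (p : ℕ) :
    bitAt (addBits v s) p = xor (bitAt s p) (bitAt v p) := by
  unfold bitAt
  split_ifs <;> rfl

/-- A stream with prescribed message bits. -/
theorem exists_bits (M : ℕ → ℕ → Bool) : ∃ s : u.Bits k, ∀ j ≤ k, ∀ i < u.a + u.b j,
    bitAt s (u.sent j + i) = M j i := by
  classical
  refine ⟨fun p => decide (∃ j i, i < u.a + u.b j ∧ (p : ℕ) = u.sent j + i ∧ M j i = true), ?_⟩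
  intro j hj i hi
  have := u.sent_succ_le (Nat.lt_succ_of_le hj)
  rw [bitAt, dif_pos (by simp only [Nat.succ_eq_add_one] at this; omega)]
  have key : (∃ j' i', i' < u.a + u.b j' ∧ u.sent j + i = u.sent j' + i' ∧ M j' i' = true) ↔
      M j i = true := by
    constructor
    · rintro ⟨j', i', hi', he, hM⟩
      rcases lt_trichotomy j j' with h | h | h
      · have := u.sent_succ_le h; omega
      · subst h
        have : i = i' := by omega
        rwa [this]
      · have := u.sent_succ_le h; omega
    · exact fun h => ⟨j, i, hi, rfl, h⟩
  simp only [key]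
  simp

/-- The conditional law of the codeword of slot `j`. -/
def slotEnc (s : u.Bits k) (j : Fin (k + 1)) (x : Fin n₁ ⊕ Fin n₂ → 𝒳) : ℝ :=
  u.wiretapEnc (part₁ s j) (fun i => x (Sum.inl i)) *
    ind ((fun i => x (Sum.inr i)) = u.keyEnc j (part₂ s j) (key s j))

theorem encProb_eq (s : u.Bits k) (x : Fin (k + 1) → Fin n₁ ⊕ Fin n₂ → 𝒳) :
    encProb s x = ∏ j, slotEnc s j (x j) := by
  simp only [encProb, slotEnc, ind]
  congr!

theorem _root_.MACWT.sum_sum_arrow {κ κ' α : Type*} [Fintype κ] [Fintype κ'] [DecidableEq κ]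
    [DecidableEq κ'] [Fintype α] (Φ : (κ → α) → (κ' → α) → ℝ) :
    ∑ x : κ ⊕ κ' → α, Φ (fun i => x (Sum.inl i)) (fun i => x (Sum.inr i)) =
      ∑ a, ∑ b, Φ a b := by
  rw [← Fintype.sum_prod_type' (f := Φ)]
  exact Fintype.sum_equiv (Equiv.sumArrowEquivProdArrow κ κ' α) _ _ fun x => rfl

theorem slotEnc_mem (s : u.Bits k) (j : Fin (k + 1)) :
    slotEnc s j ∈ stdSimplex ℝ (Fin n₁ ⊕ Fin n₂ → 𝒳) := by
  refine ⟨fun x => mul_nonneg ((u.wiretapEnc_mem _).1 _) (ind_nonneg _), ?_⟩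
  simp only [slotEnc]
  rw [sum_sum_arrow (fun a b => u.wiretapEnc (part₁ s j) a *
    ind (b = u.keyEnc j (part₂ s j) (key s j)))]
  simp only [← mul_sum, sum_ind_eq, mul_one, (u.wiretapEnc_mem _).2]

end UserCode

/-! ### The joint law slot by slot -/

section SlotLaw

variable {𝒳₁ 𝒳₂ 𝒴 𝒵 ι : Type*} [Fintype 𝒳₁] [Fintype 𝒳₂] [Fintype 𝒴] [Fintype 𝒵] [Fintype ι]
  [DecidableEq ι]

/-- The codewords of the two users in a slot and what Bob and Eve receive. -/
abbrev SlotData (ι 𝒳₁ 𝒳₂ 𝒴 𝒵 : Type*) : Type _ := (ι → 𝒳₁) × (ι → 𝒳₂) × (ι → 𝒴) × (ι → 𝒵)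

/-- The law of the data of a slot when the users choose their codewords independently. -/
def Channel.slotLaw (V : Channel 𝒳₁ 𝒳₂ 𝒴 𝒵) (e₁ : (ι → 𝒳₁) → ℝ) (e₂ : (ι → 𝒳₂) → ℝ) :
    SlotData ι 𝒳₁ 𝒳₂ 𝒴 𝒵 → ℝ :=
  fun q => e₁ q.1 * e₂ q.2.1 * ∏ t, V.prob (q.1 t) (q.2.1 t) (q.2.2.1 t) (q.2.2.2 t)

variable {V : Channel 𝒳₁ 𝒳₂ 𝒴 𝒵}

omit [Fintype 𝒳₁] [Fintype 𝒳₂] in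
theorem sum_prob_eve (x₁ : ι → 𝒳₁) (x₂ : ι → 𝒳₂) (y : ι → 𝒴) :
    ∑ z : ι → 𝒵, ∏ t, V.prob (x₁ t) (x₂ t) (y t) (z t) = ∏ t, V.bob (x₁ t) (x₂ t) (y t) :=
  sum_pi_prod fun t z => V.prob (x₁ t) (x₂ t) (y t) z

omit [Fintype 𝒳₁] [Fintype 𝒳₂] in
theorem sum_prob_bob (x₁ : ι → 𝒳₁) (x₂ : ι → 𝒳₂) (z : ι → 𝒵) :
    ∑ y : ι → 𝒴, ∏ t, V.prob (x₁ t) (x₂ t) (y t) (z t) = ∏ t, V.eve (x₁ t) (x₂ t) (z t) :=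
  sum_pi_prod fun t y => V.prob (x₁ t) (x₂ t) y (z t)

/-- Marginalization of the data of a slot to the codewords and Bob's output. -/
theorem slotLaw_sum_bob (e₁ : (ι → 𝒳₁) → ℝ) (e₂ : (ι → 𝒳₂) → ℝ)
    (Φ : (ι → 𝒳₁) → (ι → 𝒳₂) → (ι → 𝒴) → ℝ) :
    ∑ q : SlotData ι 𝒳₁ 𝒳₂ 𝒴 𝒵, V.slotLaw e₁ e₂ q * Φ q.1 q.2.1 q.2.2.1 =
      ∑ x₁, ∑ x₂, ∑ y, e₁ x₁ * e₂ x₂ * (∏ t, V.bob (x₁ t) (x₂ t) (y t)) * Φ x₁ x₂ y := by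
  simp only [Fintype.sum_prod_type, Channel.slotLaw]
  refine sum_congr rfl fun x₁ _ => sum_congr rfl fun x₂ _ => sum_congr rfl fun y _ => ?_
  rw [← sum_mul, ← mul_sum, sum_prob_eve]

theorem slotLaw_mem {e₁ : (ι → 𝒳₁) → ℝ} {e₂ : (ι → 𝒳₂) → ℝ} (h₁ : e₁ ∈ stdSimplex ℝ (ι → 𝒳₁))
    (h₂ : e₂ ∈ stdSimplex ℝ (ι → 𝒳₂)) :
    (V.slotLaw e₁ e₂ : SlotData ι 𝒳₁ 𝒳₂ 𝒴 𝒵 → ℝ) ∈ stdSimplex ℝ (SlotData ι 𝒳₁ 𝒳₂ 𝒴 𝒵) := by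
  refine ⟨fun q => mul_nonneg (mul_nonneg (h₁.1 _) (h₂.1 _))
    (prod_nonneg fun t _ => V.prob_nonneg _ _ _ _), ?_⟩
  have := slotLaw_sum_bob (V := V) e₁ e₂ (fun _ _ _ => 1)
  simp only [mul_one] at this
  rw [this]
  have hb : ∀ (x₁ : ι → 𝒳₁) (x₂ : ι → 𝒳₂), ∑ y : ι → 𝒴, ∏ t, V.bob (x₁ t) (x₂ t) (y t) = 1 :=
    fun x₁ x₂ => sum_pi_prod_eq_one fun t => (V.bob_mem (x₁ t) (x₂ t)).2
  simp only [← mul_sum, hb, mul_one, h₂.2, h₁.2]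

namespace BufferCode

variable {n₁ n₂ k : ℕ} (C : BufferCode 𝒳₁ 𝒳₂ 𝒴 n₁ n₂)

/-- The uniform law of the message bits of both users. -/
def bitLaw (k : ℕ) : ℝ := (1 / 2) ^ C.user₁.sent (k + 1) * (1 / 2) ^ C.user₂.sent (k + 1)

variable (V) in
/-- The conditional law of the data of slot `j`, given the message bits. -/
def slot (s₁ : C.user₁.Bits k) (s₂ : C.user₂.Bits k) (j : Fin (k + 1)) :
    SlotData (Fin n₁ ⊕ Fin n₂) 𝒳₁ 𝒳₂ 𝒴 𝒵 → ℝ :=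
  V.slotLaw (UserCode.slotEnc s₁ j) (UserCode.slotEnc s₂ j)

theorem slot_mem (s₁ : C.user₁.Bits k) (s₂ : C.user₂.Bits k) (j : Fin (k + 1)) :
    C.slot V s₁ s₂ j ∈ stdSimplex ℝ (SlotData (Fin n₁ ⊕ Fin n₂) 𝒳₁ 𝒳₂ 𝒴 𝒵) :=
  slotLaw_mem (UserCode.slotEnc_mem s₁ j) (UserCode.slotEnc_mem s₂ j)

/-- Given the message bits, the slots are independent. -/
theorem sum_law (Φ : C.user₁.Bits k → C.user₂.Bits k →
    (Fin (k + 1) → SlotData (Fin n₁ ⊕ Fin n₂) 𝒳₁ 𝒳₂ 𝒴 𝒵) → ℝ) :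
    ∑ ω : C.Outcome 𝒵 k, C.law V k ω *
      Φ ω.1.1 ω.1.2 (fun j => (codeword₁ ω j, codeword₂ ω j, bob ω j, eve ω j)) =
    ∑ s₁, ∑ s₂, C.bitLaw k * ∑ f, (∏ j, C.slot V s₁ s₂ j (f j)) * Φ s₁ s₂ f := by
  rw [Fintype.sum_prod_type, Fintype.sum_prod_type]
  refine sum_congr rfl fun s₁ _ => sum_congr rfl fun s₂ _ => ?_
  simp only [Fintype.sum_prod_type]
  simp_rw [sum_arrow_prod (ι := Fin (k + 1)) (α := Fin n₁ ⊕ Fin n₂ → 𝒴)]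
  simp_rw [sum_arrow_prod (ι := Fin (k + 1)) (α := Fin n₁ ⊕ Fin n₂ → 𝒳₂)]
  rw [sum_arrow_prod (ι := Fin (k + 1)), mul_sum]
  refine sum_congr rfl fun f _ => ?_
  rw [← mul_assoc]
  congr 1
  simp only [law, slot, Channel.slotLaw, prod_mul_distrib, UserCode.encProb_eq, bitLaw, codeword₁,
    codeword₂, bob, eve]
  ring

omit [Fintype 𝒴] in
theorem sum_bitLaw : ∑ _s₁ : C.user₁.Bits k, ∑ _s₂ : C.user₂.Bits k, C.bitLaw k = 1 := by
  simp only [sum_const, card_univ, nsmul_eq_mul, bitLaw, Fintype.card_fun, Fintype.card_bool,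
    Fintype.card_fin]
  push_cast
  have h : ∀ m : ℕ, (2 : ℝ) ^ m * (1 / 2) ^ m = 1 := fun m => by rw [← mul_pow]; norm_num
  rw [mul_left_comm, ← mul_assoc (2 ^ C.user₁.sent (k + 1)), h, one_mul, h]

omit [Fintype 𝒴] in
theorem bitLaw_nonneg : 0 ≤ C.bitLaw k := by unfold bitLaw; positivity

theorem law_nonneg (ω : C.Outcome 𝒵 k) : 0 ≤ C.law V k ω := by
  refine mul_nonneg (mul_nonneg (by positivity) (mul_nonneg ?_ ?_))
    (prod_nonneg fun j _ => prod_nonneg fun t _ => V.prob_nonneg _ _ _ _)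
  · rw [UserCode.encProb_eq]; exact prod_nonneg fun j _ => (UserCode.slotEnc_mem _ j).1 _
  · rw [UserCode.encProb_eq]; exact prod_nonneg fun j _ => (UserCode.slotEnc_mem _ j).1 _

theorem sum_law_eq_one : ∑ ω : C.Outcome 𝒵 k, C.law V k ω = 1 := by
  have := C.sum_law (V := V) (k := k) (fun _ _ _ => 1)
  simp only [mul_one] at this
  rw [this]
  simp only [sum_pi_prod_eq_one fun j => (C.slot_mem _ _ j).2, mul_one]
  exact C.sum_bitLaw

variable (V) in
theorem errorProb_eq (k : ℕ) : C.errorProb V k = ∑ s₁, ∑ s₂, C.bitLaw k *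
    ∑ f : Fin (k + 1) → SlotData (Fin n₁ ⊕ Fin n₂) 𝒳₁ 𝒳₂ 𝒴 𝒵, (∏ j, C.slot V s₁ s₂ j (f j)) *
      ind (C.decode k (fun j => (f j).2.2.1) ≠
        (UserCode.message s₁ (Fin.last k), UserCode.message s₂ (Fin.last k))) := by
  rw [← C.sum_law (V := V) (k := k) (fun s₁ s₂ f => ind (C.decode k (fun j => (f j).2.2.1) ≠
        (UserCode.message s₁ (Fin.last k), UserCode.message s₂ (Fin.last k))))]
  rw [errorProb, sum_filter]
  refine sum_congr rfl fun ω _ => ?_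
  rw [ind, mul_ite, mul_one, mul_zero]
  congr

end BufferCode

end SlotLaw

/-! ### Fibres that are permuted by symmetries -/

section Balanced

variable {S A : Type*} [Fintype S] [Fintype A]

/-- If the fibres of `f` are permuted transitively by symmetries of the weight `h`, then `h` has
the same mass on each fibre. -/
theorem card_mul_sum_fiber (f : S → A) (h : S → ℝ) (hσ : ∀ a a', ∃ σ : S ≃ S,
    (∀ s, f (σ s) = a' ↔ f s = a) ∧ ∀ s, h (σ s) = h s) (a : A) :
    Fintype.card A * ∑ s, h s * ind (f s = a) = ∑ s, h s := by
  have h₁ : ∀ a', ∑ s, h s * ind (f s = a') = ∑ s, h s * ind (f s = a) := by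
    intro a'
    obtain ⟨σ, hf, hh⟩ := hσ a a'
    rw [← Equiv.sum_comp σ]
    simp only [hf, hh]
  calc _ = ∑ a', ∑ s, h s * ind (f s = a') := by
        simp only [h₁, sum_const, card_univ, nsmul_eq_mul]
    _ = ∑ s, h s := by
        rw [sum_comm]
        simp only [← mul_sum, eq_comm (a := f _), sum_ind_eq, mul_one]

theorem avg_comp_eq (f : S → A) (hσ : ∀ a a', ∃ σ : S ≃ S, ∀ s, f (σ s) = a' ↔ f s = a)
    [Nonempty S] (g : A → ℝ) :
    (∑ s, g (f s)) / Fintype.card S = (∑ a, g a) / Fintype.card A := by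
  have h₁ : ∀ a, (Fintype.card A : ℝ) * ∑ s, ind (f s = a) = Fintype.card S := fun a => by
    have := card_mul_sum_fiber f (fun _ => (1 : ℝ)) (fun a a' => by
      obtain ⟨σ, hσ⟩ := hσ a a'
      exact ⟨σ, hσ, fun _ => rfl⟩) a
    simpa using this
  have hS : (0 : ℝ) < Fintype.card S := by exact_mod_cast Fintype.card_pos
  have : Nonempty A := ⟨f (Classical.arbitrary S)⟩
  have hA : (0 : ℝ) < Fintype.card A := by exact_mod_cast Fintype.card_pos
  have h₂ : ∑ s, g (f s) = ∑ a, g a * ∑ s, ind (f s = a) := by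
    simp only [mul_sum]
    rw [sum_comm]
    refine sum_congr rfl fun s _ => ?_
    simp only [eq_comm (a := f s)]
    rw [sum_mul_ind_eq]
  rw [h₂, div_eq_div_iff hS.ne' hA.ne', sum_mul, sum_mul]
  refine sum_congr rfl fun a _ => ?_
  rw [← h₁ a]; ring

end Balanced

/-! ### The layered key scheme -/

section Scheme

/-- The number of encrypted layers in slot `k`. -/
def layers (D Δ k : ℕ) : ℕ := min (k / Δ) D

/-- The number of key bits of slot `k`: the whole message of slot `k - Δ`. -/
def keyLen (a D Δ k : ℕ) : ℕ := if k < Δ then 0 else a + a * layers D Δ (k - Δ)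

theorem layers_of_lt {D Δ k : ℕ} (h : k < Δ) : layers D Δ k = 0 := by
  simp [layers, Nat.div_eq_of_lt h]

theorem layers_le_succ {D Δ k : ℕ} (h : Δ ≤ k) : layers D Δ k ≤ layers D Δ (k - Δ) + 1 := by
  rcases Nat.eq_zero_or_pos Δ with h0 | h0
  · simp [layers, h0]
  have : (k - Δ) / Δ + 1 = k / Δ := by
    rw [← Nat.add_div_right _ h0, Nat.sub_add_cancel h]
  simp only [layers]
  omega

theorem mul_layers_le_keyLen (a D Δ k : ℕ) : a * layers D Δ k ≤ keyLen a D Δ k := by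
  unfold keyLen
  split_ifs with h
  · rw [layers_of_lt h, mul_zero]
  · have := Nat.mul_le_mul_left a (layers_le_succ (D := D) (not_lt.1 h))
    linarith

theorem sum_keyLen (a D Δ k : ℕ) :
    ∑ j ∈ range k, keyLen a D Δ j = ∑ j ∈ range (k - Δ), (a + a * layers D Δ j) := by
  induction k with
  | zero => simp
  | succ k ih =>
    rw [sum_range_succ, ih, keyLen]
    split_ifs with h
    · rw [Nat.sub_eq_zero_of_le h.le, Nat.sub_eq_zero_of_le h, add_zero]
    · rw [Nat.succ_sub (not_lt.1 h), sum_range_succ]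

variable {𝒳 : Type*} [Fintype 𝒳] {n₁ n₂ : ℕ} {a : ℕ}

/-- The transmitter whose key in slot `k` is the whole message of slot `k - Δ`. The second part of
a message consists of layers of `a` bits; layer `d + 1` of slot `k` is encrypted with layer `d` of
slot `k - Δ`, where layer `0` is the part that is protected by the wiretap encoder `enc`. The
encrypted bits are transmitted by the encoder `φ d`, where `d` is the number of layers. -/
@[reducible] def schemeUser (D : ℕ) {Δ : ℕ} (hΔ : 0 < Δ) (enc : (Fin a → Bool) → (Fin n₁ → 𝒳) → ℝ)
    (henc : ∀ w, enc w ∈ stdSimplex ℝ (Fin n₁ → 𝒳))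
    (φ : ∀ d, (Fin (a * d) → Bool) → Fin n₂ → 𝒳) : UserCode 𝒳 n₁ n₂ where
  a := a
  b k := a * layers D Δ k
  c k := keyLen a D Δ k
  key_stored k := by
    rw [sum_keyLen a D Δ (k + 1)]
    exact sum_le_sum_of_subset (range_subset_range.2 (by omega))
  wiretapEnc := enc
  wiretapEnc_mem := henc
  keyEnc k w κ := φ (layers D Δ k) fun i =>
    xor (w i) (κ (Fin.castLE (mul_layers_le_keyLen a D Δ k) i))

variable {D Δ : ℕ} {hΔ : 0 < Δ} {enc : (Fin a → Bool) → (Fin n₁ → 𝒳) → ℝ}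
  {henc : ∀ w, enc w ∈ stdSimplex ℝ (Fin n₁ → 𝒳)} {φ : ∀ d, (Fin (a * d) → Bool) → Fin n₂ → 𝒳}
  {k : ℕ}

open UserCode

/-- The encrypted bits of slot `j`. -/
def cipher (s : (schemeUser D hΔ enc henc φ).Bits k) (j : Fin (k + 1)) :
    Fin (a * layers D Δ j) → Bool := fun i =>
  xor (part₂ s j i) (key s j (Fin.castLE (mul_layers_le_keyLen a D Δ j) i))

theorem slotEnc_schemeUser (s : (schemeUser D hΔ enc henc φ).Bits k) (j : Fin (k + 1))
    (x : Fin n₁ ⊕ Fin n₂ → 𝒳) : slotEnc s j x = enc (part₁ s j) (fun i => x (Sum.inl i)) *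
      ind ((fun i => x (Sum.inr i)) = φ (layers D Δ j) (cipher s j)) := rfl

theorem schemeUser_used (j : ℕ) : (schemeUser D hΔ enc henc φ).used j =
    (schemeUser D hΔ enc henc φ).sent (j - Δ) :=
  sum_keyLen a D Δ j

theorem cipher_apply (s : (schemeUser D hΔ enc henc φ).Bits k) (j : Fin (k + 1))
    (i : Fin (a * layers D Δ j)) : cipher s j i =
      xor (bitAt s ((schemeUser D hΔ enc henc φ).sent j + (a + i)))
        (bitAt s ((schemeUser D hΔ enc henc φ).sent (j - Δ) + i)) := by
  rw [cipher, part₂_apply, key_apply, schemeUser_used]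
  rfl

theorem cipher_addBits (v s : (schemeUser D hΔ enc henc φ).Bits k) (j : Fin (k + 1)) :
    cipher (addBits v s) j = fun i => xor (cipher s j i) (cipher v j i) := by
  funext i
  simp only [cipher_apply, bitAt_addBits]
  generalize bitAt s _ = b₁
  generalize bitAt s _ = b₂
  generalize bitAt v _ = b₃
  generalize bitAt v _ = b₄
  cases b₁ <;> cases b₂ <;> cases b₃ <;> cases b₄ <;> rfl

/-- The wiretap part and the encrypted bits of a slot take all values equally often. -/
theorem exists_slot_symmetry (j : Fin (k + 1))
    (c c' : (Fin a → Bool) × (Fin (a * layers D Δ j) → Bool)) :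
    ∃ σ : (schemeUser D hΔ enc henc φ).Bits k ≃ (schemeUser D hΔ enc henc φ).Bits k, ∀ s,
      ((part₁ (σ s) j, cipher (σ s) j) : (Fin a → Bool) × (Fin (a * layers D Δ j) → Bool)) = c' ↔
      ((part₁ s j, cipher s j) : (Fin a → Bool) × (Fin (a * layers D Δ j) → Bool)) = c := by
  set t₁ : Fin a → Bool := fun i => xor (c.1 i) (c'.1 i) with ht₁
  set t₂ : Fin (a * layers D Δ j) → Bool := fun i => xor (c.2 i) (c'.2 i) with ht₂
  obtain ⟨v, hv⟩ := exists_bits (u := schemeUser D hΔ enc henc φ) (k := k) (fun j' i =>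
    if j' = j then (if h : i < a then t₁ ⟨i, h⟩ else
      if h : i - a < a * layers D Δ j then t₂ ⟨i - a, h⟩ else false) else false)
  have h₁ : ∀ i : Fin a, part₁ v j i = t₁ i := by
    intro i
    have hi : (i : ℕ) < a := i.2
    rw [part₁_apply, hv j (Nat.le_of_lt_succ j.2) i (Nat.lt_add_right _ hi), if_pos rfl, dif_pos hi]
  have h₂ : ∀ i, cipher v j i = t₂ i := by
    intro i
    have hi := i.2
    have hj : Δ ≤ (j : ℕ) := by
      by_contra h
      have : a * layers D Δ j = 0 := by rw [layers_of_lt (not_le.1 h), mul_zero]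
      omega
    have hi' : (i : ℕ) < a + a * layers D Δ (j - Δ) := by
      have := Nat.mul_le_mul_left a (layers_le_succ (D := D) hj)
      linarith
    rw [cipher_apply, hv j (Nat.le_of_lt_succ j.2) (a + i) (Nat.add_lt_add_left hi _),
      hv (j - Δ) (by have := j.2; omega) i hi', if_pos rfl, if_neg (by omega), dif_neg (by omega),
      Bool.xor_false]
    simp [i.2]
  refine ⟨addBits v, fun s => ?_⟩
  have e₁ : part₁ (addBits v s) j = fun i => xor (part₁ s j i) (t₁ i) := by
    funext i
    rw [part₁_apply, bitAt_addBits, ← part₁_apply, ← part₁_apply, h₁]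
  rw [cipher_addBits, e₁]
  simp only [h₂, Prod.ext_iff, funext_iff, ht₁, ht₂]
  have hb : ∀ x y z : Bool, (xor x (xor y z) = z) ↔ x = y := by decide
  simp only [hb]

/-- Changing the last `Δ` messages arbitrarily can be compensated by changing earlier messages so
that all encrypted bits stay the same; only the last `Δ (D + 1)` slots are affected. -/
theorem exists_chain_symmetry (t : (schemeUser D hΔ enc henc φ).Bits k) :
    ∃ σ : (schemeUser D hΔ enc henc φ).Bits k ≃ (schemeUser D hΔ enc henc φ).Bits k, ∀ s,
      (∀ j : Fin (k + 1), k < j + Δ → ∀ i, message (σ s) j i = xor (message s j i) (message t j i)) ∧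
      (∀ j, cipher (σ s) j = cipher s j) ∧
      ∀ j : Fin (k + 1), j + Δ * (D + 1) ≤ k → part₁ (σ s) j = part₁ s j := by
  -- bit `i` of slot `j` is the root of a chain that meets the last slots at `j + e Δ`
  obtain ⟨v, hv⟩ := exists_bits (u := schemeUser D hΔ enc henc φ) (k := k) (fun j i =>
    if i + (k - j) / Δ * a < a + a * layers D Δ (j + (k - j) / Δ * Δ) then
      bitAt t ((schemeUser D hΔ enc henc φ).sent (j + (k - j) / Δ * Δ) + (i + (k - j) / Δ * a)) else false)
  refine ⟨addBits v, fun s => ⟨fun j hj i => ?_, fun j => ?_, fun j hj => ?_⟩⟩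
  · have he : (k - j) / Δ = 0 := Nat.div_eq_of_lt (by omega)
    have hi := i.2
    rw [message_apply, message_apply, message_apply, bitAt_addBits,
      hv j (Nat.le_of_lt_succ j.2) i hi, he]
    simp only [zero_mul, add_zero]
    rw [if_pos hi]
  · rw [cipher_addBits]
    funext i
    have hi := i.2
    have hj : Δ ≤ (j : ℕ) := by
      by_contra h
      have : a * layers D Δ j = 0 := by rw [layers_of_lt (not_le.1 h), mul_zero]
      omega
    have hi' : (i : ℕ) < a + a * layers D Δ (j - Δ) := by
      have := Nat.mul_le_mul_left a (layers_le_succ (D := D) hj)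
      linarith
    have hjk := j.2
    have he : (k - ((j : ℕ) - Δ)) / Δ = (k - j) / Δ + 1 := by
      rw [show k - ((j : ℕ) - Δ) = (k - j) + Δ by omega, Nat.add_div_right _ hΔ]
    rw [cipher_apply (s := v), hv j (Nat.le_of_lt_succ j.2) (a + i) (Nat.add_lt_add_left hi _),
      hv (j - Δ) (by omega) i hi', he]
    have e₁ : (j : ℕ) - Δ + ((k - j) / Δ + 1) * Δ = j + (k - j) / Δ * Δ := by
      rw [add_mul, one_mul]; omega
    have e₂ : (i : ℕ) + ((k - j) / Δ + 1) * a = a + i + (k - j) / Δ * a := by ring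
    rw [e₁, e₂, Bool.xor_self, Bool.xor_false]
  · funext i
    have hi : (i : ℕ) < a := i.2
    have he : D + 1 ≤ (k - j) / Δ := by
      rw [Nat.le_div_iff_mul_le hΔ, mul_comm]
      omega
    rw [part₁_apply, bitAt_addBits, ← part₁_apply, hv j (Nat.le_of_lt_succ j.2) i
      (Nat.lt_add_right _ hi), if_neg, Bool.xor_false]
    have h1 := Nat.mul_le_mul_right a he
    have h2 : a * layers D Δ (j + (k - j) / Δ * Δ) ≤ a * D :=
      Nat.mul_le_mul_left a (min_le_right _ _)
    have h3 : (D + 1) * a = a + a * D := by ring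
    omega

/-- The wiretap parts and the encrypted bits determine all messages. -/
theorem message_eq_of_cipher_eq {s s' : (schemeUser D hΔ enc henc φ).Bits k}
    (h₁ : ∀ j, part₁ s j = part₁ s' j) (h₂ : ∀ j, cipher s j = cipher s' j) (j : Fin (k + 1)) :
    message s j = message s' j := by
  have key : ∀ j ≤ k, ∀ i < a + a * layers D Δ j,
      bitAt s ((schemeUser D hΔ enc henc φ).sent j + i) = bitAt s' ((schemeUser D hΔ enc henc φ).sent j + i) := by
    intro j
    induction j using Nat.strong_induction_on with
    | _ j ih =>
      intro hj i hi
      by_cases hia : i < a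
      · have := congrFun (h₁ ⟨j, by omega⟩) ⟨i, hia⟩
        rwa [part₁_apply, part₁_apply] at this
      · have hi2 : i - a < a * layers D Δ j := by omega
        have hjΔ : Δ ≤ j := by
          by_contra h
          rw [layers_of_lt (not_le.1 h)] at hi2
          simp at hi2
        have hi' : i - a < a + a * layers D Δ (j - Δ) := by
          have := Nat.mul_le_mul_left a (layers_le_succ (D := D) hjΔ)
          have h3 : a * (layers D Δ (j - Δ) + 1) = a + a * layers D Δ (j - Δ) := by ring
          omega
        have h := congrFun (h₂ ⟨j, by omega⟩) ⟨i - a, hi2⟩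
        rw [cipher_apply, cipher_apply] at h
        simp only at h
        rw [ih (j - Δ) (by omega) (by omega) (i - a) hi', show a + (i - a) = i by omega] at h
        exact Bool.xor_left_inj.1 h
  funext i
  rw [message_apply, message_apply]
  exact key j (Nat.le_of_lt_succ j.2) i i.2

/-- The average of a function of the wiretap part and the encrypted bits of a slot. -/
theorem avg_slot (j : Fin (k + 1)) (g : (Fin a → Bool) → (Fin (a * layers D Δ j) → Bool) → ℝ) :
    ∑ s : (schemeUser D hΔ enc henc φ).Bits k,
      (1 / 2 : ℝ) ^ (schemeUser D hΔ enc henc φ).sent (k + 1) * g (part₁ s j) (cipher s j) =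
    (∑ w, ∑ c, g w c) / (2 ^ a * 2 ^ (a * layers D Δ j)) := by
  have := avg_comp_eq (S := (schemeUser D hΔ enc henc φ).Bits k)
    (fun s => ((part₁ s j, cipher s j) : (Fin a → Bool) × (Fin (a * layers D Δ j) → Bool)))
    (fun c c' => exists_slot_symmetry j c c') (fun c => g c.1 c.2)
  rw [Fintype.sum_prod_type] at this
  simp only [Fintype.card_prod, Fintype.card_fun, Fintype.card_bool, Fintype.card_fin,
    Nat.cast_mul, Nat.cast_pow, Nat.cast_ofNat] at this
  rw [← this, ← mul_sum]
  rw [one_div, inv_pow]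
  ring

end Scheme

/-! ### Secrecy of the layered key scheme -/

theorem probOf_eq {Ω α : Type*} [Fintype Ω] (P : Ω → ℝ) (A : Ω → α) (a : α) :
    probOf P A a = ∑ ω, P ω * ind (A ω = a) := by
  classical
  rw [probOf, sum_filter]
  refine sum_congr rfl fun ω _ => ?_
  by_cases h : A ω = a
  · rw [if_pos h, ind_pos h, mul_one]
  · rw [if_neg h, ind_neg h, mul_zero]

/-- Total weight of a product over the slots, when every factor depends on the slot output only
through a law on a marginal `ρ` and a conditional law given `ρ`. -/
theorem sum_slots_eval {κ Z R : Type*} [Fintype κ] [DecidableEq κ] [Fintype Z] [Fintype R]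
    {ρ : Z → R} {H : κ → R → ℝ} (hH : ∀ j, ∑ r, H j r = 1) {G : κ → Z → ℝ}
    (hG : ∀ j (g : R → ℝ), ∑ z, g (ρ z) * G j z = ∑ r, g r) (j₀ : κ) (g : R → ℝ) :
    ∑ z : κ → Z, (∏ j, H j (ρ (z j)) * G j (z j)) * g (ρ (z j₀)) = ∑ r, H j₀ r * g r := by
  rw [sum_pi_eval (κ := fun j z => H j (ρ z) * G j z) (fun j => by rw [hG, hH]) j₀
    (fun z => g (ρ z)), ← hG j₀ (fun r => H j₀ r * g r)]
  exact sum_congr rfl fun z _ => by ring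

/-- `mutualInfo_le_of_indep`, followed by processing of the observation. -/
theorem mutualInfo_comp_le_of_indep {Ω α β γ : Type*} [Fintype Ω] [Fintype α] [Fintype β]
    [Fintype γ] {P Q : Ω → ℝ} (hP : ∀ ω, 0 ≤ P ω) (hQ : ∀ ω, 0 ≤ Q ω)
    (hP₁ : ∑ ω, P ω = 1) (hQ₁ : ∑ ω, Q ω ≤ 1) (hPQ : ∀ ω, P ω ≠ 0 → Q ω ≠ 0)
    (A : Ω → α) (O : Ω → β)
    (hind : ∀ a o, probOf Q (fun ω => (A ω, O ω)) (a, o) ≤ probOf P A a * probOf Q O o)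
    (g : β → γ) :
    mutualInfo P A (fun ω => g (O ω)) ≤ (∑ ω, P ω * Real.log (P ω / Q ω)) / Real.log 2 := by
  classical
  refine mutualInfo_le_of_indep hP hQ hP₁ hQ₁ hPQ A (fun ω => g (O ω)) fun a c => ?_
  have hg : probOf (probOf Q O) g c = ∑ o, if g o = c then probOf Q O o else 0 := by
    rw [probOf, sum_filter]
  rw [probOf_pair_comp, ← probOf_map Q O g c, hg, mul_sum]
  refine sum_le_sum fun o _ => ?_
  split_ifs with h
  · exact hind a o
  · rw [mul_zero]

section Leakage

open UserCode

variable {𝒳 : Type*} [Fintype 𝒳] {n₁ n₂ : ℕ} {a D N : ℕ}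
  {enc : (Fin a → Bool) → (Fin n₁ → 𝒳) → ℝ}
  {henc : ∀ w, enc w ∈ stdSimplex ℝ (Fin n₁ → 𝒳)} {φ : ∀ d, (Fin (a * d) → Bool) → Fin n₂ → 𝒳}
  {k : ℕ}

/-- The leakage of the last `N + 1` messages is at most `(N + 1) (D + 1)` times the divergence of
the wiretap code from its target law. Here `τ` collects everything about the other user, `F w` is
the law of the part `ρ z` of Eve's output that depends on the wiretap part `w` of a message, and
the rest of the output of slot `j` is governed by the encrypted bits and `τ`. -/
theorem mutualInfo_recent_le {T R Z O : Type*} [Fintype T] [Fintype R] [Fintype Z] [Fintype O]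
    {ν : T → ℝ} (hν : ν ∈ stdSimplex ℝ T) {F : (Fin a → Bool) → R → ℝ}
    (hF : ∀ w, F w ∈ stdSimplex ℝ R) {Q : R → ℝ} (hQ : Q ∈ stdSimplex ℝ R)
    (hFQ : ∀ w r, F w r ≠ 0 → Q r ≠ 0) (ρ : Z → R)
    (G : ∀ j : Fin (k + 1), (Fin (a * layers D (N + 1) j) → Bool) → T → Z → ℝ)
    (hG0 : ∀ j c τ z, 0 ≤ G j c τ z)
    (hG : ∀ j c τ (g : R → ℝ), ∑ z, g (ρ z) * G j c τ z = ∑ r, g r)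
    (P : (schemeUser D N.succ_pos enc henc φ).Bits k × T × (Fin (k + 1) → Z) → ℝ)
    (hP : ∀ s τ z, P (s, τ, z) = (1 / 2) ^ (schemeUser D N.succ_pos enc henc φ).sent (k + 1) *
      ν τ * ∏ j, (F (part₁ s j) (ρ (z j)) * G j (cipher s j) τ (z j)))
    (g : T × (Fin (k + 1) → Z) → O) :
    mutualInfo P (fun ω => fun j : BufferCode.Recent N k => message ω.1 j.1) (fun ω => g ω.2) ≤
      ((N + 1) * (D + 1) : ℕ) *
        ((∑ w, ∑ r, F w r * Real.log (F w r / Q r)) / 2 ^ a) / Real.log 2 := by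
  classical
  set H : (schemeUser D N.succ_pos enc henc φ).Bits k → Fin (k + 1) → R → ℝ := fun s j =>
    if k < j + (N + 1) * (D + 1) then Q else F (part₁ s j) with hH
  have hHm : ∀ s j, H s j ∈ stdSimplex ℝ R := fun s j => by
    simp only [hH]; split_ifs
    · exact hQ
    · exact hF _
  -- the reference law replaces the output of the wiretap code in the last slots by pure noise
  set P' : (schemeUser D N.succ_pos enc henc φ).Bits k × T × (Fin (k + 1) → Z) → ℝ := fun ω => (1 / 2) ^ (schemeUser D N.succ_pos enc henc φ).sent (k + 1) * ν ω.2.1 *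
    ∏ j, (H ω.1 j (ρ (ω.2.2 j)) * G j (cipher ω.1 j) ω.2.1 (ω.2.2 j)) with hP'
  have hP0 : ∀ ω, 0 ≤ P ω := fun ⟨s, τ, z⟩ => by
    rw [hP]
    exact mul_nonneg (mul_nonneg (by positivity) (hν.1 τ))
      (prod_nonneg fun j _ => mul_nonneg ((hF _).1 _) (hG0 _ _ _ _))
  have hP'0 : ∀ ω, 0 ≤ P' ω := fun ω => mul_nonneg (mul_nonneg (by positivity) (hν.1 _))
      (prod_nonneg fun j _ => mul_nonneg ((hHm _ _).1 _) (hG0 _ _ _ _))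
  have hpow : ∑ _s : (schemeUser D N.succ_pos enc henc φ).Bits k, (1 / 2 : ℝ) ^ (schemeUser D N.succ_pos enc henc φ).sent (k + 1) = 1 := by
    simp only [sum_const, card_univ, nsmul_eq_mul, Fintype.card_fun, Fintype.card_bool,
      Fintype.card_fin]
    push_cast
    rw [← mul_pow]; norm_num
  have hslots : ∀ (s : (schemeUser D N.succ_pos enc henc φ).Bits k) (τ : T) (K : Fin (k + 1) → R → ℝ), (∀ j, ∑ r, K j r = 1) →
      ∑ z : Fin (k + 1) → Z, ∏ j, (K j (ρ (z j)) * G j (cipher s j) τ (z j)) = 1 := by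
    intro s τ K hK
    refine sum_pi_prod_eq_one (κ := fun j z => K j (ρ z) * G j (cipher s j) τ z) fun j => ?_
    rw [hG, hK]
  have hP1 : ∑ ω, P ω = 1 := by
    rw [Fintype.sum_prod_type]
    simp only [Fintype.sum_prod_type, hP, ← mul_sum]
    simp only [hslots _ _ _ fun j => (hF _).2, mul_one, ← mul_sum, hν.2, hpow]
  have hP'1 : ∑ ω, P' ω = 1 := by
    rw [Fintype.sum_prod_type]
    simp only [Fintype.sum_prod_type, hP', ← mul_sum]
    simp only [hslots _ _ _ fun j => (hHm _ _).2, mul_one, ← mul_sum, hν.2, hpow]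
  have hac : ∀ ω, P ω ≠ 0 → (1 / 2 : ℝ) ^ (schemeUser D N.succ_pos enc henc φ).sent (k + 1) * ν ω.2.1 ≠ 0 ∧
      ∀ j, F (part₁ ω.1 j) (ρ (ω.2.2 j)) ≠ 0 ∧ G j (cipher ω.1 j) ω.2.1 (ω.2.2 j) ≠ 0 ∧
        H ω.1 j (ρ (ω.2.2 j)) ≠ 0 := by
    rintro ⟨s, τ, z⟩ h
    rw [hP] at h
    refine ⟨left_ne_zero_of_mul h, fun j => ?_⟩
    have hj := prod_ne_zero_iff.1 (right_ne_zero_of_mul h) j (mem_univ j)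
    refine ⟨left_ne_zero_of_mul hj, right_ne_zero_of_mul hj, ?_⟩
    simp only [hH]
    split_ifs
    · exact hFQ _ _ (left_ne_zero_of_mul hj)
    · exact left_ne_zero_of_mul hj
  have hPP' : ∀ ω, P ω ≠ 0 → P' ω ≠ 0 := fun ω h => by
    obtain ⟨h0, hj⟩ := hac ω h
    exact mul_ne_zero h0 (prod_ne_zero_iff.2 fun j _ => mul_ne_zero (hj j).2.2 (hj j).2.1)
  set A : (schemeUser D N.succ_pos enc henc φ).Bits k → (∀ j : BufferCode.Recent N k, Fin ((schemeUser D N.succ_pos enc henc φ).a + (schemeUser D N.succ_pos enc henc φ).b j.1) → Bool) :=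
    fun s j => message s j.1 with hA
  -- the symmetries that move the recent messages
  have hsym : ∀ x x', ∃ σ : (schemeUser D N.succ_pos enc henc φ).Bits k ≃ (schemeUser D N.succ_pos enc henc φ).Bits k, (∀ s, A (σ s) = x' ↔ A s = x) ∧
      (∀ s j, cipher (σ s) j = cipher s j) ∧ ∀ s j, H (σ s) j = H s j := by
    intro x x'
    obtain ⟨t, ht⟩ := exists_bits (u := schemeUser D N.succ_pos enc henc φ) (k := k) (fun j i =>
      if h : ∃ (hj : j < k + 1) (_ : k ≤ j + N), i < (schemeUser D N.succ_pos enc henc φ).a + (schemeUser D N.succ_pos enc henc φ).b j then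
        xor (x ⟨⟨j, h.1⟩, h.2.1⟩ ⟨i, h.2.2⟩) (x' ⟨⟨j, h.1⟩, h.2.1⟩ ⟨i, h.2.2⟩) else false)
    obtain ⟨σ, hσ⟩ := exists_chain_symmetry (hΔ := N.succ_pos) (D := D) t
    refine ⟨σ, fun s => ?_, fun s => (hσ s).2.1, fun s j => ?_⟩
    · simp only [funext_iff, hA]
      refine forall_congr' fun j => forall_congr' fun i => ?_
      have hj := j.1.2
      have hm : message t j.1 i = xor (x j i) (x' j i) := by
        rw [message_apply, ht j.1 (by omega) i i.2, dif_pos ⟨hj, j.2, i.2⟩]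
      rw [(hσ s).1 j.1 (by have := j.2; omega) i, hm]
      generalize message s j.1 i = b₁
      generalize x j i = b₂
      generalize x' j i = b₃
      cases b₁ <;> cases b₂ <;> cases b₃ <;> decide
    · simp only [hH]
      split_ifs with h
      · rfl
      · rw [(hσ s).2.2 j (not_lt.1 h)]
  have hcard0 : (0 : ℝ) < Fintype.card (∀ j : BufferCode.Recent N k, Fin ((schemeUser D N.succ_pos enc henc φ).a + (schemeUser D N.succ_pos enc henc φ).b j.1) → Bool) := by
    exact_mod_cast Fintype.card_pos
  have hPA : ∀ x, probOf P (fun ω => A ω.1) x =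
      1 / Fintype.card (∀ j : BufferCode.Recent N k, Fin ((schemeUser D N.succ_pos enc henc φ).a + (schemeUser D N.succ_pos enc henc φ).b j.1) → Bool) := by
    intro x
    have h1 : probOf P (fun ω => A ω.1) x = ∑ s, (1 / 2 : ℝ) ^ (schemeUser D N.succ_pos enc henc φ).sent (k + 1) * ind (A s = x) := by
      rw [probOf_eq, Fintype.sum_prod_type]
      refine sum_congr rfl fun s _ => ?_
      simp only
      rw [← sum_mul]
      congr 1
      simp only [Fintype.sum_prod_type, hP, ← mul_sum]
      simp only [hslots _ _ _ fun j => (hF _).2, mul_one]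
      rw [← mul_sum, hν.2, mul_one]
    have h2 := card_mul_sum_fiber A (fun _ => (1 / 2 : ℝ) ^ (schemeUser D N.succ_pos enc henc φ).sent (k + 1)) (fun x x' => by
      obtain ⟨σ, h, _⟩ := hsym x x'
      exact ⟨σ, h, fun _ => rfl⟩) x
    rw [hpow] at h2
    rw [h1, eq_div_iff hcard0.ne', mul_comm]
    exact h2
  have hind : ∀ x o, probOf P' (fun ω => (A ω.1, ω.2)) (x, o) ≤
      probOf P (fun ω => A ω.1) x * probOf P' (fun ω => ω.2) o := by
    intro x o
    have h1 : probOf P' (fun ω => (A ω.1, ω.2)) (x, o) = ∑ s, P' (s, o) * ind (A s = x) := by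
      rw [probOf_eq, Fintype.sum_prod_type]
      refine sum_congr rfl fun s _ => ?_
      rw [sum_eq_single o]
      · by_cases h : A s = x
        · rw [ind_pos h, ind_pos (by rw [h])]
        · rw [ind_neg h, ind_neg (by simp [h])]
      · intro o' _ ho
        rw [ind_neg (by simp [ho]), mul_zero]
      · simp
    have h2 : probOf P' (fun ω => ω.2) o = ∑ s, P' (s, o) := by
      rw [probOf_eq, Fintype.sum_prod_type]
      exact sum_congr rfl fun s _ => sum_mul_ind_eq (fun o => P' (s, o)) o
    have h3 := card_mul_sum_fiber A (fun s => P' (s, o)) (fun x x' => by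
      obtain ⟨σ, h, hc, hH'⟩ := hsym x x'
      exact ⟨σ, h, fun s => by simp only [hP', hc, hH']⟩) x
    rw [h1, h2, hPA, ← h3, one_div, inv_mul_cancel_left₀ hcard0.ne']
  refine (mutualInfo_comp_le_of_indep hP0 hP'0 hP1 hP'1.le hPP' (fun ω => A ω.1) (fun ω => ω.2)
    hind g).trans (div_le_div_of_nonneg_right ?_ (Real.log_nonneg (by norm_num)))
  -- the divergence is a sum over the last slots
  set ℓ : (Fin a → Bool) → R → ℝ := fun w r => Real.log (F w r / Q r) with hℓ
  set J : Finset (Fin (k + 1)) := univ.filter fun j => k < j + (N + 1) * (D + 1) with hJ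
  have hlog : ∀ ω, P ω * Real.log (P ω / P' ω) =
      ∑ j ∈ J, P ω * ℓ (part₁ ω.1 j) (ρ (ω.2.2 j)) := by
    rintro ⟨s, τ, z⟩
    rcases eq_or_ne (P (s, τ, z)) 0 with h0 | h0
    · simp [h0]
    obtain ⟨h1, h2⟩ := hac _ h0
    rw [← mul_sum]
    congr 1
    have h3 : P (s, τ, z) / P' (s, τ, z) =
        ∏ j, F (part₁ s j) (ρ (z j)) / H s j (ρ (z j)) := by
      simp only [hP, hP']
      rw [mul_div_mul_left _ _ h1, ← prod_div_distrib]
      exact prod_congr rfl fun j _ => mul_div_mul_right _ _ (h2 j).2.1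
    rw [h3, Real.log_prod fun j _ => div_ne_zero (h2 j).1 (h2 j).2.2, hJ, sum_filter]
    refine sum_congr rfl fun j _ => ?_
    simp only [hH]
    split_ifs
    · rfl
    · rw [div_self (h2 j).1, Real.log_one]
  have hterm : ∀ j, ∑ ω, P ω * ℓ (part₁ ω.1 j) (ρ (ω.2.2 j)) =
      (∑ w, ∑ r, F w r * ℓ w r) / 2 ^ a := by
    intro j
    rw [Fintype.sum_prod_type]
    have h1 : ∀ s : (schemeUser D N.succ_pos enc henc φ).Bits k, ∑ o : T × (Fin (k + 1) → Z), P (s, o) * ℓ (part₁ s j) (ρ (o.2 j)) =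
        (1 / 2 : ℝ) ^ (schemeUser D N.succ_pos enc henc φ).sent (k + 1) * ∑ r, F (part₁ s j) r * ℓ (part₁ s j) r := by
      intro s
      simp only [Fintype.sum_prod_type, hP, mul_assoc]
      simp only [← mul_sum]
      congr 1
      simp only [mul_sum]
      have h2 : ∀ τ, ∑ z : Fin (k + 1) → Z, ν τ * ((∏ j, F (part₁ s j) (ρ (z j)) *
          G j (cipher s j) τ (z j)) * ℓ (part₁ s j) (ρ (z j))) =
          ν τ * ∑ r, F (part₁ s j) r * ℓ (part₁ s j) r := by
        intro τ
        rw [← mul_sum, sum_slots_eval (H := fun j => F (part₁ s j)) (fun j => (hF _).2)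
          (fun j => hG j (cipher s j) τ) j (ℓ (part₁ s j))]
      simp only [h2, ← sum_mul, hν.2, one_mul]
    simp only [h1]
    rw [avg_slot (hΔ := N.succ_pos) (henc := henc) (φ := φ) (D := D) j
      (fun w _ => ∑ r, F w r * ℓ w r)]
    simp only [sum_const, card_univ, nsmul_eq_mul, Fintype.card_fun, Fintype.card_bool,
      Fintype.card_fin, ← mul_sum]
    push_cast
    rw [mul_comm, mul_div_mul_right _ _ (by positivity)]
  have hD0 : 0 ≤ ∑ w, ∑ r, F w r * ℓ w r := sum_nonneg fun w _ =>
    gibbs (hF w).1 hQ.1 (hFQ w) (by rw [hQ.2, (hF w).2])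
  have hJcard : #J ≤ (N + 1) * (D + 1) := by
    generalize (N + 1) * (D + 1) = L at hJ
    have : #J ≤ #(Finset.Ioc k (k + L)) := by
      refine card_le_card_of_injOn (fun j => (j : ℕ) + L) ?_ ?_
      · intro j hj
        rw [hJ] at hj
        have h1 := (mem_filter.1 hj).2
        have h2 := j.2
        simp only [coe_Ioc, Set.mem_Ioc]
        omega
      · intro j _ j' _ h
        simp only at h
        ext; omega
    simpa using this
  simp only [hlog]
  rw [sum_comm]
  simp only [hterm, sum_const, nsmul_eq_mul]
  exact mul_le_mul_of_nonneg_right (by exact_mod_cast hJcard) (div_nonneg hD0 (by positivity))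

end Leakage

/-! ### Wiretap coding for the multiple access channel by time sharing -/

section Split

variable {ι α β γ : Type*} [Fintype ι] [DecidableEq ι] [Fintype α] [Fintype β] [Fintype γ]

theorem sum_arrow_split (p : ι → Prop) [DecidablePred p]
    (Φ : ({t // p t} → α) → ({t // ¬ p t} → α) → ℝ) :
    ∑ x : ι → α, Φ (fun t => x t) (fun t => x t) = ∑ a, ∑ b, Φ a b := by
  rw [← Fintype.sum_prod_type' (f := Φ)]
  exact Fintype.sum_equiv (Equiv.piEquivPiSubtypeProd p fun _ => α) _ _ fun x => rfl

/-- Marginalization of a product law to the coordinates with `p`. -/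
theorem sum_prod_restrict (p : ι → Prop) [DecidablePred p] {κ : ι → α → ℝ}
    (hκ : ∀ t, ∑ a, κ t a = 1) (g : ({t // p t} → α) → ℝ) :
    ∑ x : ι → α, (∏ t, κ t (x t)) * g (fun t => x t) =
      ∑ r : {t // p t} → α, (∏ t, κ t.1 (r t)) * g r := by
  have := sum_arrow_split (α := α) p (fun a b => (∏ t, κ t.1 (a t)) * (∏ t, κ t.1 (b t)) * g a)
  simp only at this
  calc _ = ∑ x : ι → α, (∏ t : {t // p t}, κ t.1 (x t)) * (∏ t : {t // ¬ p t}, κ t.1 (x t)) *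
        g (fun t => x t) := by
        refine sum_congr rfl fun x _ => ?_
        rw [Fintype.prod_subtype_mul_prod_subtype p (fun t => κ t (x t))]
    _ = _ := this
    _ = _ := by
        refine sum_congr rfl fun a _ => ?_
        rw [← sum_mul, ← mul_sum,
          sum_pi_prod_eq_one (κ := fun t : {t // ¬ p t} => κ t.1) fun t => hκ t.1, mul_one]

/-- The word that is `a` at the times with `p` and constant otherwise. -/
def glue (p : ι → Prop) [DecidablePred p] (c : α) (a : {t // p t} → α) (t : ι) : α :=
  if h : p t then a ⟨t, h⟩ else c

/-- The law of a word that has law `f` at the times with `p` and is constant otherwise. -/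
def splitEnc (p : ι → Prop) (f : ({t // p t} → α) → ℝ) (c : α) (x : ι → α) : ℝ :=
  f (fun t => x t) * ind (∀ t, ¬ p t → x t = c)

omit [Fintype ι] [DecidableEq ι] [Fintype α] in
theorem splitEnc_support {p : ι → Prop} {f : ({t // p t} → α) → ℝ} {c : α} {x : ι → α}
    (h : splitEnc p f c x ≠ 0) : ∀ t, ¬ p t → x t = c := by
  by_contra h'
  exact h (by rw [splitEnc, ind_neg h', mul_zero])

theorem sum_splitEnc (p : ι → Prop) [DecidablePred p] (f : ({t // p t} → α) → ℝ) (c : α)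
    (Φ : (ι → α) → ℝ) : ∑ x, splitEnc p f c x * Φ x = ∑ a, f a * Φ (glue p c a) := by
  have hg : ∀ x : ι → α, (∀ t, ¬ p t → x t = c) → glue p c (fun t => x t) = x := by
    intro x hx
    funext t
    rw [glue]
    split_ifs with h
    · rfl
    · exact (hx t h).symm
  have := sum_arrow_split (α := α) p
    (fun a b => f a * Φ (glue p c a) * ind (b = fun _ => c))
  simp only [← mul_sum, sum_ind_eq, mul_one] at this
  rw [← this]
  refine sum_congr rfl fun x _ => ?_
  have hiff : ((fun t : {t // ¬ p t} => x t) = fun _ => c) ↔ ∀ t, ¬ p t → x t = c := by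
    simp [funext_iff]
  by_cases h : ∀ t, ¬ p t → x t = c
  · rw [splitEnc, ind_pos h, ind_pos (hiff.2 h), hg x h]; ring
  · rw [splitEnc, ind_neg h, ind_neg (mt hiff.1 h)]; ring

theorem splitEnc_mem (p : ι → Prop) [DecidablePred p] {f : ({t // p t} → α) → ℝ}
    (hf : f ∈ stdSimplex ℝ ({t // p t} → α)) (c : α) :
    splitEnc p f c ∈ stdSimplex ℝ (ι → α) := by
  refine ⟨fun x => mul_nonneg (hf.1 _) (ind_nonneg _), ?_⟩
  have := sum_splitEnc p f c (fun _ => 1)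
  simpa [hf.2] using this

/-- Decoding from the times with `p`, where the second input is constant. -/
theorem sum_splitEnc_output {U : α → β → γ → ℝ} (hU : ∀ a b, U a b ∈ stdSimplex ℝ γ) (p : ι → Prop)
    [DecidablePred p] (f : ({t // p t} → α) → ℝ) (c : α) {d : β} {e : (ι → β) → ℝ}
    (he : e ∈ stdSimplex ℝ (ι → β)) (hd : ∀ x, e x ≠ 0 → ∀ t, p t → x t = d)
    (g : ({t // p t} → γ) → ℝ) :
    ∑ x₁, ∑ x₂, ∑ y : ι → γ, splitEnc p f c x₁ * e x₂ * (∏ t, U (x₁ t) (x₂ t) (y t)) *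
        g (fun t => y t) =
      ∑ a, ∑ r : {t // p t} → γ, f a * (∏ t, U (a t) d (r t)) * g r := by
  have h1 : ∀ x₁ x₂, ∑ y : ι → γ, splitEnc p f c x₁ * e x₂ * (∏ t, U (x₁ t) (x₂ t) (y t)) *
        g (fun t => y t) = splitEnc p f c x₁ * (e x₂ *
          ∑ r : {t // p t} → γ, (∏ t : {t // p t}, U (x₁ t) d (r t)) * g r) := by
    intro x₁ x₂
    have := sum_prod_restrict p (fun t => (hU (x₁ t) (x₂ t)).2) g
    simp only [mul_assoc, ← mul_sum, this]
    rcases eq_or_ne (e x₂) 0 with h0 | h0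
    · simp [h0]
    congr 2
    refine sum_congr rfl fun r _ => ?_
    congr 1
    exact prod_congr rfl fun t _ => by rw [hd x₂ h0 t t.2]
  simp only [h1, ← mul_sum, ← sum_mul, he.2, one_mul]
  rw [sum_splitEnc]
  refine sum_congr rfl fun a _ => ?_
  rw [mul_sum]
  refine sum_congr rfl fun r _ => ?_
  rw [mul_assoc]
  congr 2
  exact prod_congr rfl fun t _ => by rw [glue, dif_pos t.2]

/-- The stochastic encoder `enc` hides its message from Eve: her output has, at the times with `p`,
a law that depends on the message only and is on average within divergence `δ` of a fixed law; at
the other times it does not depend on the message at all. This is required whenever the other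
user transmits a word in `other`. -/
def Hides {W : Type*} [Fintype W] (E : α → β → γ → ℝ) (p : ι → Prop) [DecidablePred p]
    (enc : W → (ι → α) → ℝ) (other : Set (ι → β)) (δ : ℝ) : Prop :=
  ∃ (F : W → ({t // p t} → γ) → ℝ) (Q : ({t // p t} → γ) → ℝ) (G : (ι → β) → (ι → γ) → ℝ),
    (∀ w, F w ∈ stdSimplex ℝ ({t // p t} → γ)) ∧ Q ∈ stdSimplex ℝ ({t // p t} → γ) ∧
    (∀ w r, F w r ≠ 0 → Q r ≠ 0) ∧ (∀ x z, 0 ≤ G x z) ∧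
    (∀ x (g : ({t // p t} → γ) → ℝ), ∑ z : ι → γ, g (fun t => z t) * G x z = ∑ r, g r) ∧
    (∀ w, ∀ x ∈ other, ∀ z : ι → γ,
      ∑ s, enc w s * ∏ t, E (s t) (x t) (z t) = F w (fun t => z t) * G x z) ∧
    (∑ w, ∑ r, F w r * Real.log (F w r / Q r)) / Fintype.card W ≤ δ

omit [Fintype β] in
theorem splitEnc_hides {W : Type*} [Fintype W] {E : α → β → γ → ℝ}
    (hE : ∀ a b, E a b ∈ stdSimplex ℝ γ) (p : ι → Prop) [DecidablePred p]
    {f : W → ({t // p t} → α) → ℝ} (hf : ∀ w, f w ∈ stdSimplex ℝ ({t // p t} → α)) (c : α) (d : β)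
    {other : Set (ι → β)} (hother : ∀ x ∈ other, ∀ t, p t → x t = d)
    {q : γ → ℝ} (hq : q ∈ stdSimplex ℝ γ)
    (hfq : ∀ w x (z : {t // p t} → γ), f w x ≠ 0 → ∏ t, E (x t) d (z t) ≠ 0 → ∏ t, q (z t) ≠ 0)
    {δ : ℝ} (hδ : (∑ w, ∑ z : {t // p t} → γ, (∑ x, f w x * ∏ t, E (x t) d (z t)) *
      Real.log ((∑ x, f w x * ∏ t, E (x t) d (z t)) / ∏ t, q (z t))) / Fintype.card W ≤ δ) :
    Hides E p (fun w => splitEnc p (f w) c) other δ := by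
  refine ⟨fun w z => ∑ x, f w x * ∏ t, E (x t) d (z t), fun z => ∏ t, q (z t),
    fun x z => ∏ t : {t // ¬ p t}, E c (x t) (z t), fun w => ?_, piLaw_mem hq, ?_, ?_, ?_, ?_, hδ⟩
  · exact outLaw_mem (W := fun (x : {t // p t} → α) (z : {t // p t} → γ) => ∏ t, E (x t) d (z t))
      (hf w) fun x => prod_mem_stdSimplex (κ := fun t => E (x t) d) fun t => hE _ _
  · intro w r h
    obtain ⟨x, _, hx⟩ := exists_ne_zero_of_sum_ne_zero h
    exact hfq w x r (left_ne_zero_of_mul hx) (right_ne_zero_of_mul hx)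
  · exact fun x z => prod_nonneg fun t _ => (hE _ _).1 _
  · intro x g
    rw [sum_arrow_split p (fun a b => g a * ∏ t : {t // ¬ p t}, E c (x t) (b t))]
    refine sum_congr rfl fun a _ => ?_
    rw [← mul_sum, sum_pi_prod_eq_one (κ := fun t : {t // ¬ p t} => E c (x t))
      fun t => (hE _ _).2, mul_one]
  · intro w x hx z
    rw [sum_splitEnc p (f w) c (fun s => ∏ t, E (s t) (x t) (z t)), sum_mul]
    refine sum_congr rfl fun a _ => ?_
    rw [← Fintype.prod_subtype_mul_prod_subtype p, mul_assoc]
    congr 2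
    · exact prod_congr rfl fun t _ => by rw [glue, dif_pos t.2, hother x hx t t.2]
    · exact prod_congr rfl fun t _ => by rw [glue, dif_neg t.2]

end Split

section WiretapMac

variable {α β γ δ : Type*} [Fintype α] [Fintype β] [Fintype γ] [Fintype δ]

/-- An advantage over Eve on average over the other input is an advantage for some fixed value of
the other input. -/
theorem exists_info_lt {U : α → β → γ → ℝ} {E : α → β → δ → ℝ} {p : α → ℝ} {q : β → ℝ}
    (hq : q ∈ stdSimplex ℝ β) (h : macInfo E p q < macInfo U p q) :
    ∃ b, info p (fun a => E a b) < info p (fun a => U a b) := by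
  obtain ⟨b, _, hb⟩ := exists_lt_of_sum_lt h
  exact ⟨b, lt_of_mul_lt_mul_left hb (hq.1 b)⟩

/-- Wiretap coding for the multiple access channel: in the first half of the time only the first
user transmits a message and the second one sends a fixed symbol, then vice versa. -/
theorem wiretap_mac_coding {U : α → β → γ → ℝ} {E : α → β → δ → ℝ}
    (hU : ∀ a b, U a b ∈ stdSimplex ℝ γ) (hE : ∀ a b, E a b ∈ stdSimplex ℝ δ)
    (h₁ : ∃ p ∈ stdSimplex ℝ α, ∃ q ∈ stdSimplex ℝ β, macInfo E p q < macInfo U p q)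
    (h₂ : ∃ q ∈ stdSimplex ℝ β, ∃ p ∈ stdSimplex ℝ α,
      macInfo (fun b a => E a b) q p < macInfo (fun b a => U a b) q p) :
    ∃ (r κ : ℝ) (e : ℕ → ℝ), 0 < r ∧ 0 ≤ κ ∧ Tendsto e atTop (𝓝 0) ∧
      ∀ (n : ℕ) (W₁ W₂ : Type) [Fintype W₁] [Fintype W₂] [Nonempty W₁] [Nonempty W₂], 2 ≤ n →
      Fintype.card W₁ ≤ Real.exp (n * r) → Fintype.card W₂ ≤ Real.exp (n * r) →
      ∃ (enc₁ : W₁ → (Fin n → α) → ℝ) (enc₂ : W₂ → (Fin n → β) → ℝ)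
        (dec : (Fin n → γ) → W₁ × W₂),
        (∀ w, enc₁ w ∈ stdSimplex ℝ (Fin n → α)) ∧ (∀ w, enc₂ w ∈ stdSimplex ℝ (Fin n → β)) ∧
        (∑ w₁, ∑ w₂, ∑ x₁, ∑ x₂, ∑ y : Fin n → γ, enc₁ w₁ x₁ * enc₂ w₂ x₂ *
          (∏ t, U (x₁ t) (x₂ t) (y t)) * ind (dec y ≠ (w₁, w₂))) /
          (Fintype.card W₁ * Fintype.card W₂) ≤ e n ∧
        Hides E (fun t : Fin n => (t : ℕ) < n / 2) enc₁ {x | ∃ w, enc₂ w x ≠ 0} (κ * √n) ∧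
        Hides (fun b a => E a b) (fun t : Fin n => ¬ (t : ℕ) < n / 2) enc₂ {x | ∃ w, enc₁ w x ≠ 0}
          (κ * √n) := by
  obtain ⟨p, hp, p', hp', hpp⟩ := h₁
  obtain ⟨q, hq, q', hq', hqq⟩ := h₂
  obtain ⟨d, hd⟩ := exists_info_lt hp' hpp
  obtain ⟨c, hc⟩ := exists_info_lt hq' hqq
  obtain ⟨r₁, κ₁, e₁, hr₁, he₁, H₁⟩ :=
    wiretap_coding hp (fun a => hU a d) (fun a => hE a d) hd
  obtain ⟨r₂, κ₂, e₂, hr₂, he₂, H₂⟩ :=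
    wiretap_coding hq (fun b => hU c b) (fun b => hE c b) hc
  have hhalf : Tendsto (fun n : ℕ => n / 2) atTop atTop :=
    tendsto_atTop_mono' _ (Eventually.of_forall fun n => le_rfl)
      (Nat.tendsto_div_const_atTop (by norm_num))
  have hhalf' : Tendsto (fun n : ℕ => n - n / 2) atTop atTop :=
    tendsto_atTop_mono (fun n => by omega) hhalf
  refine ⟨min r₁ r₂ / 3, max κ₁ κ₂ ⊔ 0, fun n => e₁ (n / 2) + e₂ (n - n / 2), by positivity,
    le_max_right _ _, by simpa using (he₁.comp hhalf).add (he₂.comp hhalf'), ?_⟩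
  intro n W₁ W₂ _ _ _ _ hn hW₁ hW₂
  have hc₁ : Fintype.card {t : Fin n // (t : ℕ) < n / 2} = n / 2 := by
    rw [Fintype.card_subtype, Fin.card_filter_val_lt]; omega
  have hc₂ : Fintype.card {t : Fin n // ¬ (t : ℕ) < n / 2} = n - n / 2 := by
    rw [Fintype.card_subtype_compl, hc₁, Fintype.card_fin]
  have hrate : ∀ (W : Type) [Fintype W] (s : ℝ) (m : ℕ), Fintype.card W ≤
      Real.exp (n * (min r₁ r₂ / 3)) → n ≤ 3 * m → min r₁ r₂ ≤ s →
      (Fintype.card W : ℝ) ≤ Real.exp (m * s) := by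
    intro W _ s m hW hm hs
    refine hW.trans (Real.exp_le_exp.2 ?_)
    have hm' : (n : ℝ) ≤ 3 * m := by exact_mod_cast hm
    have h0 : 0 < min r₁ r₂ := lt_min hr₁ hr₂
    calc (n : ℝ) * (min r₁ r₂ / 3) ≤ 3 * m * (min r₁ r₂ / 3) := by gcongr
      _ = m * min r₁ r₂ := by ring
      _ ≤ m * s := by gcongr
  obtain ⟨f₁, g₁, hf₁, herr₁, hac₁, hdiv₁⟩ := H₁ {t : Fin n // (t : ℕ) < n / 2} W₁
    (by rw [hc₁]; omega) (by rw [hc₁]; exact hrate W₁ r₁ _ hW₁ (by omega) (min_le_left _ _))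
  obtain ⟨f₂, g₂, hf₂, herr₂, hac₂, hdiv₂⟩ := H₂ {t : Fin n // ¬ (t : ℕ) < n / 2} W₂
    (by rw [hc₂]; omega) (by rw [hc₂]; exact hrate W₂ r₂ _ hW₂ (by omega) (min_le_right _ _))
  have hκ : ∀ (κ : ℝ) (m : ℕ), m ≤ n → κ ≤ max κ₁ κ₂ → κ * √m ≤ (max κ₁ κ₂ ⊔ 0) * √n := by
    intro κ m hm hκ
    exact mul_le_mul (hκ.trans (le_max_left _ _)) (Real.sqrt_le_sqrt (by exact_mod_cast hm))
      (Real.sqrt_nonneg _) (le_max_right _ _)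
  have hm₁ : ∀ w, splitEnc (fun t : Fin n => (t : ℕ) < n / 2) (f₁ w) c ∈
    stdSimplex ℝ (Fin n → α) := fun w => splitEnc_mem _ (hf₁ w) c
  have hm₂ : ∀ w, splitEnc (fun t : Fin n => ¬ (t : ℕ) < n / 2) (f₂ w) d ∈
    stdSimplex ℝ (Fin n → β) := fun w => splitEnc_mem _ (hf₂ w) d
  refine ⟨fun w => splitEnc _ (f₁ w) c, fun w => splitEnc _ (f₂ w) d,
    fun y => (g₁ fun t => y t, g₂ fun t => y t), hm₁, hm₂, ?_, ?_, ?_⟩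
  · have hW₁0 : (0 : ℝ) < Fintype.card W₁ := by exact_mod_cast Fintype.card_pos
    have hW₂0 : (0 : ℝ) < Fintype.card W₂ := by exact_mod_cast Fintype.card_pos
    rw [hc₁] at herr₁
    rw [hc₂] at herr₂
    have hpt : ∀ w₁ w₂, ∑ x₁, ∑ x₂, ∑ y : Fin n → γ,
        splitEnc (fun t : Fin n => (t : ℕ) < n / 2) (f₁ w₁) c x₁ *
          splitEnc (fun t : Fin n => ¬ (t : ℕ) < n / 2) (f₂ w₂) d x₂ *
          (∏ t, U (x₁ t) (x₂ t) (y t)) * ind ((g₁ fun t => y t, g₂ fun t => y t) ≠ (w₁, w₂)) ≤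
        (∑ a, ∑ y : {t : Fin n // (t : ℕ) < n / 2} → γ, f₁ w₁ a * (∏ t, U (a t) d (y t)) *
          ind (g₁ y ≠ w₁)) +
        (∑ b, ∑ y : {t : Fin n // ¬ (t : ℕ) < n / 2} → γ, f₂ w₂ b * (∏ t, U c (b t) (y t)) *
          ind (g₂ y ≠ w₂)) := by
      intro w₁ w₂
      rw [← sum_splitEnc_output hU _ (f₁ w₁) c (hm₂ w₂)
          (fun x hx t ht => splitEnc_support hx t (not_not.2 ht)) (fun y => ind (g₁ y ≠ w₁)),
        ← sum_splitEnc_output (U := fun b a => U a b) (fun b a => hU a b) _ (f₂ w₂) d (hm₁ w₁)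
          (fun x hx t ht => splitEnc_support hx t ht) (fun y => ind (g₂ y ≠ w₂))]
      rw [sum_comm (s := (univ : Finset (Fin n → β)))]
      simp only [← sum_add_distrib]
      refine sum_le_sum fun x₁ _ => sum_le_sum fun x₂ _ => sum_le_sum fun y _ => ?_
      have h0 : 0 ≤ splitEnc (fun t : Fin n => (t : ℕ) < n / 2) (f₁ w₁) c x₁ *
          splitEnc (fun t : Fin n => ¬ (t : ℕ) < n / 2) (f₂ w₂) d x₂ *
          (∏ t, U (x₁ t) (x₂ t) (y t)) :=
        mul_nonneg (mul_nonneg ((hm₁ _).1 _) ((hm₂ _).1 _)) (prod_nonneg fun t _ => (hU _ _).1 _)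
      rw [mul_comm (splitEnc (fun t : Fin n => ¬ (t : ℕ) < n / 2) (f₂ w₂) d x₂), ← mul_add]
      refine mul_le_mul_of_nonneg_left ?_ h0
      by_cases h1 : g₁ (fun t => y t) = w₁
      · by_cases h2 : g₂ (fun t => y t) = w₂
        · rw [ind_neg (by simp [h1, h2])]
          exact add_nonneg (ind_nonneg _) (ind_nonneg _)
        · rw [ind_pos (s := g₂ _ ≠ w₂) h2]
          exact (ind_le_one _).trans (le_add_of_nonneg_left (ind_nonneg _))
      · rw [ind_pos (s := g₁ _ ≠ w₁) h1]
        exact (ind_le_one _).trans (le_add_of_nonneg_right (ind_nonneg _))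
    refine (div_le_div_of_nonneg_right (sum_le_sum fun w₁ _ => sum_le_sum fun w₂ _ => hpt w₁ w₂)
      (by positivity)).trans ?_
    simp only [sum_add_distrib, sum_const, card_univ, nsmul_eq_mul, ← mul_sum]
    rw [add_div]
    refine add_le_add (le_trans (le_of_eq ?_) herr₁) (le_trans (le_of_eq ?_) herr₂)
    · field_simp
    · field_simp
  · refine splitEnc_hides hE _ hf₁ c d ?_ (outLaw_mem hp fun a => hE a d) hac₁
      (hdiv₁.trans (hκ _ _ ?_ (le_max_left _ _)))
    · rintro x ⟨w, hw⟩ t ht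
      exact splitEnc_support hw t (not_not.2 ht)
    · rw [hc₁]; omega
  · refine splitEnc_hides (E := fun b a => E a b) (fun b a => hE a b) _ hf₂ d c ?_
      (outLaw_mem hq fun b => hE c b) hac₂ (hdiv₂.trans (hκ _ _ ?_ (le_max_right _ _)))
    · rintro x ⟨w, hw⟩ t ht
      exact splitEnc_support hw t ht
    · rw [hc₂]; omega

end WiretapMac

/-! ### Leakage and error probability of the layered key scheme -/

section EveLaw

variable {𝒳₁ 𝒳₂ 𝒴 𝒵 : Type*} [Fintype 𝒳₁] [Fintype 𝒳₂] [Fintype 𝒴] [Fintype 𝒵] {n₁ n₂ : ℕ}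

open UserCode

/-- The joint law of the message bits of a user, of the message bits and codewords of the other
user, and of Eve's observations, where `E` is Eve's channel. -/
def eveLaw (u₁ : UserCode 𝒳₁ n₁ n₂) (u₂ : UserCode 𝒳₂ n₁ n₂) (E : 𝒳₁ → 𝒳₂ → 𝒵 → ℝ) (k : ℕ) :
    u₁.Bits k × (u₂.Bits k × (Fin (k + 1) → Fin n₁ ⊕ Fin n₂ → 𝒳₂)) ×
      (Fin (k + 1) → Fin n₁ ⊕ Fin n₂ → 𝒵) → ℝ :=
  fun ω => (1 / 2) ^ u₁.sent (k + 1) *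
    ((1 / 2) ^ u₂.sent (k + 1) * ∏ j, slotEnc ω.2.1.1 j (ω.2.1.2 j)) *
    ∏ j, ∑ x, slotEnc ω.1 j x * ∏ t, E (x t) (ω.2.1.2 j t) (ω.2.2 j t)

variable (C : BufferCode 𝒳₁ 𝒳₂ 𝒴 n₁ n₂) (V : Channel 𝒳₁ 𝒳₂ 𝒴 𝒵) {k : ℕ}

theorem ind_and (s t : Prop) : ind (s ∧ t) = ind s * ind t := by
  by_cases h : s <;> by_cases h' : t <;> simp [ind, h, h']

theorem ind_forall {κ : Type*} [Fintype κ] (s : κ → Prop) : ind (∀ j, s j) = ∏ j, ind (s j) := by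
  by_cases h : ∀ j, s j
  · rw [ind_pos h, prod_eq_one fun j _ => ind_pos (h j)]
  · rw [ind_neg h]
    push Not at h
    obtain ⟨j, hj⟩ := h
    exact (prod_eq_zero (mem_univ j) (ind_neg hj)).symm

theorem sum_mul_ind_eq' {α : Type*} [Fintype α] (f : α → ℝ) (a₀ : α) :
    ∑ a, ind (a = a₀) * f a = f a₀ := by
  simp only [mul_comm (ind _), sum_mul_ind_eq]

theorem slot_eve₁ (s₁ : C.user₁.Bits k) (s₂ : C.user₂.Bits k) (j : Fin (k + 1))
    (x₂ : Fin n₁ ⊕ Fin n₂ → 𝒳₂) (z : Fin n₁ ⊕ Fin n₂ → 𝒵) :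
    ∑ q, C.slot V s₁ s₂ j q * ind (q.2.1 = x₂ ∧ q.2.2.2 = z) =
      slotEnc s₂ j x₂ * ∑ x₁, slotEnc s₁ j x₁ * ∏ t, V.eve (x₁ t) (x₂ t) (z t) := by
  simp only [Fintype.sum_prod_type, BufferCode.slot, Channel.slotLaw, ind_and]
  rw [mul_sum]
  refine sum_congr rfl fun x₁ _ => ?_
  rw [sum_comm (s := (univ : Finset (Fin n₁ ⊕ Fin n₂ → 𝒳₂)))]
  simp only [← sum_prob_bob, mul_sum]
  refine sum_congr rfl fun y _ => ?_
  simp only [← mul_assoc, sum_mul_ind_eq]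
  ring

theorem slot_eve₂ (s₁ : C.user₁.Bits k) (s₂ : C.user₂.Bits k) (j : Fin (k + 1))
    (x₁ : Fin n₁ ⊕ Fin n₂ → 𝒳₁) (z : Fin n₁ ⊕ Fin n₂ → 𝒵) :
    ∑ q, C.slot V s₁ s₂ j q * ind (q.1 = x₁ ∧ q.2.2.2 = z) =
      slotEnc s₁ j x₁ * ∑ x₂, slotEnc s₂ j x₂ * ∏ t, V.eve (x₁ t) (x₂ t) (z t) := by
  simp only [Fintype.sum_prod_type, BufferCode.slot, Channel.slotLaw, ind_and]
  rw [sum_comm, mul_sum]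
  refine sum_congr rfl fun x₂ _ => ?_
  rw [sum_comm]
  simp only [← sum_prob_bob, mul_sum]
  refine sum_congr rfl fun y _ => ?_
  simp only [← mul_assoc, sum_mul_ind_eq]

theorem probOf_law_user₁ : probOf (C.law V k)
    (fun ω => (ω.1.1, (ω.1.2, BufferCode.codeword₂ ω), BufferCode.eve ω)) =
      eveLaw C.user₁ C.user₂ V.eve k := by
  funext ⟨s₁, ⟨s₂, x₂⟩, z⟩
  rw [probOf_eq]
  have h := C.sum_law (V := V) (k := k) (fun s₁' s₂' f => ind (s₁' = s₁) * (ind (s₂' = s₂) *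
    ∏ j, ind ((f j).2.1 = x₂ j ∧ (f j).2.2.2 = z j)))
  refine Eq.trans (sum_congr rfl fun ω _ => ?_) (h.trans ?_)
  · rw [← ind_forall, ← ind_and, ← ind_and]
    congr 2
    simp only [Prod.mk.injEq, funext_iff, BufferCode.codeword₂, BufferCode.eve, forall_and,
      and_assoc]
  · have hs : ∀ s₁' s₂', C.bitLaw k * ∑ f : Fin (k + 1) → SlotData (Fin n₁ ⊕ Fin n₂) 𝒳₁ 𝒳₂ 𝒴 𝒵,
        (∏ j, C.slot V s₁' s₂' j (f j)) * (ind (s₁' = s₁) * (ind (s₂' = s₂) *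
          ∏ j, ind ((f j).2.1 = x₂ j ∧ (f j).2.2.2 = z j))) =
        ind (s₁' = s₁) * (ind (s₂' = s₂) * (C.bitLaw k * ∏ j, ∑ q, C.slot V s₁' s₂' j q *
          ind (q.2.1 = x₂ j ∧ q.2.2.2 = z j))) := by
      intro s₁' s₂'
      rw [← sum_pi_prod]
      simp only [mul_sum, prod_mul_distrib]
      exact sum_congr rfl fun f _ => by ring
    simp only [hs, ← mul_sum, sum_mul_ind_eq']
    simp only [slot_eve₁, prod_mul_distrib, BufferCode.bitLaw, eveLaw]
    ring

theorem probOf_law_user₂ : probOf (C.law V k)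
    (fun ω => (ω.1.2, (ω.1.1, BufferCode.codeword₁ ω), BufferCode.eve ω)) =
      eveLaw C.user₂ C.user₁ (fun x₂ x₁ => V.eve x₁ x₂) k := by
  funext ⟨s₂, ⟨s₁, x₁⟩, z⟩
  rw [probOf_eq]
  have h := C.sum_law (V := V) (k := k) (fun s₁' s₂' f => ind (s₁' = s₁) * (ind (s₂' = s₂) *
    ∏ j, ind ((f j).1 = x₁ j ∧ (f j).2.2.2 = z j)))
  refine Eq.trans (sum_congr rfl fun ω _ => ?_) (h.trans ?_)
  · rw [← ind_forall, ← ind_and, ← ind_and]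
    congr 2
    simp only [Prod.mk.injEq, funext_iff, BufferCode.codeword₁, BufferCode.eve, forall_and,
      and_assoc, and_left_comm]
  · have hs : ∀ s₁' s₂', C.bitLaw k * ∑ f : Fin (k + 1) → SlotData (Fin n₁ ⊕ Fin n₂) 𝒳₁ 𝒳₂ 𝒴 𝒵,
        (∏ j, C.slot V s₁' s₂' j (f j)) * (ind (s₁' = s₁) * (ind (s₂' = s₂) *
          ∏ j, ind ((f j).1 = x₁ j ∧ (f j).2.2.2 = z j))) =
        ind (s₁' = s₁) * (ind (s₂' = s₂) * (C.bitLaw k * ∏ j, ∑ q, C.slot V s₁' s₂' j q *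
          ind (q.1 = x₁ j ∧ q.2.2.2 = z j))) := by
      intro s₁' s₂'
      rw [← sum_pi_prod]
      simp only [mul_sum, prod_mul_distrib]
      exact sum_congr rfl fun f _ => by ring
    simp only [hs, ← mul_sum, sum_mul_ind_eq']
    simp only [slot_eve₂, prod_mul_distrib, BufferCode.bitLaw, eveLaw]
    ring

variable {a D N : ℕ} {enc : (Fin a → Bool) → (Fin n₁ → 𝒳₁) → ℝ}
  {henc : ∀ w, enc w ∈ stdSimplex ℝ (Fin n₁ → 𝒳₁)} {φ : ∀ d, (Fin (a * d) → Bool) → Fin n₂ → 𝒳₁}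

/-- The leakage of the recent messages of a user to Eve, even if she knows everything about the
other user. -/
theorem mutualInfo_eveLaw_le {O : Type*} [Fintype O] {E : 𝒳₁ → 𝒳₂ → 𝒵 → ℝ}
    (hE : ∀ a b, E a b ∈ stdSimplex ℝ 𝒵)
    (u₂ : UserCode 𝒳₂ n₁ n₂) {p : Fin n₁ → Prop} [DecidablePred p] {δ : ℝ}
    (h : Hides E p enc {x | ∃ w, u₂.wiretapEnc w x ≠ 0} δ)
    (g : (u₂.Bits k × (Fin (k + 1) → Fin n₁ ⊕ Fin n₂ → 𝒳₂)) ×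
      (Fin (k + 1) → Fin n₁ ⊕ Fin n₂ → 𝒵) → O) :
    mutualInfo (eveLaw (schemeUser D N.succ_pos enc henc φ) u₂ E k)
      (fun ω => fun j : BufferCode.Recent N k => message ω.1 j.1) (fun ω => g ω.2) ≤
      ((N + 1) * (D + 1) : ℕ) * δ / Real.log 2 := by
  obtain ⟨F, Q, G, hF, hQ, hFQ, hG0, hG, hEq, hδ⟩ := h
  have hν : (fun τ : u₂.Bits k × (Fin (k + 1) → Fin n₁ ⊕ Fin n₂ → 𝒳₂) =>
      (1 / 2 : ℝ) ^ u₂.sent (k + 1) * ∏ j, slotEnc τ.1 j (τ.2 j)) ∈ stdSimplex ℝ _ := by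
    refine ⟨fun τ => mul_nonneg (by positivity) (prod_nonneg fun j _ => (slotEnc_mem _ _).1 _), ?_⟩
    simp only [Fintype.sum_prod_type, ← mul_sum]
    simp only [sum_pi_prod_eq_one fun j => (slotEnc_mem _ j).2, sum_const, card_univ, nsmul_eq_mul,
      mul_one, Fintype.card_fun, Fintype.card_bool, Fintype.card_fin]
    push_cast
    rw [← mul_pow]; norm_num
  refine (mutualInfo_recent_le hν hF hQ hFQ
    (fun (z : Fin n₁ ⊕ Fin n₂ → 𝒵) (t : {t // p t}) => z (Sum.inl t))
    (fun j c τ z => G (fun t => τ.2 j (Sum.inl t)) (fun t => z (Sum.inl t)) *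
      ∏ t, E (φ (layers D (N + 1) j) c t) (τ.2 j (Sum.inr t)) (z (Sum.inr t)))
    (fun j c τ z => mul_nonneg (hG0 _ _) (prod_nonneg fun t _ => (hE _ _).1 _)) ?_ _ ?_ g).trans ?_
  · intro j c τ g
    have h := sum_sum_arrow (fun (za : Fin n₁ → 𝒵) (zb : Fin n₂ → 𝒵) => g (fun t => za t) *
      (G (fun t => τ.2 j (Sum.inl t)) za *
      ∏ t, E (φ (layers D (N + 1) j) c t) (τ.2 j (Sum.inr t)) (zb t)))
    rw [h, ← hG (fun t => τ.2 j (Sum.inl t)) g]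
    refine sum_congr rfl fun za _ => ?_
    rw [← mul_sum, ← mul_sum, sum_pi_prod_eq_one
      (κ := fun t => E (φ (layers D (N + 1) j) c t) (τ.2 j (Sum.inr t))) fun t => (hE _ _).2, mul_one]
  · rintro s ⟨s₂, x₂⟩ z
    simp only [eveLaw]
    rcases eq_or_ne (∏ j, slotEnc s₂ j (x₂ j)) 0 with h0 | h0
    · rw [h0]; ring
    congr 1
    refine prod_congr rfl fun j _ => ?_
    have hj := left_ne_zero_of_mul (prod_ne_zero_iff.1 h0 j (mem_univ j))
    rw [← mul_assoc, ← hEq (part₁ s j) _ ⟨_, hj⟩ (fun t => z j (Sum.inl t)), sum_mul]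
    have h := sum_sum_arrow (fun (xa : Fin n₁ → 𝒳₁) (xb : Fin n₂ → 𝒳₁) => enc (part₁ s j) xa *
      ind (xb = φ (layers D (N + 1) j) (cipher s j)) *
      ((∏ t, E (xa t) (x₂ j (Sum.inl t)) (z j (Sum.inl t))) *
        ∏ t, E (xb t) (x₂ j (Sum.inr t)) (z j (Sum.inr t))))
    simp only [Fintype.prod_sum_type]
    refine h.trans (sum_congr rfl fun xa _ => ?_)
    simp only [mul_assoc, ← mul_sum, sum_mul_ind_eq']
  · gcongr
    simpa using hδ

/-- By the chain rule, the conditional leakage only grows when the codeword of the other user is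
counted as part of the observation. -/
theorem leakage₁_le (N : ℕ) : C.leakage₁ V N k ≤ mutualInfo (eveLaw C.user₁ C.user₂ V.eve k)
    (fun ω => fun j : BufferCode.Recent N k => message ω.1 j.1)
    (fun ω => (ω.2.2, ω.2.1.2 (Fin.last k))) := by
  rw [← probOf_law_user₁, mutualInfo_map]
  exact condMutualInfo_le (fun ω => C.law_nonneg ω) C.sum_law_eq_one _ _ _

theorem leakage₂_le (N : ℕ) : C.leakage₂ V N k ≤
    mutualInfo (eveLaw C.user₂ C.user₁ (fun x₂ x₁ => V.eve x₁ x₂) k)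
    (fun ω => fun j : BufferCode.Recent N k => message ω.1 j.1)
    (fun ω => (ω.2.2, ω.2.1.2 (Fin.last k))) := by
  rw [← probOf_law_user₂, mutualInfo_map]
  exact condMutualInfo_le (fun ω => C.law_nonneg ω) C.sum_law_eq_one _ _ _

/-- The messages of the first user are bounded while those of the second user are revealed to Eve. -/
theorem leakage_le (N : ℕ) : C.leakage V N k ≤ mutualInfo (eveLaw C.user₁ C.user₂ V.eve k)
    (fun ω => fun j : BufferCode.Recent N k => message ω.1 j.1)
    (fun ω => (ω.2.2, fun j : BufferCode.Recent N k => message ω.2.1.1 j.1)) +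
    mutualInfo (eveLaw C.user₂ C.user₁ (fun x₂ x₁ => V.eve x₁ x₂) k)
    (fun ω => fun j : BufferCode.Recent N k => message ω.1 j.1) (fun ω => ω.2.2) := by
  rw [← probOf_law_user₁, ← probOf_law_user₂, mutualInfo_map, mutualInfo_map]
  exact mutualInfo_pair_le (fun ω => C.law_nonneg ω) C.sum_law_eq_one _ _ _

end EveLaw

section SchemeCode

variable {𝒳₁ 𝒳₂ 𝒴 𝒵 : Type*} [Fintype 𝒳₁] [Fintype 𝒳₂] [Fintype 𝒴] [Fintype 𝒵] {n₁ n₂ : ℕ}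

open UserCode

variable (V : Channel 𝒳₁ 𝒳₂ 𝒴 𝒵) {a₁ a₂ D N : ℕ}
  {enc₁ : (Fin a₁ → Bool) → (Fin n₁ → 𝒳₁) → ℝ} (henc₁ : ∀ w, enc₁ w ∈ stdSimplex ℝ (Fin n₁ → 𝒳₁))
  {enc₂ : (Fin a₂ → Bool) → (Fin n₁ → 𝒳₂) → ℝ} (henc₂ : ∀ w, enc₂ w ∈ stdSimplex ℝ (Fin n₁ → 𝒳₂))
  (φ₁ : ∀ d, (Fin (a₁ * d) → Bool) → Fin n₂ → 𝒳₁) (φ₂ : ∀ d, (Fin (a₂ * d) → Bool) → Fin n₂ → 𝒳₂)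
  (dec : (Fin n₁ → 𝒴) → (Fin a₁ → Bool) × (Fin a₂ → Bool))
  (dec' : ∀ d, (Fin n₂ → 𝒴) → (Fin (a₁ * d) → Bool) × (Fin (a₂ * d) → Bool))

/-- The message streams `s₁`, `s₂` agree with everything that is decoded from the separate parts of
the slots `0, …, k`. -/
def Consistent {k : ℕ} (D N : ℕ) (y : Fin (k + 1) → Fin n₁ ⊕ Fin n₂ → 𝒴)
    (s₁ : (schemeUser D N.succ_pos enc₁ henc₁ φ₁).Bits k)
    (s₂ : (schemeUser D N.succ_pos enc₂ henc₂ φ₂).Bits k) : Prop :=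
  ∀ j, dec (fun t => y j (Sum.inl t)) = (part₁ s₁ j, part₁ s₂ j) ∧
    dec' (layers D (N + 1) j) (fun t => y j (Sum.inr t)) = (cipher s₁ j, cipher s₂ j)

open Classical in
/-- The code with key buffers built from a wiretap code for the first part of the slots and codes
for the multiple access channel for the second part. Bob decodes the parts separately and looks for
a consistent pair of message streams. -/
@[reducible] def schemeCode (D N : ℕ) : BufferCode 𝒳₁ 𝒳₂ 𝒴 n₁ n₂ where
  user₁ := schemeUser D N.succ_pos enc₁ henc₁ φ₁
  user₂ := schemeUser D N.succ_pos enc₂ henc₂ φ₂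
  decode k y := if h : ∃ s : (schemeUser D N.succ_pos enc₁ henc₁ φ₁).Bits k ×
      (schemeUser D N.succ_pos enc₂ henc₂ φ₂).Bits k,
      Consistent henc₁ henc₂ φ₁ φ₂ dec dec' D N y s.1 s.2 then
    (message h.choose.1 (Fin.last k), message h.choose.2 (Fin.last k))
    else (fun _ => false, fun _ => false)

variable {henc₁ henc₂ φ₁ φ₂ dec dec'}

omit [Fintype 𝒴] in
theorem schemeCode_decode {k : ℕ} {y : Fin (k + 1) → Fin n₁ ⊕ Fin n₂ → 𝒴}
    {s₁ : (schemeUser D N.succ_pos enc₁ henc₁ φ₁).Bits k}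
    {s₂ : (schemeUser D N.succ_pos enc₂ henc₂ φ₂).Bits k}
    (h : Consistent henc₁ henc₂ φ₁ φ₂ dec dec' D N y s₁ s₂) :
    (schemeCode henc₁ henc₂ φ₁ φ₂ dec dec' D N).decode k y =
      (message s₁ (Fin.last k), message s₂ (Fin.last k)) := by
  have hex : ∃ s : (schemeUser D N.succ_pos enc₁ henc₁ φ₁).Bits k ×
      (schemeUser D N.succ_pos enc₂ henc₂ φ₂).Bits k,
      Consistent henc₁ henc₂ φ₁ φ₂ dec dec' D N y s.1 s.2 := ⟨(s₁, s₂), h⟩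
  simp only [schemeCode]
  rw [dif_pos hex]
  have hc := hex.choose_spec
  generalize hex.choose = s at hc
  have e₁ : message s.1 (Fin.last k) = message s₁ (Fin.last k) := message_eq_of_cipher_eq
    (fun j => congrArg Prod.fst ((hc j).1.symm.trans (h j).1))
    (fun j => congrArg Prod.fst ((hc j).2.symm.trans (h j).2)) _
  have e₂ : message s.2 (Fin.last k) = message s₂ (Fin.last k) := message_eq_of_cipher_eq
    (fun j => congrArg Prod.snd ((hc j).1.symm.trans (h j).1))
    (fun j => congrArg Prod.snd ((hc j).2.symm.trans (h j).2)) _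
  rw [e₁, e₂]

variable {V} in
/-- The expectation of a function of the two parts of Bob's output of a slot. -/
theorem sum_slotLaw_parts {k : ℕ} (s₁ : (schemeUser D N.succ_pos enc₁ henc₁ φ₁).Bits k)
    (s₂ : (schemeUser D N.succ_pos enc₂ henc₂ φ₂).Bits k) (j : Fin (k + 1))
    (Φ : (Fin n₁ → 𝒴) → (Fin n₂ → 𝒴) → ℝ) :
    ∑ q : SlotData (Fin n₁ ⊕ Fin n₂) 𝒳₁ 𝒳₂ 𝒴 𝒵, V.slotLaw (slotEnc s₁ j) (slotEnc s₂ j) q *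
      Φ (fun t => q.2.2.1 (Sum.inl t)) (fun t => q.2.2.1 (Sum.inr t)) =
    ∑ x₁, ∑ x₂, ∑ y, ∑ y', enc₁ (part₁ s₁ j) x₁ * enc₂ (part₁ s₂ j) x₂ *
      (∏ t, V.bob (x₁ t) (x₂ t) (y t)) * (∏ t, V.bob (φ₁ (layers D (N + 1) j) (cipher s₁ j) t)
        (φ₂ (layers D (N + 1) j) (cipher s₂ j) t) (y' t)) * Φ y y' := by
  rw [slotLaw_sum_bob (slotEnc s₁ j) (slotEnc s₂ j)
    (fun _ _ y => Φ (fun t => y (Sum.inl t)) (fun t => y (Sum.inr t)))]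
  simp only [slotEnc_schemeUser, Fintype.prod_sum_type]
  have hy : ∀ (x₁ : Fin n₁ ⊕ Fin n₂ → 𝒳₁) (x₂ : Fin n₁ ⊕ Fin n₂ → 𝒳₂) (c : ℝ),
      ∑ y : Fin n₁ ⊕ Fin n₂ → 𝒴, c *
      ((∏ t, V.bob (x₁ (Sum.inl t)) (x₂ (Sum.inl t)) (y (Sum.inl t))) *
        ∏ t, V.bob (x₁ (Sum.inr t)) (x₂ (Sum.inr t)) (y (Sum.inr t))) *
      Φ (fun t => y (Sum.inl t)) (fun t => y (Sum.inr t)) =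
      ∑ y, ∑ y', c * ((∏ t, V.bob (x₁ (Sum.inl t)) (x₂ (Sum.inl t)) (y t)) *
        ∏ t, V.bob (x₁ (Sum.inr t)) (x₂ (Sum.inr t)) (y' t)) * Φ y y' := fun x₁ x₂ c =>
    sum_sum_arrow (fun y y' => c * ((∏ t, V.bob (x₁ (Sum.inl t)) (x₂ (Sum.inl t)) (y t)) *
        ∏ t, V.bob (x₁ (Sum.inr t)) (x₂ (Sum.inr t)) (y' t)) * Φ y y')
  simp only [hy]
  have h₂ : ∀ x₁ : Fin n₁ ⊕ Fin n₂ → 𝒳₁, ∀ c : ℝ, ∑ x₂ : Fin n₁ ⊕ Fin n₂ → 𝒳₂, ∑ y, ∑ y',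
      c * (enc₂ (part₁ s₂ j) (fun i => x₂ (Sum.inl i)) *
        ind ((fun i => x₂ (Sum.inr i)) = φ₂ (layers D (N + 1) j) (cipher s₂ j))) *
        ((∏ t, V.bob (x₁ (Sum.inl t)) (x₂ (Sum.inl t)) (y t)) *
        ∏ t, V.bob (x₁ (Sum.inr t)) (x₂ (Sum.inr t)) (y' t)) * Φ y y' =
      ∑ x₂, ∑ y, ∑ y', c * enc₂ (part₁ s₂ j) x₂ *
        ((∏ t, V.bob (x₁ (Sum.inl t)) (x₂ t) (y t)) *
        ∏ t, V.bob (x₁ (Sum.inr t)) (φ₂ (layers D (N + 1) j) (cipher s₂ j) t) (y' t)) * Φ y y' := by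
    intro x₁ c
    rw [sum_sum_arrow (fun xa xb => ∑ y, ∑ y', c * (enc₂ (part₁ s₂ j) xa *
        ind (xb = φ₂ (layers D (N + 1) j) (cipher s₂ j))) *
        ((∏ t, V.bob (x₁ (Sum.inl t)) (xa t) (y t)) *
        ∏ t, V.bob (x₁ (Sum.inr t)) (xb t) (y' t)) * Φ y y')]
    refine sum_congr rfl fun xa _ => ?_
    rw [← sum_mul_ind_eq (fun xb : Fin n₂ → 𝒳₂ => ∑ y, ∑ y', c * enc₂ (part₁ s₂ j) xa *
      ((∏ t, V.bob (x₁ (Sum.inl t)) (xa t) (y t)) *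
        ∏ t, V.bob (x₁ (Sum.inr t)) (xb t) (y' t)) * Φ y y')]
    simp only [sum_mul]
    exact sum_congr rfl fun xb _ => sum_congr rfl fun y _ => sum_congr rfl fun y' _ => by ring
  simp only [h₂]
  rw [sum_sum_arrow (fun xa xb => ∑ x₂, ∑ y, ∑ y', enc₁ (part₁ s₁ j) xa *
        ind (xb = φ₁ (layers D (N + 1) j) (cipher s₁ j)) * enc₂ (part₁ s₂ j) x₂ *
        ((∏ t, V.bob (xa t) (x₂ t) (y t)) *
        ∏ t, V.bob (xb t) (φ₂ (layers D (N + 1) j) (cipher s₂ j) t) (y' t)) * Φ y y')]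
  refine sum_congr rfl fun xa _ => ?_
  rw [← sum_mul_ind_eq (fun xb : Fin n₂ → 𝒳₁ => ∑ x₂, ∑ y, ∑ y', enc₁ (part₁ s₁ j) xa *
        enc₂ (part₁ s₂ j) x₂ * (∏ t, V.bob (xa t) (x₂ t) (y t)) *
        (∏ t, V.bob (xb t) (φ₂ (layers D (N + 1) j) (cipher s₂ j) t) (y' t)) * Φ y y')]
  simp only [sum_mul]
  exact sum_congr rfl fun xb _ => sum_congr rfl fun x₂ _ => sum_congr rfl fun y _ =>
    sum_congr rfl fun y' _ => by ring

omit [Fintype 𝒴] in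
/-- The average of a function of the wiretap parts and the encrypted bits of both users. -/
theorem avg_slot_pair {k : ℕ}
    (j : Fin (k + 1))
    (g : (Fin a₁ → Bool) → (Fin a₂ → Bool) → ℝ)
    (g' : (Fin (a₁ * layers D (N + 1) j) → Bool) → (Fin (a₂ * layers D (N + 1) j) → Bool) → ℝ) :
    ∑ s₁ : (schemeUser D N.succ_pos enc₁ henc₁ φ₁).Bits k,
      ∑ s₂ : (schemeUser D N.succ_pos enc₂ henc₂ φ₂).Bits k,
      (schemeCode henc₁ henc₂ φ₁ φ₂ dec dec' D N).bitLaw k *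
        (g (part₁ s₁ j) (part₁ s₂ j) + g' (cipher s₁ j) (cipher s₂ j)) =
    (∑ w₁, ∑ w₂, g w₁ w₂) / (2 ^ a₁ * 2 ^ a₂) +
      (∑ c₁, ∑ c₂, g' c₁ c₂) / (2 ^ (a₁ * layers D (N + 1) j) * 2 ^ (a₂ * layers D (N + 1) j)) := by
  simp only [BufferCode.bitLaw, mul_assoc]
  have h₂ : ∀ s₁ : (schemeUser D N.succ_pos enc₁ henc₁ φ₁).Bits k,
      ∑ s₂ : (schemeUser D N.succ_pos enc₂ henc₂ φ₂).Bits k,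
        (1 / 2 : ℝ) ^ (schemeUser D N.succ_pos enc₂ henc₂ φ₂).sent (k + 1) *
        (g (part₁ s₁ j) (part₁ s₂ j) + g' (cipher s₁ j) (cipher s₂ j)) =
      (∑ w, ∑ c, (g (part₁ s₁ j) w + g' (cipher s₁ j) c)) /
        (2 ^ a₂ * 2 ^ (a₂ * layers D (N + 1) j)) := fun s₁ =>
    avg_slot (hΔ := N.succ_pos) (henc := henc₂) (φ := φ₂) (D := D) j
      (fun w c => g (part₁ s₁ j) w + g' (cipher s₁ j) c)
  refine (sum_congr rfl fun s₁ _ => (mul_sum _ _ _).symm.trans (congrArg _ (h₂ s₁))).trans ?_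
  rw [avg_slot (hΔ := N.succ_pos) (henc := henc₁) (φ := φ₁) (D := D) j
    (fun w₁ c₁ => (∑ w, ∑ c, (g w₁ w + g' c₁ c)) / (2 ^ a₂ * 2 ^ (a₂ * layers D (N + 1) j)))]
  simp only [← sum_div, sum_add_distrib, sum_const, card_univ, nsmul_eq_mul, Fintype.card_fun,
    Fintype.card_bool, Fintype.card_fin, ← mul_sum, Nat.cast_pow, Nat.cast_ofNat]
  field_simp

/-- Bob errs in slot `k` only if one of the component codes errs in one of the slots up to `k`. -/
theorem errorProb_schemeCode_le {e e' : ℝ}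
    (he : (∑ w₁, ∑ w₂, ∑ x₁, ∑ x₂, ∑ y : Fin n₁ → 𝒴, enc₁ w₁ x₁ * enc₂ w₂ x₂ *
      (∏ t, V.bob (x₁ t) (x₂ t) (y t)) * ind (dec y ≠ (w₁, w₂))) / (2 ^ a₁ * 2 ^ a₂) ≤ e)
    (he' : ∀ d ≤ D, (∑ c₁, ∑ c₂, ∑ y : Fin n₂ → 𝒴, (∏ t, V.bob (φ₁ d c₁ t) (φ₂ d c₂ t) (y t)) *
      ind (dec' d y ≠ (c₁, c₂))) / (2 ^ (a₁ * d) * 2 ^ (a₂ * d)) ≤ e') (k : ℕ) :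
    (schemeCode henc₁ henc₂ φ₁ φ₂ dec dec' D N).errorProb V k ≤ (k + 1) * (e + e') := by
  classical
  set g : (Fin a₁ → Bool) → (Fin a₂ → Bool) → ℝ := fun w₁ w₂ =>
    ∑ x₁, ∑ x₂, ∑ y : Fin n₁ → 𝒴, enc₁ w₁ x₁ * enc₂ w₂ x₂ *
      (∏ t, V.bob (x₁ t) (x₂ t) (y t)) * ind (dec y ≠ (w₁, w₂)) with hg
  set g' : ∀ d, (Fin (a₁ * d) → Bool) → (Fin (a₂ * d) → Bool) → ℝ := fun d c₁ c₂ =>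
    ∑ y : Fin n₂ → 𝒴, (∏ t, V.bob (φ₁ d c₁ t) (φ₂ d c₂ t) (y t)) *
      ind (dec' d y ≠ (c₁, c₂)) with hg'
  rw [BufferCode.errorProb_eq]
  have hB : ∀ (ι : Type) [Fintype ι] [DecidableEq ι] (x₁ : ι → 𝒳₁) (x₂ : ι → 𝒳₂),
      ∑ y : ι → 𝒴, ∏ t, V.bob (x₁ t) (x₂ t) (y t) = 1 := fun ι _ _ x₁ x₂ =>
    sum_pi_prod_eq_one fun t => (V.bob_mem (x₁ t) (x₂ t)).2
  have hslot : ∀ (s₁ : (schemeUser D N.succ_pos enc₁ henc₁ φ₁).Bits k) (s₂ : (schemeUser D N.succ_pos enc₂ henc₂ φ₂).Bits k) (j : Fin (k + 1)),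
      ∑ q, (schemeCode henc₁ henc₂ φ₁ φ₂ dec dec' D N).slot V s₁ s₂ j q *
        (ind (dec (fun t => q.2.2.1 (Sum.inl t)) ≠ (part₁ s₁ j, part₁ s₂ j)) +
        ind (dec' (layers D (N + 1) j) (fun t => q.2.2.1 (Sum.inr t)) ≠
          (cipher s₁ j, cipher s₂ j))) =
      g (part₁ s₁ j) (part₁ s₂ j) + g' (layers D (N + 1) j) (cipher s₁ j) (cipher s₂ j) := by
    intro s₁ s₂ j
    refine (sum_slotLaw_parts s₁ s₂ j (fun y y' => ind (dec y ≠ (part₁ s₁ j, part₁ s₂ j)) +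
        ind (dec' (layers D (N + 1) j) y' ≠ (cipher s₁ j, cipher s₂ j)))).trans ?_
    simp only [mul_add, sum_add_distrib]
    congr 1
    · simp only [hg]
      refine sum_congr rfl fun x₁ _ => sum_congr rfl fun x₂ _ => sum_congr rfl fun y _ => ?_
      rw [← sum_mul, ← mul_sum, hB, mul_one]
    · have : ∀ (x₁ : Fin n₁ → 𝒳₁) (x₂ : Fin n₁ → 𝒳₂), ∑ y : Fin n₁ → 𝒴, ∑ y' : Fin n₂ → 𝒴,
          enc₁ (part₁ s₁ j) x₁ * enc₂ (part₁ s₂ j) x₂ *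
          (∏ t, V.bob (x₁ t) (x₂ t) (y t)) * (∏ t, V.bob (φ₁ (layers D (N + 1) j) (cipher s₁ j) t)
            (φ₂ (layers D (N + 1) j) (cipher s₂ j) t) (y' t)) *
            ind (dec' (layers D (N + 1) j) y' ≠ (cipher s₁ j, cipher s₂ j)) =
          enc₁ (part₁ s₁ j) x₁ * (enc₂ (part₁ s₂ j) x₂ *
            g' (layers D (N + 1) j) (cipher s₁ j) (cipher s₂ j)) := by
        intro x₁ x₂
        simp only [mul_assoc, ← mul_sum, ← sum_mul, hB, one_mul, hg']
      simp only [this, ← mul_sum, ← sum_mul, (henc₂ _).2, (henc₁ _).2, one_mul]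
  have hle : ∀ (s₁ : (schemeUser D N.succ_pos enc₁ henc₁ φ₁).Bits k) (s₂ : (schemeUser D N.succ_pos enc₂ henc₂ φ₂).Bits k),
      ∑ f : Fin (k + 1) → SlotData (Fin n₁ ⊕ Fin n₂) 𝒳₁ 𝒳₂ 𝒴 𝒵, (∏ j, (schemeCode henc₁ henc₂ φ₁ φ₂ dec dec' D N).slot V s₁ s₂ j (f j)) *
      ind ((schemeCode henc₁ henc₂ φ₁ φ₂ dec dec' D N).decode k (fun j => (f j).2.2.1) ≠ (message s₁ (Fin.last k), message s₂ (Fin.last k))) ≤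
      ∑ j : Fin (k + 1), (g (part₁ s₁ j) (part₁ s₂ j) +
        g' (layers D (N + 1) j) (cipher s₁ j) (cipher s₂ j)) := by
    intro s₁ s₂
    have h1 : ∀ f : Fin (k + 1) → SlotData (Fin n₁ ⊕ Fin n₂) 𝒳₁ 𝒳₂ 𝒴 𝒵,
        ind ((schemeCode henc₁ henc₂ φ₁ φ₂ dec dec' D N).decode k (fun j => (f j).2.2.1) ≠
          (message s₁ (Fin.last k), message s₂ (Fin.last k))) ≤
        ∑ j : Fin (k + 1), (ind (dec (fun t => (f j).2.2.1 (Sum.inl t)) ≠ (part₁ s₁ j, part₁ s₂ j)) +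
        ind (dec' (layers D (N + 1) j) (fun t => (f j).2.2.1 (Sum.inr t)) ≠
          (cipher s₁ j, cipher s₂ j))) := by
      intro f
      by_cases hc : Consistent henc₁ henc₂ φ₁ φ₂ dec dec' D N (fun j => (f j).2.2.1) s₁ s₂
      · rw [ind_neg (not_not.2 (schemeCode_decode hc))]
        exact sum_nonneg fun j _ => add_nonneg (ind_nonneg _) (ind_nonneg _)
      · rw [Consistent] at hc
        push Not at hc
        obtain ⟨j, hj⟩ := hc
        refine (ind_le_one _).trans (le_trans ?_ (single_le_sum (fun j _ => add_nonneg (ind_nonneg _)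
          (ind_nonneg _)) (mem_univ j)))
        by_cases hd : dec (fun t => (f j).2.2.1 (Sum.inl t)) = (part₁ s₁ j, part₁ s₂ j)
        · rw [ind_pos (s := dec' _ _ ≠ _) (hj hd)]
          exact le_add_of_nonneg_left (ind_nonneg _)
        · rw [ind_pos (s := dec _ ≠ _) hd]
          exact le_add_of_nonneg_right (ind_nonneg _)
    calc _ ≤ ∑ f : Fin (k + 1) → SlotData (Fin n₁ ⊕ Fin n₂) 𝒳₁ 𝒳₂ 𝒴 𝒵, (∏ j, (schemeCode henc₁ henc₂ φ₁ φ₂ dec dec' D N).slot V s₁ s₂ j (f j)) *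
        ∑ j : Fin (k + 1), (ind (dec (fun t => (f j).2.2.1 (Sum.inl t)) ≠ (part₁ s₁ j, part₁ s₂ j)) +
        ind (dec' (layers D (N + 1) j) (fun t => (f j).2.2.1 (Sum.inr t)) ≠
          (cipher s₁ j, cipher s₂ j))) := sum_le_sum fun f _ =>
          mul_le_mul_of_nonneg_left (h1 f) (prod_nonneg fun j _ => ((schemeCode henc₁ henc₂ φ₁ φ₂ dec dec' D N).slot_mem s₁ s₂ j).1 _)
      _ = _ := by
          simp only [mul_sum]
          rw [sum_comm]
          refine sum_congr rfl fun j _ => ?_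
          rw [sum_pi_eval (κ := (schemeCode henc₁ henc₂ φ₁ φ₂ dec dec' D N).slot V s₁ s₂) (fun j => ((schemeCode henc₁ henc₂ φ₁ φ₂ dec dec' D N).slot_mem s₁ s₂ j).2) j
            (fun q => ind (dec (fun t => q.2.2.1 (Sum.inl t)) ≠ (part₁ s₁ j, part₁ s₂ j)) +
              ind (dec' (layers D (N + 1) j) (fun t => q.2.2.1 (Sum.inr t)) ≠
              (cipher s₁ j, cipher s₂ j))), hslot]
  calc _ ≤ ∑ s₁ : (schemeUser D N.succ_pos enc₁ henc₁ φ₁).Bits k, ∑ s₂ : (schemeUser D N.succ_pos enc₂ henc₂ φ₂).Bits k, (schemeCode henc₁ henc₂ φ₁ φ₂ dec dec' D N).bitLaw k * ∑ j : Fin (k + 1),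
        (g (part₁ s₁ j) (part₁ s₂ j) + g' (layers D (N + 1) j) (cipher s₁ j) (cipher s₂ j)) :=
        sum_le_sum fun s₁ _ => sum_le_sum fun s₂ _ =>
          mul_le_mul_of_nonneg_left (hle s₁ s₂) (schemeCode henc₁ henc₂ φ₁ φ₂ dec dec' D N).bitLaw_nonneg
    _ = ∑ j : Fin (k + 1), ∑ s₁ : (schemeUser D N.succ_pos enc₁ henc₁ φ₁).Bits k, ∑ s₂ : (schemeUser D N.succ_pos enc₂ henc₂ φ₂).Bits k, (schemeCode henc₁ henc₂ φ₁ φ₂ dec dec' D N).bitLaw k *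
        (g (part₁ s₁ j) (part₁ s₂ j) + g' (layers D (N + 1) j) (cipher s₁ j) (cipher s₂ j)) := by
        simp only [mul_sum]
        rw [sum_comm (s := (univ : Finset (Fin (k + 1))))]
        refine sum_congr rfl fun _ _ => ?_
        rw [sum_comm]
    _ ≤ ∑ j : Fin (k + 1), (e + e') := sum_le_sum fun j _ => by
        rw [avg_slot_pair (D := D) (N := N) (dec := dec) (dec' := dec') j g (g' _)]
        exact add_le_add he (he' _ (min_le_right _ _))
    _ = _ := by simp; ring

end SchemeCode

/-! ### Achievability -/

section Achievability

variable {𝒳₁ 𝒳₂ 𝒴 𝒵 : Type*} [Fintype 𝒳₁] [Fintype 𝒳₂] [Fintype 𝒴] [Fintype 𝒵]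

theorem nonempty_of_mem_stdSimplex {α : Type*} [Fintype α] {p : α → ℝ} (hp : p ∈ stdSimplex ℝ α) :
    Nonempty α := by
  by_contra h
  rw [not_nonempty_iff] at h
  have := hp.2
  simp at this

/-- The transmitter that sends no message. -/
def silentUser {𝒳 : Type*} [Fintype 𝒳] [Nonempty 𝒳] (n₁ n₂ : ℕ) : UserCode 𝒳 n₁ n₂ := by
  classical
  exact
  { a := 0
    b := fun _ => 0
    c := fun _ => 0
    key_stored := fun k => by simp
    wiretapEnc := fun _ => Pi.single (fun _ => Classical.arbitrary 𝒳) 1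
    wiretapEnc_mem := fun _ => single_mem_stdSimplex ℝ _
    keyEnc := fun _ _ _ _ => Classical.arbitrary 𝒳 }

theorem card_bits_le_exp {m : ℕ} {c : ℝ} (h : m * Real.log 2 ≤ c) :
    (Fintype.card (Fin m → Bool) : ℝ) ≤ Real.exp c := by
  rw [Fintype.card_fun, Fintype.card_bool, Fintype.card_fin, Nat.cast_pow, Nat.cast_ofNat,
    ← Real.exp_log (show (0 : ℝ) < 2 by norm_num), ← Real.exp_nat_mul]
  exact Real.exp_le_exp.2 h

theorem card_bits (m : ℕ) : (Fintype.card (Fin m → Bool) : ℝ) = 2 ^ m := by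
  simp

/-- The layered key scheme with good component codes. -/
theorem exists_scheme (V : Channel 𝒳₁ 𝒳₂ 𝒴 𝒵)
    (h₁ : ∃ p₁ ∈ stdSimplex ℝ 𝒳₁, ∃ p₂ ∈ stdSimplex ℝ 𝒳₂, macInfo V.eve p₁ p₂ < macInfo V.bob p₁ p₂)
    (h₂ : ∃ p₂ ∈ stdSimplex ℝ 𝒳₂, ∃ p₁ ∈ stdSimplex ℝ 𝒳₁,
      macInfo (fun b a => V.eve a b) p₂ p₁ < macInfo (fun b a => V.bob a b) p₂ p₁)
    {p₁ : 𝒳₁ → ℝ} {p₂ : 𝒳₂ → ℝ} (hp₁ : p₁ ∈ stdSimplex ℝ 𝒳₁) (hp₂ : p₂ ∈ stdSimplex ℝ 𝒳₂)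
    {r₁ r₂ : ℝ} (hr₁ : r₁ < macInfo V.bob p₁ p₂)
    (hr₂ : r₂ < macInfo (fun b a => V.bob a b) p₂ p₁) (hr : r₁ + r₂ < macSumInfo V.bob p₁ p₂) :
    ∃ (r κ : ℝ) (e e' : ℕ → ℝ), 0 < r ∧ 0 ≤ κ ∧ Tendsto e atTop (𝓝 0) ∧ Tendsto e' atTop (𝓝 0) ∧
      ∀ (N D n₁ n₂ a₁ a₂ : ℕ), 2 ≤ n₁ → 0 < n₂ → a₁ * Real.log 2 ≤ n₁ * r →
        a₂ * Real.log 2 ≤ n₁ * r → a₁ * D * Real.log 2 ≤ n₂ * r₁ → a₂ * D * Real.log 2 ≤ n₂ * r₂ →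
      ∃ C : BufferCode 𝒳₁ 𝒳₂ 𝒴 n₁ n₂,
        (∀ k, (N + 1) * D ≤ k → C.user₁.rate k = ((a₁ + a₁ * D : ℕ) : ℝ) / ((n₁ + n₂ : ℕ) : ℝ) ∧
          C.user₂.rate k = ((a₂ + a₂ * D : ℕ) : ℝ) / ((n₁ + n₂ : ℕ) : ℝ)) ∧
        (∀ k, C.errorProb V k ≤ (k + 1) * (e n₁ + e' n₂)) ∧
        ∀ k, C.leakage₁ V N k ≤ ((N + 1) * (D + 1) : ℕ) * (κ * √n₁) / Real.log 2 ∧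
          C.leakage₂ V N k ≤ ((N + 1) * (D + 1) : ℕ) * (κ * √n₁) / Real.log 2 ∧
          C.leakage V N k ≤ 2 * (((N + 1) * (D + 1) : ℕ) * (κ * √n₁) / Real.log 2) := by
  obtain ⟨r, κ, e, hr0, hκ, he, H⟩ := wiretap_mac_coding V.bob_mem V.eve_mem h₁ h₂
  obtain ⟨e', he', H'⟩ := mac_coding hp₁ hp₂ V.bob_mem hr₁ hr₂ hr
  have hne₁ := nonempty_of_mem_stdSimplex hp₁
  have hne₂ := nonempty_of_mem_stdSimplex hp₂
  have hl2 : 0 < Real.log 2 := Real.log_pos (by norm_num)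
  refine ⟨r, κ, e, e', hr0, hκ, he, he', ?_⟩
  intro N D n₁ n₂ a₁ a₂ hn₁ hn₂ ha₁ ha₂ hb₁ hb₂
  obtain ⟨enc₁, enc₂, dec, henc₁, henc₂, herr, hide₁, hide₂⟩ :=
    H n₁ (Fin a₁ → Bool) (Fin a₂ → Bool) hn₁ (card_bits_le_exp ha₁) (card_bits_le_exp ha₂)
  have hmac : ∀ d, ∃ (c₁ : (Fin (a₁ * d) → Bool) → Fin n₂ → 𝒳₁)
      (c₂ : (Fin (a₂ * d) → Bool) → Fin n₂ → 𝒳₂)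
      (dec' : (Fin n₂ → 𝒴) → (Fin (a₁ * d) → Bool) × (Fin (a₂ * d) → Bool)), d ≤ D →
      (∑ m₁, ∑ m₂, ∑ y : Fin n₂ → 𝒴, (∏ t, V.bob (c₁ m₁ t) (c₂ m₂ t) (y t)) *
        ind (dec' y ≠ (m₁, m₂))) / (2 ^ (a₁ * d) * 2 ^ (a₂ * d)) ≤ e' n₂ := by
    intro d
    by_cases hd : d ≤ D
    · have hle : ∀ (a : ℕ) (c : ℝ), a * D * Real.log 2 ≤ c → ((a * d : ℕ) : ℝ) * Real.log 2 ≤ c := by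
        intro a c h
        refine le_trans (mul_le_mul_of_nonneg_right ?_ hl2.le) h
        exact_mod_cast Nat.mul_le_mul_left a hd
      have := H' (Fin n₂) (Fin (a₁ * d) → Bool) (Fin (a₂ * d) → Bool)
      simp only [Fintype.card_fin n₂] at this
      obtain ⟨c₁, c₂, dec', h⟩ := this hn₂ (card_bits_le_exp (hle _ _ hb₁))
        (card_bits_le_exp (hle _ _ hb₂))
      rw [card_bits, card_bits] at h
      exact ⟨c₁, c₂, dec', fun _ => h⟩
    · exact ⟨fun _ _ => Classical.arbitrary _, fun _ _ => Classical.arbitrary _,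
        fun _ => (fun _ => false, fun _ => false), fun h => absurd h hd⟩
  choose φ₁ φ₂ dec' hdec' using hmac
  rw [card_bits, card_bits] at herr
  refine ⟨schemeCode henc₁ henc₂ φ₁ φ₂ dec dec' D N, fun k hk => ?_,
    errorProb_schemeCode_le V herr hdec', fun k => ?_⟩
  · have hlay : layers D (N + 1) k = D := by
      rw [layers, min_eq_right]
      rwa [Nat.le_div_iff_mul_le N.succ_pos, mul_comm]
    constructor <;> simp only [UserCode.rate, hlay]
  · refine ⟨(leakage₁_le _ V N).trans (mutualInfo_eveLaw_le V.eve_mem _ hide₁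
      fun o => (o.2, o.1.2 (Fin.last k))),
      (leakage₂_le _ V N).trans (mutualInfo_eveLaw_le (fun b a => V.eve_mem a b) _ hide₂
      fun o => (o.2, o.1.2 (Fin.last k))), (leakage_le _ V N).trans ?_⟩
    rw [two_mul]
    exact add_le_add (mutualInfo_eveLaw_le V.eve_mem _ hide₁
        fun o => (o.2, fun j : BufferCode.Recent N k => UserCode.message o.1.1 j.1))
      (mutualInfo_eveLaw_le (fun b a => V.eve_mem a b) _ hide₂ fun o => o.2)

/-- Points strictly inside a pentagon of the capacity region are achievable secrecy rates. -/
theorem isAchievable_of_lt (V : Channel 𝒳₁ 𝒳₂ 𝒴 𝒵)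
    (h₁ : ∃ p₁ ∈ stdSimplex ℝ 𝒳₁, ∃ p₂ ∈ stdSimplex ℝ 𝒳₂, macInfo V.eve p₁ p₂ < macInfo V.bob p₁ p₂)
    (h₂ : ∃ p₂ ∈ stdSimplex ℝ 𝒳₂, ∃ p₁ ∈ stdSimplex ℝ 𝒳₁,
      macInfo (fun b a => V.eve a b) p₂ p₁ < macInfo (fun b a => V.bob a b) p₂ p₁)
    {p₁ : 𝒳₁ → ℝ} {p₂ : 𝒳₂ → ℝ} (hp₁ : p₁ ∈ stdSimplex ℝ 𝒳₁) (hp₂ : p₂ ∈ stdSimplex ℝ 𝒳₂)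
    {R : ℝ × ℝ} (hR₁ : 0 ≤ R.1) (hR₂ : 0 ≤ R.2) (hr₁ : R.1 * Real.log 2 < macInfo V.bob p₁ p₂)
    (hr₂ : R.2 * Real.log 2 < macInfo (fun b a => V.bob a b) p₂ p₁)
    (hr : (R.1 + R.2) * Real.log 2 < macSumInfo V.bob p₁ p₂) (N : ℕ) : V.IsAchievable N R := by
  have hl2 : 0 < Real.log 2 := Real.log_pos (by norm_num)
  set L := Real.log 2 with hL
  have hne₁ := nonempty_of_mem_stdSimplex hp₁
  have hne₂ := nonempty_of_mem_stdSimplex hp₂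
  -- the target rates leave a margin `s` (in nats)
  obtain ⟨s, hs0, hs₁, hs₂, hs₃⟩ : ∃ s > 0, R.1 * L + s < macInfo V.bob p₁ p₂ ∧
      R.2 * L + s < macInfo (fun b a => V.bob a b) p₂ p₁ ∧
      (R.1 * L + s) + (R.2 * L + s) < macSumInfo V.bob p₁ p₂ := by
    obtain ⟨s₁, h1, h1'⟩ := exists_between (sub_pos.2 hr₁)
    obtain ⟨s₂, h2, h2'⟩ := exists_between (sub_pos.2 hr₂)
    obtain ⟨s₃, h3, h3'⟩ := exists_between (sub_pos.2 hr)
    refine ⟨min s₁ (min s₂ (s₃ / 2)), by positivity, ?_, ?_, ?_⟩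
    · linarith [min_le_left s₁ (min s₂ (s₃ / 2))]
    · linarith [(min_le_right s₁ (min s₂ (s₃ / 2))).trans (min_le_left _ _)]
    · linarith [(min_le_right s₁ (min s₂ (s₃ / 2))).trans (min_le_right _ _)]
  obtain ⟨r, κ, e, e', hr0, hκ, he, he', H⟩ := exists_scheme V h₁ h₂ hp₁ hp₂ hs₁ hs₂ hs₃
  -- `l` makes the first part of a slot negligible, `D` makes the wiretap rates small enough
  obtain ⟨l, hl⟩ := exists_nat_gt ((2 * (R.1 + R.2) * L + s) / s)
  have hlpos : 0 < l := by
    have : (0 : ℝ) < l := lt_of_le_of_lt (by positivity) hl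
    exact_mod_cast this
  rw [div_lt_iff₀ hs0] at hl
  obtain ⟨D, hD⟩ := exists_nat_gt (l * ((R.1 + R.2) * L + s) / r)
  have hD0 : (0 : ℝ) < D := lt_of_le_of_lt (by positivity) hD
  rw [div_lt_iff₀ hr0] at hD
  let a : ℝ → ℕ → ℕ := fun x n => ⌊l * n * (x * L + s) / (L * D)⌋₊
  have ha : ∀ x, 0 ≤ x → ∀ n : ℕ, a x n * D * L ≤ ((l * n : ℕ) : ℝ) * (x * L + s) := by
    intro x hx n
    have := Nat.floor_le (a := l * n * (x * L + s) / (L * D)) (by positivity)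
    rw [le_div_iff₀ (by positivity)] at this
    push_cast
    linarith
  have ha' : ∀ x, 0 ≤ x → x ≤ R.1 + R.2 → ∀ n : ℕ, a x n * L ≤ n * r := by
    intro x hx hx' n
    have h1 := ha x hx n
    push_cast at h1
    have h2 : (l : ℝ) * n * (x * L + s) ≤ n * (D * r) := by
      have : (l : ℝ) * (x * L + s) ≤ D * r := le_trans (by gcongr) hD.le
      calc (l : ℝ) * n * (x * L + s) = n * (l * (x * L + s)) := by ring
        _ ≤ _ := by gcongr
    refine le_of_mul_le_mul_left ?_ hD0
    linarith
  have hrate : ∀ x, 0 ≤ x → x ≤ R.1 + R.2 → ∀ n : ℕ, 2 * L * D ≤ s * n → 0 < n →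
      x ≤ ((a x n + a x n * D : ℕ) : ℝ) / ((n + l * n : ℕ) : ℝ) := by
    intro x hx hx' n hn hn0
    have hn0' : (0 : ℝ) < n := by exact_mod_cast hn0
    have h1 := Nat.lt_floor_add_one (l * n * (x * L + s) / (L * D))
    rw [div_lt_iff₀ (by positivity)] at h1
    change l * n * (x * L + s) < ((a x n : ℕ) + 1) * (L * D) at h1
    generalize a x n = A at h1 ⊢
    rw [le_div_iff₀ (by positivity)]
    push_cast
    refine le_of_mul_le_mul_right ?_ hl2
    have h2 : (0 : ℝ) ≤ A * L := by positivity
    have h3 : x * L * n ≤ (R.1 + R.2) * L * n := by gcongr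
    have h4 : (2 * (R.1 + R.2) * L + s) * n ≤ l * s * n := by gcongr
    have h5 : 0 ≤ (R.1 + R.2) * L * n := by positivity
    have h6 : 0 ≤ L * D := by positivity
    linarith
  have hex : ∀ n₁ : ℕ, ∃ C : BufferCode 𝒳₁ 𝒳₂ 𝒴 n₁ (l * n₁), 2 ≤ n₁ →
      (∀ k, (N + 1) * D ≤ k →
        C.user₁.rate k = ((a R.1 n₁ + a R.1 n₁ * D : ℕ) : ℝ) / ((n₁ + l * n₁ : ℕ) : ℝ) ∧
          C.user₂.rate k = ((a R.2 n₁ + a R.2 n₁ * D : ℕ) : ℝ) / ((n₁ + l * n₁ : ℕ) : ℝ)) ∧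
        (∀ k, C.errorProb V k ≤ (k + 1) * (e n₁ + e' (l * n₁))) ∧
        ∀ k, C.leakage₁ V N k ≤ ((N + 1) * (D + 1) : ℕ) * (κ * √n₁) / L ∧
          C.leakage₂ V N k ≤ ((N + 1) * (D + 1) : ℕ) * (κ * √n₁) / L ∧
          C.leakage V N k ≤ 2 * (((N + 1) * (D + 1) : ℕ) * (κ * √n₁) / L) := by
    intro n₁
    by_cases hn : 2 ≤ n₁
    · obtain ⟨C, hC⟩ := H N D n₁ (l * n₁) (a R.1 n₁) (a R.2 n₁) hn (by positivity)
        (ha' _ hR₁ (by linarith) _) (ha' _ hR₂ (by linarith) _) (ha _ hR₁ _) (ha _ hR₂ _)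
      exact ⟨C, fun _ => hC⟩
    · exact ⟨⟨silentUser _ _, silentUser _ _, fun _ _ => (fun _ => false, fun _ => false)⟩,
        fun h => absurd h hn⟩
  choose C hC using hex
  refine ⟨hR₁, hR₂, l, (N + 1) * D, C, ?_, fun k => ?_, fun ε hε => ?_⟩
  · have : ∀ᶠ n₁ : ℕ in atTop, 2 * L * D ≤ s * n₁ :=
      (tendsto_natCast_atTop_atTop.const_mul_atTop hs0).eventually_ge_atTop _
    filter_upwards [this, eventually_ge_atTop 2] with n₁ h hn k hk
    rw [((hC n₁ hn).1 k hk).1, ((hC n₁ hn).1 k hk).2]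
    exact ⟨hrate _ hR₁ (by linarith) _ h (by omega), hrate _ hR₂ (by linarith) _ h (by omega)⟩
  · have hlim : Tendsto (fun n₁ : ℕ => ((k : ℝ) + 1) * (e n₁ + e' (l * n₁))) atTop (𝓝 0) := by
      have := (he.add (he'.comp (tendsto_id.const_mul_atTop' hlpos))).const_mul ((k : ℝ) + 1)
      simpa using this
    refine squeeze_zero' (Eventually.of_forall fun n₁ => ?_) ?_ hlim
    · rw [BufferCode.errorProb]
      exact sum_nonneg fun ω _ => (C n₁).law_nonneg ω
    · filter_upwards [eventually_ge_atTop 2] with n₁ hn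
      exact (hC n₁ hn).2.1 k
  · have hsq : Tendsto (fun n : ℕ => √(n : ℝ)) atTop atTop :=
      Real.tendsto_sqrt_atTop.comp tendsto_natCast_atTop_atTop
    filter_upwards [(hsq.const_mul_atTop hε).eventually_ge_atTop
      (((N + 1) * (D + 1) : ℕ) * κ / L), eventually_ge_atTop 2] with n₁ h hn k
    have hB : ((N + 1) * (D + 1) : ℕ) * (κ * √n₁) / L ≤ n₁ * ε := by
      calc ((N + 1) * (D + 1) : ℕ) * (κ * √n₁) / L = ((N + 1) * (D + 1) : ℕ) * κ / L * √n₁ := by ring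
        _ ≤ ε * √n₁ * √n₁ := mul_le_mul_of_nonneg_right h (Real.sqrt_nonneg _)
        _ = n₁ * ε := by rw [mul_assoc, Real.mul_self_sqrt (Nat.cast_nonneg _), mul_comm]
    obtain ⟨c1, c2, c3⟩ := (hC n₁ hn).2.2 k
    exact ⟨c1.trans hB, c2.trans hB, c3.trans (by linarith)⟩

end Achievability

/-! ### The converse for a single block -/

section Converse

/-- An event that is likely under `P` and has `Q`-probability at most `1 / M` forces the relative
entropy of `P` with respect to `Q` to be almost `log M`. -/
theorem prob_mul_log_le {Ω : Type*} [Fintype Ω] {P Q : Ω → ℝ} (hP : ∀ ω, 0 ≤ P ω)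
    (hQ : ∀ ω, 0 ≤ Q ω) (hPQ : ∀ ω, P ω ≠ 0 → Q ω ≠ 0) (hP₁ : ∑ ω, P ω = 1) (hQ₁ : ∑ ω, Q ω = 1)
    (A : Ω → Prop) {M : ℝ} (hM : 0 < M) (hA : ∑ ω, Q ω * ind (A ω) ≤ 1 / M) :
    (∑ ω, P ω * ind (A ω)) * Real.log M - Real.log 2 ≤
      ∑ ω, P ω * Real.log (P ω / Q ω) := by
  classical
  -- the reference measure is tilted towards the event
  set q : Ω → ℝ := fun ω => if A ω then M / 2 else 1 / 2 with hq
  have hq0 : ∀ ω, 0 < q ω := fun ω => by simp only [hq]; split_ifs <;> positivity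
  have hsum : ∑ ω, Q ω * q ω ≤ ∑ ω, P ω := by
    have h1 : ∀ ω, Q ω * q ω ≤ M / 2 * (Q ω * ind (A ω)) + 1 / 2 * Q ω := by
      intro ω
      have := hQ ω
      simp only [hq]
      split_ifs with h
      · rw [ind_pos h]; linarith
      · rw [ind_neg h]; linarith
    calc _ ≤ ∑ ω, (M / 2 * (Q ω * ind (A ω)) + 1 / 2 * Q ω) := sum_le_sum fun ω _ => h1 ω
      _ = M / 2 * (∑ ω, Q ω * ind (A ω)) + 1 / 2 := by
          rw [sum_add_distrib, ← mul_sum, ← mul_sum, hQ₁, mul_one]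
      _ ≤ M / 2 * (1 / M) + 1 / 2 := by gcongr
      _ = ∑ ω, P ω := by rw [hP₁]; field_simp; norm_num
  have hg := gibbs hP (fun ω => mul_nonneg (hQ ω) (hq0 ω).le)
    (fun ω h => mul_ne_zero (hPQ ω h) (hq0 ω).ne') hsum
  have hterm : ∀ ω, P ω * Real.log (P ω / (Q ω * q ω)) = P ω * Real.log (P ω / Q ω) -
      P ω * ind (A ω) * Real.log M + P ω * Real.log 2 := by
    intro ω
    rcases eq_or_ne (P ω) 0 with h0 | h0
    · simp [h0]
    rw [← div_div, Real.log_div (div_ne_zero h0 (hPQ ω h0)) (hq0 ω).ne']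
    simp only [hq]
    split_ifs with h
    · rw [ind_pos h, Real.log_div hM.ne' (by norm_num)]; ring
    · rw [ind_neg h, Real.log_div one_ne_zero (by norm_num), Real.log_one]; ring
  simp only [hterm, sum_add_distrib, sum_sub_distrib, ← sum_mul, hP₁] at hg
  linarith

variable {S₁ S₂ α β γ ι : Type*} [Fintype S₁] [Fintype S₂] [Fintype α] [Fintype β] [Fintype γ]
  [Fintype ι] [DecidableEq ι] {P₁ : S₁ → ℝ} {P₂ : S₂ → ℝ} {X₁ : S₁ → ι → α} {X₂ : S₂ → ι → β}
  {U : α → β → γ → ℝ}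

/-- The law of two independent transmitters and of the output of a channel that may depend on the
time. -/
def blockLaw (P₁ : S₁ → ℝ) (P₂ : S₂ → ℝ) (X₁ : S₁ → ι → α) (X₂ : S₂ → ι → β)
    (K : ι → α → β → γ → ℝ) : S₁ × S₂ × (ι → γ) → ℝ :=
  fun ω => P₁ ω.1 * P₂ ω.2.1 * ∏ t, K t (X₁ ω.1 t) (X₂ ω.2.1 t) (ω.2.2 t)

omit [Fintype α] [Fintype β] in
theorem blockLaw_mem {K : ι → α → β → γ → ℝ} (h₁ : P₁ ∈ stdSimplex ℝ S₁)
    (h₂ : P₂ ∈ stdSimplex ℝ S₂) (hK : ∀ t a b, K t a b ∈ stdSimplex ℝ γ) :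
    blockLaw P₁ P₂ X₁ X₂ K ∈ stdSimplex ℝ (S₁ × S₂ × (ι → γ)) := by
  refine ⟨fun ω => mul_nonneg (mul_nonneg (h₁.1 _) (h₂.1 _))
    (prod_nonneg fun t _ => (hK _ _ _).1 _), ?_⟩
  simp only [blockLaw, Fintype.sum_prod_type, ← mul_sum]
  have : ∀ s₁ s₂, ∑ y : ι → γ, ∏ t, K t (X₁ s₁ t) (X₂ s₂ t) (y t) = 1 := fun s₁ s₂ =>
    sum_pi_prod_eq_one fun t => (hK _ _ _).2
  simp only [this, mul_one, ← mul_sum, h₂.2, h₁.2]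

theorem probOf_mem {Ω : Type*} [Fintype Ω] {P : Ω → ℝ} (hP : P ∈ stdSimplex ℝ Ω) (A : Ω → α) :
    probOf P A ∈ stdSimplex ℝ α :=
  ⟨probOf_nonneg hP.1 A, by rw [sum_probOf, hP.2]⟩

/-- The converse with a memoryless reference channel `K`. -/
theorem block_converse (h₁ : P₁ ∈ stdSimplex ℝ S₁) (h₂ : P₂ ∈ stdSimplex ℝ S₂)
    (hU : ∀ a b, U a b ∈ stdSimplex ℝ γ) {K : ι → α → β → γ → ℝ}
    (hK : ∀ t a b, K t a b ∈ stdSimplex ℝ γ)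
    (hUK : ∀ t a b c, probOf P₁ (fun s => X₁ s t) a * probOf P₂ (fun s => X₂ s t) b * U a b c ≠ 0 →
      K t a b c ≠ 0) (A : S₁ × S₂ × (ι → γ) → Prop) {M : ℝ} (hM : 0 < M)
    (hA : ∑ ω, blockLaw P₁ P₂ X₁ X₂ K ω * ind (A ω) ≤ 1 / M) :
    (∑ ω, blockLaw P₁ P₂ X₁ X₂ (fun _ => U) ω * ind (A ω)) * Real.log M - Real.log 2 ≤
      ∑ t, ∑ b, probOf P₂ (fun s => X₂ s t) b * ∑ a, ∑ c, probOf P₁ (fun s => X₁ s t) a * U a b c *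
        Real.log (U a b c / K t a b c) := by
  have hP := blockLaw_mem (X₁ := X₁) (X₂ := X₂) h₁ h₂ (K := fun _ : ι => U) fun _ => hU
  have hQ := blockLaw_mem (X₁ := X₁) (X₂ := X₂) h₁ h₂ hK
  have hac : ∀ ω, blockLaw P₁ P₂ X₁ X₂ (fun _ => U) ω ≠ 0 → P₁ ω.1 * P₂ ω.2.1 ≠ 0 ∧
      ∀ t, U (X₁ ω.1 t) (X₂ ω.2.1 t) (ω.2.2 t) ≠ 0 ∧ K t (X₁ ω.1 t) (X₂ ω.2.1 t) (ω.2.2 t) ≠ 0 := by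
    intro ω h
    have h0 := left_ne_zero_of_mul h
    have hU' := fun t => prod_ne_zero_iff.1 (right_ne_zero_of_mul h) t (mem_univ t)
    refine ⟨h0, fun t => ⟨hU' t, hUK _ _ _ _ (mul_ne_zero (mul_ne_zero ?_ ?_) (hU' t))⟩⟩
    · exact ((lt_of_le_of_ne (h₁.1 _) (left_ne_zero_of_mul h0).symm).trans_le
        (le_probOf h₁.1 (fun s => X₁ s t) ω.1)).ne'
    · exact ((lt_of_le_of_ne (h₂.1 _) (right_ne_zero_of_mul h0).symm).trans_le
        (le_probOf h₂.1 (fun s => X₂ s t) ω.2.1)).ne'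
  refine (prob_mul_log_le hP.1 hQ.1 (fun ω h => ?_) hP.2 hQ.2 A hM hA).trans (le_of_eq ?_)
  · obtain ⟨h0, h⟩ := hac ω h
    exact mul_ne_zero h0 (prod_ne_zero_iff.2 fun t _ => (h t).2)
  · have hlog : ∀ ω, blockLaw P₁ P₂ X₁ X₂ (fun _ => U) ω * Real.log
        (blockLaw P₁ P₂ X₁ X₂ (fun _ => U) ω / blockLaw P₁ P₂ X₁ X₂ K ω) =
        ∑ t, blockLaw P₁ P₂ X₁ X₂ (fun _ => U) ω * Real.log
          (U (X₁ ω.1 t) (X₂ ω.2.1 t) (ω.2.2 t) / K t (X₁ ω.1 t) (X₂ ω.2.1 t) (ω.2.2 t)) := by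
      intro ω
      rcases eq_or_ne (blockLaw P₁ P₂ X₁ X₂ (fun _ => U) ω) 0 with h0 | h0
      · simp [h0]
      obtain ⟨h1, h⟩ := hac ω h0
      rw [← mul_sum]
      congr 1
      rw [← Real.log_prod fun t _ => div_ne_zero (h t).1 (h t).2]
      congr 1
      simp only [blockLaw]
      rw [mul_div_mul_left _ _ h1, prod_div_distrib]
    simp only [hlog]
    rw [sum_comm]
    refine sum_congr rfl fun t _ => ?_
    simp only [Fintype.sum_prod_type, blockLaw]
    have hy : ∀ s₁ s₂, ∑ y : ι → γ, P₁ s₁ * P₂ s₂ * (∏ t, U (X₁ s₁ t) (X₂ s₂ t) (y t)) *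
        Real.log (U (X₁ s₁ t) (X₂ s₂ t) (y t) / K t (X₁ s₁ t) (X₂ s₂ t) (y t)) =
        P₂ s₂ * (P₁ s₁ * ∑ c, U (X₁ s₁ t) (X₂ s₂ t) c *
          Real.log (U (X₁ s₁ t) (X₂ s₂ t) c / K t (X₁ s₁ t) (X₂ s₂ t) c)) := by
      intro s₁ s₂
      simp only [mul_assoc, ← mul_sum]
      rw [sum_pi_eval (κ := fun t c => U (X₁ s₁ t) (X₂ s₂ t) c) (fun t => (hU _ _).2) t
        (fun c => Real.log (U (X₁ s₁ t) (X₂ s₂ t) c / K t (X₁ s₁ t) (X₂ s₂ t) c))]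
      ring
    simp only [hy]
    rw [sum_comm]
    simp only [← mul_sum, mul_assoc]
    rw [sum_probOf_mul P₂ (fun s => X₂ s t) (fun b => ∑ a, probOf P₁ (fun s => X₁ s t) a *
      ∑ c, U a b c * Real.log (U a b c / K t a b c))]
    refine sum_congr rfl fun s₂ _ => ?_
    rw [sum_probOf_mul P₁ (fun s => X₁ s t) (fun a =>
      ∑ c, U a (X₂ s₂ t) c * Real.log (U a (X₂ s₂ t) c / K t a (X₂ s₂ t) c))]

variable {W₁ W₂ : Type*} {m₁ : S₁ → W₁} {m₂ : S₂ → W₂}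

/-- Fano-type bounds for a block code for the multiple access channel, with messages `m₁`, `m₂` and
decoder `dec`. -/
theorem mac_converse (h₁ : P₁ ∈ stdSimplex ℝ S₁) (h₂ : P₂ ∈ stdSimplex ℝ S₂)
    (hU : ∀ a b, U a b ∈ stdSimplex ℝ γ) {M₁ M₂ : ℝ} (hM₁ : 1 ≤ M₁) (hM₂ : 1 ≤ M₂)
    (hm₁ : ∀ w, ∑ s, P₁ s * ind (w = m₁ s) ≤ 1 / M₁)
    (hm₂ : ∀ w, ∑ s, P₂ s * ind (w = m₂ s) ≤ 1 / M₂) (dec : (ι → γ) → W₁ × W₂) {δ : ℝ}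
    (hδ : ∑ ω, blockLaw P₁ P₂ X₁ X₂ (fun _ => U) ω * ind (dec ω.2.2 ≠ (m₁ ω.1, m₂ ω.2.1)) ≤ δ) :
    (1 - δ) * Real.log M₁ - Real.log 2 ≤
        ∑ t, macInfo U (probOf P₁ fun s => X₁ s t) (probOf P₂ fun s => X₂ s t) ∧
      (1 - δ) * Real.log M₂ - Real.log 2 ≤
        ∑ t, macInfo (fun b a => U a b) (probOf P₂ fun s => X₂ s t) (probOf P₁ fun s => X₁ s t) ∧
      (1 - δ) * (Real.log M₁ + Real.log M₂) - Real.log 2 ≤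
        ∑ t, macSumInfo U (probOf P₁ fun s => X₁ s t) (probOf P₂ fun s => X₂ s t) := by
  have hp₁ : ∀ t, probOf P₁ (fun s => X₁ s t) ∈ stdSimplex ℝ α := fun t => probOf_mem h₁ _
  have hp₂ : ∀ t, probOf P₂ (fun s => X₂ s t) ∈ stdSimplex ℝ β := fun t => probOf_mem h₂ _
  have hP := blockLaw_mem (X₁ := X₁) (X₂ := X₂) h₁ h₂ (K := fun _ : ι => U) fun _ => hU
  have hM₁0 : 0 < M₁ := by linarith
  have hM₂0 : 0 < M₂ := by linarith
  have hl₁ := Real.log_nonneg hM₁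
  have hl₂ := Real.log_nonneg hM₂
  have hsucc : ∀ A : S₁ × S₂ × (ι → γ) → Prop, (∀ ω, dec ω.2.2 = (m₁ ω.1, m₂ ω.2.1) → A ω) →
      1 - δ ≤ ∑ ω, blockLaw P₁ P₂ X₁ X₂ (fun _ => U) ω * ind (A ω) := by
    intro A hA
    have : ∀ ω, blockLaw P₁ P₂ X₁ X₂ (fun _ => U) ω ≤
        blockLaw P₁ P₂ X₁ X₂ (fun _ => U) ω * ind (A ω) +
        blockLaw P₁ P₂ X₁ X₂ (fun _ => U) ω * ind (dec ω.2.2 ≠ (m₁ ω.1, m₂ ω.2.1)) := by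
      intro ω
      rw [← mul_add]
      refine le_mul_of_one_le_right (hP.1 ω) ?_
      by_cases h : dec ω.2.2 = (m₁ ω.1, m₂ ω.2.1)
      · rw [ind_pos (hA ω h)]
        exact le_add_of_nonneg_right (ind_nonneg _)
      · rw [ind_pos (s := dec ω.2.2 ≠ _) h]
        exact le_add_of_nonneg_left (ind_nonneg _)
    have h := sum_le_sum fun ω (_ : ω ∈ univ) => this ω
    rw [hP.2, sum_add_distrib] at h
    linarith
  refine ⟨?_, ?_, ?_⟩
  · refine (sub_le_sub_right (mul_le_mul_of_nonneg_right
      (hsucc (fun ω => (dec ω.2.2).1 = m₁ ω.1) fun ω h => by rw [h]) hl₁) _).trans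
      ((block_converse h₁ h₂ hU (K := fun t _ b => outLaw (probOf P₁ fun s => X₁ s t)
        fun a => U a b) (fun t _ b => outLaw_mem (hp₁ t) fun a => hU a b) ?_ _ hM₁0 ?_).trans
        (le_of_eq rfl))
    · intro t a b c h
      refine (outLaw_pos (hp₁ t).1 (fun a => (hU a b).1) (a := a) ?_).ne'
      exact mul_ne_zero (left_ne_zero_of_mul (left_ne_zero_of_mul h)) (right_ne_zero_of_mul h)
    · simp only [Fintype.sum_prod_type, blockLaw]
      rw [sum_comm]
      have : ∀ s₂, ∑ s₁, ∑ y : ι → γ, P₁ s₁ * P₂ s₂ *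
          (∏ t, outLaw (probOf P₁ fun s => X₁ s t) (fun a => U a (X₂ s₂ t)) (y t)) *
          ind ((dec y).1 = m₁ s₁) ≤ P₂ s₂ * (1 / M₁) := by
        intro s₂
        rw [sum_comm]
        calc _ = P₂ s₂ * ∑ y : ι → γ,
              (∏ t, outLaw (probOf P₁ fun s => X₁ s t) (fun a => U a (X₂ s₂ t)) (y t)) *
              ∑ s₁, P₁ s₁ * ind ((dec y).1 = m₁ s₁) := by
              simp only [mul_sum]
              exact sum_congr rfl fun y _ => sum_congr rfl fun s₁ _ => by ring
          _ ≤ P₂ s₂ * ∑ y : ι → γ,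
              (∏ t, outLaw (probOf P₁ fun s => X₁ s t) (fun a => U a (X₂ s₂ t)) (y t)) * (1 / M₁) := by
              refine mul_le_mul_of_nonneg_left (sum_le_sum fun y _ => mul_le_mul_of_nonneg_left
                (hm₁ _) (prod_nonneg fun t _ => (outLaw_mem (hp₁ t) fun a => hU a _).1 _)) (h₂.1 _)
          _ = _ := by
              rw [← sum_mul, sum_pi_prod_eq_one (κ := fun t => outLaw (probOf P₁ fun s => X₁ s t)
                (fun a => U a (X₂ s₂ t))) fun t => (outLaw_mem (hp₁ t) fun a => hU a _).2, one_mul]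
      refine (sum_le_sum fun s₂ _ => this s₂).trans (le_of_eq ?_)
      rw [← sum_mul, h₂.2, one_mul]
  · refine (sub_le_sub_right (mul_le_mul_of_nonneg_right
      (hsucc (fun ω => (dec ω.2.2).2 = m₂ ω.2.1) fun ω h => by rw [h]) hl₂) _).trans
      ((block_converse h₁ h₂ hU (K := fun t a _ => outLaw (probOf P₂ fun s => X₂ s t)
        fun b => U a b) (fun t a _ => outLaw_mem (hp₂ t) fun b => hU a b) ?_ _ hM₂0 ?_).trans
        (le_of_eq ?_))
    · intro t a b c h
      refine (outLaw_pos (hp₂ t).1 (fun b => (hU a b).1) (a := b) ?_).ne'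
      exact mul_ne_zero (right_ne_zero_of_mul (left_ne_zero_of_mul h)) (right_ne_zero_of_mul h)
    · simp only [Fintype.sum_prod_type, blockLaw]
      have : ∀ s₁, ∑ s₂, ∑ y : ι → γ, P₁ s₁ * P₂ s₂ *
          (∏ t, outLaw (probOf P₂ fun s => X₂ s t) (fun b => U (X₁ s₁ t) b) (y t)) *
          ind ((dec y).2 = m₂ s₂) ≤ P₁ s₁ * (1 / M₂) := by
        intro s₁
        rw [sum_comm]
        calc _ = P₁ s₁ * ∑ y : ι → γ,
              (∏ t, outLaw (probOf P₂ fun s => X₂ s t) (fun b => U (X₁ s₁ t) b) (y t)) *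
              ∑ s₂, P₂ s₂ * ind ((dec y).2 = m₂ s₂) := by
              simp only [mul_sum]
              exact sum_congr rfl fun y _ => sum_congr rfl fun s₁ _ => by ring
          _ ≤ P₁ s₁ * ∑ y : ι → γ,
              (∏ t, outLaw (probOf P₂ fun s => X₂ s t) (fun b => U (X₁ s₁ t) b) (y t)) * (1 / M₂) := by
              refine mul_le_mul_of_nonneg_left (sum_le_sum fun y _ => mul_le_mul_of_nonneg_left
                (hm₂ _) (prod_nonneg fun t _ => (outLaw_mem (hp₂ t) fun b => hU _ b).1 _)) (h₁.1 _)
          _ = _ := by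
              rw [← sum_mul, sum_pi_prod_eq_one (κ := fun t => outLaw (probOf P₂ fun s => X₂ s t)
                (fun b => U (X₁ s₁ t) b)) fun t => (outLaw_mem (hp₂ t) fun b => hU _ b).2, one_mul]
      refine (sum_le_sum fun s₁ _ => this s₁).trans (le_of_eq ?_)
      rw [← sum_mul, h₁.2, one_mul]
    · refine sum_congr rfl fun t _ => ?_
      simp only [macInfo, info, mul_sum]
      rw [sum_comm]
      exact sum_congr rfl fun a _ => sum_congr rfl fun b _ => sum_congr rfl fun c _ => by ring
  · rw [← Real.log_mul hM₁0.ne' hM₂0.ne']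
    refine (sub_le_sub_right (mul_le_mul_of_nonneg_right
      (hsucc (fun ω => dec ω.2.2 = (m₁ ω.1, m₂ ω.2.1)) fun ω h => h)
      (Real.log_nonneg (by nlinarith))) _).trans
      ((block_converse h₁ h₂ hU (K := fun t _ _ => outLaw (prodLaw (probOf P₁ fun s => X₁ s t)
        (probOf P₂ fun s => X₂ s t)) fun x => U x.1 x.2)
        (fun t _ _ => outLaw_mem (prodLaw_mem (hp₁ t) (hp₂ t)) fun x => hU _ _) ?_ _
        (mul_pos hM₁0 hM₂0) ?_).trans (le_of_eq (sum_congr rfl fun t _ => macSumInfo_eq.symm)))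
    · intro t a b c h
      exact (outLaw_pos (prodLaw_mem (hp₁ t) (hp₂ t)).1 (fun x => (hU x.1 x.2).1) (a := (a, b)) h).ne'
    · simp only [Fintype.sum_prod_type, blockLaw]
      set O : (ι → γ) → ℝ := fun y => ∏ t, outLaw (prodLaw (probOf P₁ fun s => X₁ s t)
        (probOf P₂ fun s => X₂ s t)) (fun x => U x.1 x.2) (y t) with hO
      have hOm : O ∈ stdSimplex ℝ (ι → γ) := prod_mem_stdSimplex
        (κ := fun t => outLaw (prodLaw (probOf P₁ fun s => X₁ s t)
        (probOf P₂ fun s => X₂ s t)) (fun x => U x.1 x.2))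
        fun t => outLaw_mem (prodLaw_mem (hp₁ t) (hp₂ t)) fun x => hU _ _
      calc _ = ∑ y, O y * ((∑ s₁, P₁ s₁ * ind ((dec y).1 = m₁ s₁)) *
            ∑ s₂, P₂ s₂ * ind ((dec y).2 = m₂ s₂)) := by
            simp only [sum_mul_sum]
            simp only [mul_sum]
            refine ((sum_congr rfl fun s₁ _ => sum_comm).trans sum_comm).trans ?_
            refine sum_congr rfl fun y _ => sum_congr rfl fun s₁ _ => sum_congr rfl fun s₂ _ => ?_
            rw [Prod.ext_iff, ind_and]
            ring
        _ ≤ ∑ y, O y * (1 / M₁ * (1 / M₂)) := sum_le_sum fun y _ =>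
            mul_le_mul_of_nonneg_left (mul_le_mul (hm₁ _) (hm₂ _)
              (sum_nonneg fun s _ => mul_nonneg (h₂.1 s) (ind_nonneg _)) (by positivity)) (hOm.1 y)
        _ = _ := by rw [← sum_mul, hOm.2, one_mul, one_div_mul_one_div]

end Converse

/-! ### The converse for codes with key buffers -/

namespace UserCode

variable {𝒳 : Type*} [Fintype 𝒳] {n₁ n₂ : ℕ} {u : UserCode 𝒳 n₁ n₂} {k : ℕ}

theorem sent_succ (k : ℕ) : u.sent (k + 1) = u.sent k + (u.a + u.b k) := sum_range_succ _ _

/-- The stream with the bits `v` before slot `k` and the message `w` in slot `k`. -/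
def extend (v : Fin (u.sent k) → Bool) (w : Fin (u.a + u.b k) → Bool) : u.Bits k :=
  fun p => Fin.append v w (Fin.cast (sent_succ k) p)

theorem sum_bits (Φ : u.Bits k → ℝ) :
    ∑ s, Φ s = ∑ v, ∑ w, Φ (extend v w) := by
  rw [← Fintype.sum_prod_type' (f := fun v w => Φ (extend v w))]
  exact (Fintype.sum_equiv ((Fin.appendEquiv (α := Bool) (u.sent k) (u.a + u.b k)).trans
    (Equiv.arrowCongr (finCongr (sent_succ k).symm) (Equiv.refl Bool))) _ _ fun x => rfl).symm

theorem message_extend_last (v : Fin (u.sent k) → Bool) (w : Fin (u.a + u.b k) → Bool) :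
    message (extend v w) (Fin.last k) = w := by
  funext i
  exact Fin.append_right v w i

theorem bitAt_extend (v : Fin (u.sent k) → Bool) (w w' : Fin (u.a + u.b k) → Bool) {p : ℕ}
    (hp : p < u.sent k) : bitAt (extend v w) p = bitAt (extend v w') p := by
  have h : p < u.sent (k + 1) := by rw [sent_succ]; omega
  rw [bitAt, bitAt, dif_pos h, dif_pos h]
  exact (Fin.append_left v w ⟨p, hp⟩).trans (Fin.append_left v w' ⟨p, hp⟩).symm

/-- The encoding of the earlier slots does not depend on the message of slot `k`. -/
theorem slotEnc_extend (v : Fin (u.sent k) → Bool) (w w' : Fin (u.a + u.b k) → Bool) (j : Fin k) :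
    slotEnc (extend v w) j.castSucc = slotEnc (extend v w') j.castSucc := by
  have hs := u.sent_succ_le j.2
  have hu := u.used_add_le j.2
  have h₁ : part₁ (extend v w) j.castSucc = part₁ (extend v w') j.castSucc := by
    funext i
    have hp : u.sent j + i < u.sent k := by omega
    rw [part₁_apply, part₁_apply]
    exact bitAt_extend v w w' hp
  have h₂ : part₂ (extend v w) j.castSucc = part₂ (extend v w') j.castSucc := by
    funext i
    have hi : (i : ℕ) < u.b j := i.2
    have hp : u.sent j + (u.a + i) < u.sent k := by omega
    rw [part₂_apply, part₂_apply]
    exact bitAt_extend v w w' hp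
  have h₃ : key (extend v w) j.castSucc = key (extend v w') j.castSucc := by
    funext i
    have hi : (i : ℕ) < u.c j := i.2
    have hp : u.used j + i < u.sent k := by omega
    rw [key_apply, key_apply]
    exact bitAt_extend v w w' hp
  funext x
  rw [slotEnc, slotEnc, h₁, h₂, h₃]

variable (u) in
/-- The law of the message and the codeword of slot `k`, given the earlier message bits. -/
def blockInput (v : Fin (u.sent k) → Bool) :
    (Fin (u.a + u.b k) → Bool) × (Fin n₁ ⊕ Fin n₂ → 𝒳) → ℝ :=
  fun s => (1 / 2) ^ (u.a + u.b k) * slotEnc (extend v s.1) (Fin.last k) s.2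

theorem half_pow_mul_card (m : ℕ) : (1 / 2 : ℝ) ^ m * Fintype.card (Fin m → Bool) = 1 := by
  rw [card_bits, ← mul_pow]; norm_num

theorem blockInput_mem (v : Fin (u.sent k) → Bool) : u.blockInput v ∈ stdSimplex ℝ _ := by
  refine ⟨fun s => mul_nonneg (by positivity) ((slotEnc_mem _ _).1 _), ?_⟩
  simp only [blockInput, Fintype.sum_prod_type, ← mul_sum, (slotEnc_mem _ _).2]
  simp only [sum_const, card_univ, nsmul_eq_mul, mul_one]
  exact half_pow_mul_card _

theorem sum_blockInput_message (v : Fin (u.sent k) → Bool) (w : Fin (u.a + u.b k) → Bool) :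
    ∑ s, u.blockInput v s * ind (w = s.1) ≤ 1 / 2 ^ (u.a + u.b k) := by
  simp only [blockInput, Fintype.sum_prod_type, ← sum_mul, ← mul_sum, (slotEnc_mem _ _).2, mul_one,
    eq_comm (a := w), sum_ind_eq]
  rw [one_div_pow]

end UserCode

section Past

variable {𝒳₁ 𝒳₂ 𝒴 𝒵 : Type*} [Fintype 𝒳₁] [Fintype 𝒳₂] [Fintype 𝒴] [Fintype 𝒵] {n₁ n₂ : ℕ}
  (C : BufferCode 𝒳₁ 𝒳₂ 𝒴 n₁ n₂) (V : Channel 𝒳₁ 𝒳₂ 𝒴 𝒵)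

open UserCode

theorem sum_snoc {A : Type*} [Fintype A] {k : ℕ} (Φ : (Fin (k + 1) → A) → ℝ) :
    ∑ f, Φ f = ∑ f' : Fin k → A, ∑ q, Φ (Fin.snoc f' q) := by
  rw [sum_comm, ← Fintype.sum_prod_type' (f := fun q f' => Φ (Fin.snoc f' q))]
  exact (Fintype.sum_equiv (Fin.snocEquiv fun _ => A) _ _ fun x => rfl).symm

/-- For some past of slot `k`, the conditional error probability in slot `k` does not exceed the
error probability. -/
theorem exists_past (k : ℕ) : ∃ (v₁ : Fin (C.user₁.sent k) → Bool) (v₂ : Fin (C.user₂.sent k) → Bool)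
    (dec : (Fin n₁ ⊕ Fin n₂ → 𝒴) →
      (Fin (C.user₁.a + C.user₁.b k) → Bool) × (Fin (C.user₂.a + C.user₂.b k) → Bool)),
    ∑ ω, blockLaw (C.user₁.blockInput v₁) (C.user₂.blockInput v₂) (fun s => s.2) (fun s => s.2)
      (fun _ => V.bob) ω * ind (dec ω.2.2 ≠ (ω.1.1, ω.2.1.1)) ≤ C.errorProb V k := by
  classical
  set weight : (Fin (C.user₁.sent k) → Bool) × (Fin (C.user₂.sent k) → Bool) × (Fin k →
    SlotData (Fin n₁ ⊕ Fin n₂) 𝒳₁ 𝒳₂ 𝒴 𝒵) → ℝ := fun θ => (1 / 2) ^ C.user₁.sent k * ((1 / 2) ^ C.user₂.sent k *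
    ∏ j : Fin k, C.slot V (extend θ.1 fun _ => false) (extend θ.2.1 fun _ => false) j.castSucc
      (θ.2.2 j)) with hweight
  set D : (Fin (C.user₁.sent k) → Bool) × (Fin (C.user₂.sent k) → Bool) × (Fin k →
    SlotData (Fin n₁ ⊕ Fin n₂) 𝒳₁ 𝒳₂ 𝒴 𝒵) → (Fin n₁ ⊕ Fin n₂ → 𝒴) →
      (Fin (C.user₁.a + C.user₁.b k) → Bool) × (Fin (C.user₂.a + C.user₂.b k) → Bool) :=
    fun θ y => C.decode k (Fin.snoc (fun j => (θ.2.2 j).2.2.1) y) with hD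
  set F : (Fin (C.user₁.sent k) → Bool) × (Fin (C.user₂.sent k) → Bool) × (Fin k →
    SlotData (Fin n₁ ⊕ Fin n₂) 𝒳₁ 𝒳₂ 𝒴 𝒵) → ℝ := fun θ => ∑ ω, blockLaw (C.user₁.blockInput θ.1) (C.user₂.blockInput θ.2.1)
    (fun s => s.2) (fun s => s.2) (fun _ => V.bob) ω * ind (D θ ω.2.2 ≠ (ω.1.1, ω.2.1.1)) with hF
  have hw0 : ∀ θ, 0 ≤ weight θ := fun θ => mul_nonneg (by positivity) (mul_nonneg (by positivity)
    (prod_nonneg fun j _ => (C.slot_mem _ _ _).1 _))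
  have hw1 : ∑ θ, weight θ = 1 := by
    have : ∀ (v₁ : Fin (C.user₁.sent k) → Bool) (v₂ : Fin (C.user₂.sent k) → Bool),
        ∑ f' : Fin k → SlotData (Fin n₁ ⊕ Fin n₂) 𝒳₁ 𝒳₂ 𝒴 𝒵, ∏ j : Fin k, C.slot V (extend v₁ fun _ => false)
          (extend v₂ fun _ => false) j.castSucc (f' j) = 1 := fun v₁ v₂ =>
      sum_pi_prod_eq_one (κ := fun j : Fin k => C.slot V (extend v₁ fun _ => false)
          (extend v₂ fun _ => false) j.castSucc) fun j => (C.slot_mem _ _ _).2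
    simp only [hweight, Fintype.sum_prod_type, ← mul_sum]
    simp only [this, sum_const, card_univ, nsmul_eq_mul, mul_one]
    rw [mul_left_comm (_ ^ C.user₂.sent k), half_pow_mul_card, mul_one, half_pow_mul_card]
  have hFeq : ∀ θ, F θ = ∑ w₁, ∑ w₂, (1 / 2) ^ (C.user₁.a + C.user₁.b k) *
      (1 / 2) ^ (C.user₂.a + C.user₂.b k) * ∑ q, C.slot V (extend θ.1 w₁) (extend θ.2.1 w₂)
        (Fin.last k) q * ind (D θ q.2.2.1 ≠ (w₁, w₂)) := by
    intro θ
    have h : ∀ w₁ w₂, ∑ q, C.slot V (extend θ.1 w₁) (extend θ.2.1 w₂)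
        (Fin.last k) q * ind (D θ q.2.2.1 ≠ (w₁, w₂)) = _ := fun w₁ w₂ =>
      slotLaw_sum_bob _ _ fun _ _ y => ind (D θ y ≠ (w₁, w₂))
    simp only [hF, h, Fintype.sum_prod_type, blockLaw, blockInput]
    refine sum_congr rfl fun w₁ _ => ?_
    rw [sum_comm]
    refine sum_congr rfl fun w₂ _ => ?_
    simp only [mul_sum]
    exact sum_congr rfl fun x₁ _ => sum_congr rfl fun x₂ _ => sum_congr rfl fun y _ => by ring
  have herr : ∑ θ, weight θ * F θ ≤ C.errorProb V k := by
    have hdec : ∀ v₁ v₂ f' (q : SlotData (Fin n₁ ⊕ Fin n₂) 𝒳₁ 𝒳₂ 𝒴 𝒵), C.decode k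
        (fun j => (Fin.snoc (α := fun _ => SlotData (Fin n₁ ⊕ Fin n₂) 𝒳₁ 𝒳₂ 𝒴 𝒵) f' q j).2.2.1) =
        D (v₁, v₂, f') q.2.2.1 := by
      intro v₁ v₂ f' q
      simp only [hD]
      congr 1
      funext j
      refine Fin.lastCases ?_ (fun j => ?_) j
      · rw [Fin.snoc_last, Fin.snoc_last]
      · rw [Fin.snoc_castSucc, Fin.snoc_castSucc]
    have hR : ∀ v₁ w₁ v₂ w₂, C.bitLaw k * ∑ f : Fin (k + 1) → SlotData (Fin n₁ ⊕ Fin n₂) 𝒳₁ 𝒳₂ 𝒴 𝒵,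
        (∏ j, C.slot V (extend v₁ w₁) (extend v₂ w₂) j (f j)) *
        ind (C.decode k (fun j => (f j).2.2.1) ≠ (w₁, w₂)) =
        ∑ f', weight (v₁, v₂, f') * ((1 / 2) ^ (C.user₁.a + C.user₁.b k) *
      (1 / 2) ^ (C.user₂.a + C.user₂.b k) * ∑ q, C.slot V (extend v₁ w₁) (extend v₂ w₂)
        (Fin.last k) q * ind (D (v₁, v₂, f') q.2.2.1 ≠ (w₁, w₂))) := by
      intro v₁ w₁ v₂ w₂
      rw [sum_snoc]
      have hpast : ∀ j : Fin k, C.slot V (extend v₁ w₁) (extend v₂ w₂) j.castSucc =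
          C.slot V (extend v₁ fun _ => false) (extend v₂ fun _ => false) j.castSucc := fun j => by
        rw [BufferCode.slot, BufferCode.slot, slotEnc_extend v₁ w₁ fun _ => false,
          slotEnc_extend v₂ w₂ fun _ => false]
      simp only [Fin.prod_univ_castSucc, Fin.snoc_castSucc, Fin.snoc_last, hpast, hdec v₁ v₂,
        hweight, BufferCode.bitLaw, sent_succ, pow_add, mul_sum]
      exact sum_congr rfl fun f' _ => sum_congr rfl fun q _ => by ring
    refine le_of_eq ?_
    rw [BufferCode.errorProb_eq, sum_bits]
    simp only [sum_bits, message_extend_last, hR]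
    simp only [Fintype.sum_prod_type, hFeq]
    refine sum_congr rfl fun v₁ _ => ?_
    rw [sum_comm (s := (univ : Finset (Fin (C.user₁.a + C.user₁.b k) → Bool)))]
    refine sum_congr rfl fun v₂ _ => ?_
    simp only [mul_sum (univ : Finset (Fin (C.user₁.a + C.user₁.b k) → Bool)),
      mul_sum (univ : Finset (Fin (C.user₂.a + C.user₂.b k) → Bool))]
    rw [sum_comm]
    exact sum_congr rfl fun w₁ _ => sum_comm
  obtain ⟨θ, _, hθ⟩ := exists_le_of_sum_le hw0 hw1 herr
  exact ⟨θ.1, θ.2.1, D θ, hθ⟩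

/-- The converse for one slot of a code with key buffers. -/
theorem slot_converse (k : ℕ) : ∃ (p : Fin n₁ ⊕ Fin n₂ → 𝒳₁ → ℝ) (q : Fin n₁ ⊕ Fin n₂ → 𝒳₂ → ℝ),
    (∀ t, p t ∈ stdSimplex ℝ 𝒳₁) ∧ (∀ t, q t ∈ stdSimplex ℝ 𝒳₂) ∧
    ((1 - C.errorProb V k) * (C.user₁.a + C.user₁.b k : ℕ) - 1) * Real.log 2 ≤
      ∑ t, macInfo V.bob (p t) (q t) ∧
    ((1 - C.errorProb V k) * (C.user₂.a + C.user₂.b k : ℕ) - 1) * Real.log 2 ≤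
      ∑ t, macInfo (fun b a => V.bob a b) (q t) (p t) ∧
    ((1 - C.errorProb V k) * ((C.user₁.a + C.user₁.b k : ℕ) + (C.user₂.a + C.user₂.b k : ℕ)) - 1) *
      Real.log 2 ≤ ∑ t, macSumInfo V.bob (p t) (q t) := by
  obtain ⟨v₁, v₂, dec, h⟩ := exists_past C V k
  obtain ⟨h1, h2, h3⟩ := mac_converse (blockInput_mem v₁) (blockInput_mem v₂) V.bob_mem
    (one_le_pow₀ (by norm_num)) (one_le_pow₀ (by norm_num)) (sum_blockInput_message v₁)
    (sum_blockInput_message v₂) dec h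
  simp only [Real.log_pow] at h1 h2 h3
  refine ⟨_, _, fun t => probOf_mem (blockInput_mem v₁) _, fun t => probOf_mem (blockInput_mem v₂) _,
    le_trans (le_of_eq (by ring)) h1, le_trans (le_of_eq (by ring)) h2,
    le_trans (le_of_eq (by ring)) h3⟩

end Past

/-! ### The Shannon region and the final comparison -/

section ShannonRegion

variable {α β γ : Type*} [Fintype α] [Fintype β] [Fintype γ] {U : α → β → γ → ℝ}

/-- The mixture of two laws with weights `1 - t` and `t`. -/
def mix (t : ℝ) (p u : α → ℝ) : α → ℝ := fun a => (1 - t) * p a + t * u a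

theorem mix_mem {p u : α → ℝ} (hp : p ∈ stdSimplex ℝ α) (hu : u ∈ stdSimplex ℝ α) {t : ℝ}
    (h0 : 0 ≤ t) (h1 : t ≤ 1) : mix t p u ∈ stdSimplex ℝ α :=
  convex_stdSimplex ℝ α hp hu (sub_nonneg.2 h1) h0 (by ring)

omit [Fintype α] in
theorem mix_half_comm (p u : α → ℝ) : mix (1 / 2) p u = mix (1 / 2) u p := by
  funext a; simp only [mix]; ring

theorem mul_macInfo_le_mix (hU : ∀ a b, U a b ∈ stdSimplex ℝ γ) {p u : α → ℝ} {q v : β → ℝ}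
    (hp : p ∈ stdSimplex ℝ α) (hu : u ∈ stdSimplex ℝ α) (hq : q ∈ stdSimplex ℝ β)
    (hv : v ∈ stdSimplex ℝ β) {t : ℝ} (h0 : 0 < t) (h1 : t ≤ 1) :
    t * t * macInfo U u v ≤ macInfo U (mix t p u) (mix t q v) := by
  rw [macInfo, macInfo, mul_sum]
  refine sum_le_sum fun b _ => ?_
  have h2 : t * info u (fun a => U a b) ≤ info (mix t p u) (fun a => U a b) :=
    mul_info_le_info_mix hp hu (fun a => hU a b) (sub_nonneg.2 h1) h0 (by ring)
  have h3 := info_nonneg hu fun a => hU a b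
  calc t * t * (v b * info u fun a => U a b) = t * v b * (t * info u fun a => U a b) := by ring
    _ ≤ mix t q v b * info (mix t p u) (fun a => U a b) := by
      refine mul_le_mul ?_ h2 (mul_nonneg h0.le h3) ((mix_mem hq hv h0.le h1).1 b)
      exact le_add_of_nonneg_left (mul_nonneg (sub_nonneg.2 h1) (hq.1 b))

theorem continuous_macInfo (hU : ∀ a b, U a b ∈ stdSimplex ℝ γ) {X : Type*} [TopologicalSpace X]
    {P : X → α → ℝ} {Q : X → β → ℝ} (hP : Continuous P) (hQ : Continuous Q)
    (hP0 : ∀ x a, 0 ≤ P x a) : Continuous fun x => macInfo U (P x) (Q x) :=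
  continuous_finsetSum _ fun b _ => ((continuous_apply b).comp hQ).mul
    (continuous_info hP hP0 fun a => (hU a b).1)

theorem continuous_macSumInfo (hU : ∀ a b, U a b ∈ stdSimplex ℝ γ) {X : Type*} [TopologicalSpace X]
    {P : X → α → ℝ} {Q : X → β → ℝ} (hP : Continuous P) (hQ : Continuous Q)
    (hP0 : ∀ x a, 0 ≤ P x a) (hQ0 : ∀ x b, 0 ≤ Q x b) :
    Continuous fun x => macSumInfo U (P x) (Q x) :=
  continuous_info (continuous_pi fun ab => ((continuous_apply ab.1).comp hP).mul
    ((continuous_apply ab.2).comp hQ)) (fun x _ => mul_nonneg (hP0 x _) (hQ0 x _))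
    fun _ => (hU _ _).1

variable {𝒳₁ 𝒳₂ 𝒴 𝒵 : Type*} [Fintype 𝒳₁] [Fintype 𝒳₂] [Fintype 𝒴] [Fintype 𝒵]
  {V : Channel 𝒳₁ 𝒳₂ 𝒴 𝒵}

theorem convex_shannonRegion : Convex ℝ V.shannonRegion := (convex_convexHull ℝ _).closure

theorem isClosed_shannonRegion : IsClosed V.shannonRegion := isClosed_closure

/-- The capacity region is stable under scaling down each of the rates. -/
theorem scale_mem_shannonRegion {R : ℝ × ℝ} (hR : R ∈ V.shannonRegion) {s t : ℝ} (hs : 0 ≤ s)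
    (hs₁ : s ≤ 1) (ht : 0 ≤ t) (ht₁ : t ≤ 1) : (s * R.1, t * R.2) ∈ V.shannonRegion := by
  let f : ℝ × ℝ →ₗ[ℝ] ℝ × ℝ := LinearMap.prodMap (s • LinearMap.id) (t • LinearMap.id)
  have hf : ∀ R, f R = (s * R.1, t * R.2) := fun R => rfl
  rw [← hf]
  refine map_mem_closure (f := f) (LinearMap.continuous_of_finiteDimensional f) hR ?_
  rw [Set.mapsTo_iff_image_subset, LinearMap.image_convexHull]
  refine convexHull_mono ?_
  rintro _ ⟨R, ⟨h1, h2, p₁, hp₁, p₂, hp₂, h3, h4, h5⟩, rfl⟩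
  have e1 : s * R.1 ≤ R.1 := mul_le_of_le_one_left h1 hs₁
  have e2 : t * R.2 ≤ R.2 := mul_le_of_le_one_left h2 ht₁
  exact ⟨mul_nonneg hs h1, mul_nonneg ht h2, p₁, hp₁, p₂, hp₂, e1.trans_lt h3, e2.trans_lt h4,
    (add_le_add e1 e2).trans_lt h5⟩

/-- The closed pentagon of a pair of inputs is in the capacity region, if both users can transmit. -/
theorem pentagon_subset_of_pos {p₁ : 𝒳₁ → ℝ} {p₂ : 𝒳₂ → ℝ} (hp₁ : p₁ ∈ stdSimplex ℝ 𝒳₁)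
    (hp₂ : p₂ ∈ stdSimplex ℝ 𝒳₂) (h₁ : 0 < macInfo V.bob p₁ p₂)
    (h₂ : 0 < macInfo (fun b a => V.bob a b) p₂ p₁) {x y : ℝ} (hx : 0 ≤ x) (hy : 0 ≤ y)
    (hx₁ : x ≤ macInfo V.bob p₁ p₂) (hy₁ : y ≤ macInfo (fun b a => V.bob a b) p₂ p₁)
    (hxy : x + y ≤ macSumInfo V.bob p₁ p₂) :
    (x / Real.log 2, y / Real.log 2) ∈ V.shannonRegion := by
  have hl2 : 0 < Real.log 2 := Real.log_pos (by norm_num)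
  have h₃ : 0 < macSumInfo V.bob p₁ p₂ := h₁.trans_le (macInfo_le_sum V.bob_mem hp₁ hp₂)
  have hlim : Tendsto (fun ε : ℝ => ((1 - ε) * x / Real.log 2, (1 - ε) * y / Real.log 2)) (𝓝[>] 0)
      (𝓝 (x / Real.log 2, y / Real.log 2)) := by
    have : Continuous fun ε : ℝ => ((1 - ε) * x / Real.log 2, (1 - ε) * y / Real.log 2) := by
      fun_prop
    simpa using (this.tendsto 0).mono_left nhdsWithin_le_nhds
  refine isClosed_shannonRegion.mem_of_tendsto hlim ?_
  have hev : ∀ᶠ ε : ℝ in 𝓝[>] 0, ε ∈ Set.Ioo (0 : ℝ) 1 := Ioo_mem_nhdsGT one_pos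
  filter_upwards [hev] with ε hε
  have hstrict : ∀ z m : ℝ, 0 < m → z ≤ m → (1 - ε) * z < m := fun z m hm hz => by
    have := mul_le_mul_of_nonneg_left hz (sub_nonneg.2 hε.2.le)
    nlinarith [mul_pos hε.1 hm]
  refine subset_closure (subset_convexHull ℝ _ ⟨?_, ?_, p₁, hp₁, p₂, hp₂, ?_, ?_, ?_⟩)
  · exact div_nonneg (mul_nonneg (sub_nonneg.2 hε.2.le) hx) hl2.le
  · exact div_nonneg (mul_nonneg (sub_nonneg.2 hε.2.le) hy) hl2.le
  · rw [Channel.infoBob₁_eq V hp₁]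
    exact div_lt_div_of_pos_right (hstrict _ _ h₁ hx₁) hl2
  · rw [Channel.infoBob₂_eq V hp₂]
    exact div_lt_div_of_pos_right (hstrict _ _ h₂ hy₁) hl2
  · rw [Channel.infoBob_eq V hp₁ hp₂, ← add_div, ← mul_add]
    exact div_lt_div_of_pos_right (hstrict _ _ h₃ hxy) hl2

/-- The two corners of the pentagon of a pair of inputs are in the capacity region, provided that
for some inputs both users can transmit. -/
theorem corners_mem {w₁ : 𝒳₁ → ℝ} {w₂ : 𝒳₂ → ℝ} (hw₁ : w₁ ∈ stdSimplex ℝ 𝒳₁)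
    (hw₂ : w₂ ∈ stdSimplex ℝ 𝒳₂) (h₁ : 0 < macInfo V.bob w₁ w₂)
    (h₂ : 0 < macInfo (fun b a => V.bob a b) w₂ w₁) {p₁ : 𝒳₁ → ℝ} {p₂ : 𝒳₂ → ℝ}
    (hp₁ : p₁ ∈ stdSimplex ℝ 𝒳₁) (hp₂ : p₂ ∈ stdSimplex ℝ 𝒳₂) :
    (macInfo V.bob p₁ p₂ / Real.log 2,
      (macSumInfo V.bob p₁ p₂ - macInfo V.bob p₁ p₂) / Real.log 2) ∈ V.shannonRegion ∧
    ((macSumInfo V.bob p₁ p₂ - macInfo (fun b a => V.bob a b) p₂ p₁) / Real.log 2,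
      macInfo (fun b a => V.bob a b) p₂ p₁ / Real.log 2) ∈ V.shannonRegion := by
  -- mix in a vanishing portion of the inputs `w₁`, `w₂`
  set s : ℝ → ℝ := fun x => min |x| 1 with hs
  have hsc : Continuous s := continuous_abs.min continuous_const
  have hs0 : ∀ x, 0 ≤ s x := fun x => le_min (abs_nonneg x) zero_le_one
  have hs1 : ∀ x, s x ≤ 1 := fun x => min_le_right _ _
  have hs00 : s 0 = 0 := by simp [hs]
  set q₁ : ℝ → 𝒳₁ → ℝ := fun x => mix (s x) p₁ w₁ with hq₁
  set q₂ : ℝ → 𝒳₂ → ℝ := fun x => mix (s x) p₂ w₂ with hq₂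
  have hq₁c : Continuous q₁ := continuous_pi fun a => by simp only [hq₁, mix]; fun_prop
  have hq₂c : Continuous q₂ := continuous_pi fun a => by simp only [hq₂, mix]; fun_prop
  have hq₁m : ∀ x, q₁ x ∈ stdSimplex ℝ 𝒳₁ := fun x => mix_mem hp₁ hw₁ (hs0 x) (hs1 x)
  have hq₂m : ∀ x, q₂ x ∈ stdSimplex ℝ 𝒳₂ := fun x => mix_mem hp₂ hw₂ (hs0 x) (hs1 x)
  have hq₁0 : q₁ 0 = p₁ := by funext a; simp [hq₁, mix, hs00]
  have hq₂0 : q₂ 0 = p₂ := by funext a; simp [hq₂, mix, hs00]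
  have c₁ := continuous_macInfo V.bob_mem hq₁c hq₂c fun x => (hq₁m x).1
  have c₂ := continuous_macInfo (U := fun b a => V.bob a b) (fun b a => V.bob_mem a b) hq₂c hq₁c
    fun x => (hq₂m x).1
  have c₃ := continuous_macSumInfo V.bob_mem hq₁c hq₂c (fun x => (hq₁m x).1) fun x => (hq₂m x).1
  have hpos : ∀ x, 0 < x → 0 < macInfo V.bob (q₁ x) (q₂ x) ∧
      0 < macInfo (fun b a => V.bob a b) (q₂ x) (q₁ x) := by
    intro x hx
    have hsx : 0 < s x := lt_min (abs_pos.2 hx.ne') one_pos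
    exact ⟨(mul_pos (mul_pos hsx hsx) h₁).trans_le
        (mul_macInfo_le_mix V.bob_mem hp₁ hw₁ hp₂ hw₂ hsx (hs1 x)),
      (mul_pos (mul_pos hsx hsx) h₂).trans_le
        (mul_macInfo_le_mix (fun b a => V.bob_mem a b) hp₂ hw₂ hp₁ hw₁ hsx (hs1 x))⟩
  have hI : ∀ x, macInfo V.bob (q₁ x) (q₂ x) ≤ macSumInfo V.bob (q₁ x) (q₂ x) ∧
      macInfo (fun b a => V.bob a b) (q₂ x) (q₁ x) ≤ macSumInfo V.bob (q₁ x) (q₂ x) ∧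
      macSumInfo V.bob (q₁ x) (q₂ x) ≤ macInfo V.bob (q₁ x) (q₂ x) +
        macInfo (fun b a => V.bob a b) (q₂ x) (q₁ x) := fun x =>
    ⟨macInfo_le_sum V.bob_mem (hq₁m x) (hq₂m x),
      (macInfo_le_sum (fun b a => V.bob_mem a b) (hq₂m x) (hq₁m x)).trans_eq macSumInfo_swap,
      macSumInfo_le_add V.bob_mem (hq₁m x) (hq₂m x)⟩
  constructor
  · have hlim := (((c₁.div_const (Real.log 2)).prodMk
      ((c₃.sub c₁).div_const (Real.log 2))).tendsto 0).mono_left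
      (nhdsWithin_le_nhds (s := Set.Ioi 0))
    simp only [Pi.sub_apply, hq₁0, hq₂0] at hlim
    refine isClosed_shannonRegion.mem_of_tendsto hlim ?_
    filter_upwards [self_mem_nhdsWithin] with x hx
    obtain ⟨h1, h2⟩ := hpos x hx
    obtain ⟨h3, h4, h5⟩ := hI x
    exact pentagon_subset_of_pos (hq₁m x) (hq₂m x) h1 h2 h1.le (by linarith) le_rfl (by linarith)
      (by linarith)
  · have hlim := ((((c₃.sub c₂).div_const (Real.log 2)).prodMk
      (c₂.div_const (Real.log 2))).tendsto 0).mono_left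
      (nhdsWithin_le_nhds (s := Set.Ioi 0))
    simp only [Pi.sub_apply, hq₁0, hq₂0] at hlim
    refine isClosed_shannonRegion.mem_of_tendsto hlim ?_
    filter_upwards [self_mem_nhdsWithin] with x hx
    obtain ⟨h1, h2⟩ := hpos x hx
    obtain ⟨h3, h4, h5⟩ := hI x
    exact pentagon_subset_of_pos (hq₁m x) (hq₂m x) h1 h2 (by linarith) h2.le (by linarith) le_rfl
      (by linarith)

/-- A pentagon is in the capacity region if its corners are. -/
theorem mem_of_corners_mem {A B C x y : ℝ} (hCAB : C ≤ A + B)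
    (h₁ : (A, C - A) ∈ V.shannonRegion) (h₂ : (C - B, B) ∈ V.shannonRegion) (hx : 0 ≤ x)
    (hy : 0 ≤ y) (hxA : x ≤ A) (hyB : y ≤ B) (hxy : x + y ≤ C) : (x, y) ∈ V.shannonRegion := by
  -- a point of the dominant face that dominates `(x, y)`
  obtain ⟨x', hxx', hBx', hx'A, hyx'⟩ : ∃ x', x ≤ x' ∧ C - B ≤ x' ∧ x' ≤ A ∧ y ≤ C - x' := by
    refine ⟨max x (C - B), le_max_left _ _, le_max_right _ _, max_le hxA (by linarith), ?_⟩
    rcases le_total x (C - B) with h | h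
    · rw [max_eq_right h]; linarith
    · rw [max_eq_left h]; linarith
  have hface : (x', C - x') ∈ V.shannonRegion := by
    rcases hCAB.eq_or_lt with h | h
    · rwa [show x' = A by linarith]
    have hd : 0 < A + B - C := by linarith
    have := convex_shannonRegion h₁ h₂ (a := (x' - (C - B)) / (A + B - C))
      (b := (A - x') / (A + B - C)) (div_nonneg (by linarith) hd.le)
      (div_nonneg (by linarith) hd.le) (by rw [← add_div]; exact (div_eq_one_iff_eq hd.ne').2 (by ring))
    convert this using 1
    ext
    · simp only [Prod.smul_mk, Prod.mk_add_mk, smul_eq_mul]; field_simp; ring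
    · simp only [Prod.smul_mk, Prod.mk_add_mk, smul_eq_mul]; field_simp; ring
  have hscale : ∀ u v : ℝ, 0 ≤ u → u ≤ v → u / v * v = u := fun u v hu huv => by
    rcases eq_or_ne v 0 with h | h
    · rw [h] at huv ⊢; rw [mul_zero]; linarith
    · exact div_mul_cancel₀ u h
  have := scale_mem_shannonRegion hface (s := x / x') (t := y / (C - x'))
    (div_nonneg hx (hx.trans hxx')) (div_le_one_of_le₀ hxx' (hx.trans hxx'))
    (div_nonneg hy (hy.trans hyx')) (div_le_one_of_le₀ hyx' (hy.trans hyx'))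
  simpa only [hscale x x' hx hxx', hscale y (C - x') hy hyx'] using this

/-- Averages of pentagons are in the capacity region. -/
theorem average_mem {ι : Type*} [Fintype ι] [Nonempty ι] {w₁ : 𝒳₁ → ℝ} {w₂ : 𝒳₂ → ℝ}
    (hw₁ : w₁ ∈ stdSimplex ℝ 𝒳₁) (hw₂ : w₂ ∈ stdSimplex ℝ 𝒳₂) (h₁ : 0 < macInfo V.bob w₁ w₂)
    (h₂ : 0 < macInfo (fun b a => V.bob a b) w₂ w₁) {p : ι → 𝒳₁ → ℝ} {q : ι → 𝒳₂ → ℝ}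
    (hp : ∀ t, p t ∈ stdSimplex ℝ 𝒳₁) (hq : ∀ t, q t ∈ stdSimplex ℝ 𝒳₂) {x y : ℝ} (hx : 0 ≤ x)
    (hy : 0 ≤ y) (hxA : x * Fintype.card ι * Real.log 2 ≤ ∑ t, macInfo V.bob (p t) (q t))
    (hyB : y * Fintype.card ι * Real.log 2 ≤ ∑ t, macInfo (fun b a => V.bob a b) (q t) (p t))
    (hxy : (x + y) * Fintype.card ι * Real.log 2 ≤ ∑ t, macSumInfo V.bob (p t) (q t)) :
    (x, y) ∈ V.shannonRegion := by
  have hl2 : 0 < Real.log 2 := Real.log_pos (by norm_num)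
  have hn : (0 : ℝ) < Fintype.card ι := by exact_mod_cast Fintype.card_pos
  set n : ℝ := (Fintype.card ι : ℝ) with hnd
  have havg : ∀ f g : ι → ℝ, (∀ t, (f t / Real.log 2, g t / Real.log 2) ∈ V.shannonRegion) →
      ((∑ t, f t) / (n * Real.log 2), (∑ t, g t) / (n * Real.log 2)) ∈ V.shannonRegion := by
    intro f g h
    have := convex_shannonRegion.sum_mem (t := univ) (w := fun _ : ι => 1 / n)
      (fun _ _ => by positivity) (by
        rw [sum_const, card_univ, nsmul_eq_mul, ← hnd]; field_simp) (fun t _ => h t)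
    convert this using 1
    ext
    · simp only [Prod.fst_sum, Prod.smul_fst, smul_eq_mul, ← mul_sum, ← sum_div]; field_simp
    · simp only [Prod.snd_sum, Prod.smul_snd, smul_eq_mul, ← mul_sum, ← sum_div]; field_simp
  have hc := fun t => corners_mem hw₁ hw₂ h₁ h₂ (hp t) (hq t)
  have k₁ := havg _ _ fun t => (hc t).1
  have k₂ := havg _ _ fun t => (hc t).2
  simp only [sum_sub_distrib, sub_div] at k₁ k₂
  have hd : 0 < n * Real.log 2 := mul_pos hn hl2
  refine mem_of_corners_mem ?_ k₁ k₂ hx hy ?_ ?_ ?_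
  · rw [← add_div, ← sum_add_distrib]
    exact div_le_div_of_nonneg_right (sum_le_sum fun t _ =>
      macSumInfo_le_add V.bob_mem (hp t) (hq t)) hd.le
  · rw [le_div_iff₀ hd]; linarith
  · rw [le_div_iff₀ hd]; linarith
  · rw [le_div_iff₀ hd]; linarith

/-- Achievable secrecy rates are in the capacity region. -/
theorem mem_shannonRegion_of_isAchievable {w₁ : 𝒳₁ → ℝ} {w₂ : 𝒳₂ → ℝ}
    (hw₁ : w₁ ∈ stdSimplex ℝ 𝒳₁) (hw₂ : w₂ ∈ stdSimplex ℝ 𝒳₂) (h₁ : 0 < macInfo V.bob w₁ w₂)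
    (h₂ : 0 < macInfo (fun b a => V.bob a b) w₂ w₁) {N : ℕ} {R : ℝ × ℝ}
    (hR : V.IsAchievable N R) : R ∈ V.shannonRegion := by
  obtain ⟨hR₁, hR₂, l, k₀, C, hrate, herr, -⟩ := hR
  have hl2 : 0 < Real.log 2 := Real.log_pos (by norm_num)
  set δ : ℕ → ℝ := fun n₁ => (C n₁).errorProb V k₀ with hδ
  set n : ℕ → ℕ := fun n₁ => n₁ + l * n₁ with hn
  have hnlim : Tendsto n atTop atTop := tendsto_atTop_mono (fun n₁ => Nat.le_add_right _ _) tendsto_id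
  set ρ : ℝ → ℕ → ℝ := fun r n₁ => max ((1 - δ n₁) * r - 1 / (n n₁ : ℕ)) 0 with hρ
  have hρlim : ∀ r, 0 ≤ r → Tendsto (ρ r) atTop (𝓝 r) := by
    intro r hr
    have h1 : Tendsto (fun n₁ => (1 - δ n₁) * r - 1 / ((n n₁ : ℕ) : ℝ)) atTop (𝓝 ((1 - 0) * r - 0)) :=
      (((herr k₀).const_sub 1).mul_const r).sub
        (tendsto_one_div_atTop_nhds_zero_nat.comp hnlim)
    have := h1.max (tendsto_const_nhds (x := (0 : ℝ)))
    rwa [sub_zero, sub_zero, one_mul, max_eq_left hr] at this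
  refine isClosed_shannonRegion.mem_of_tendsto ((hρlim R.1 hR₁).prodMk_nhds (hρlim R.2 hR₂)) ?_
  have hδ1 : ∀ᶠ n₁ in atTop, δ n₁ < 1 := (herr k₀).eventually_lt_const one_pos
  filter_upwards [hrate, hδ1, eventually_ge_atTop 1] with n₁ hr hδ' hn₁
  obtain ⟨p, q, hp, hq, i₁, i₂, i₃⟩ := slot_converse (C n₁) V k₀
  obtain ⟨hr₁, hr₂⟩ := hr k₀ le_rfl
  have hnpos : 0 < n n₁ := by simp only [hn]; omega
  have hn0 : (0 : ℝ) < (n n₁ : ℕ) := by exact_mod_cast hnpos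
  have : Nonempty (Fin n₁ ⊕ Fin (l * n₁)) := ⟨Sum.inl ⟨0, hn₁⟩⟩
  have hcard : (Fintype.card (Fin n₁ ⊕ Fin (l * n₁)) : ℝ) = (n n₁ : ℕ) := by
    simp [hn]
  rw [UserCode.rate, le_div_iff₀ hn0] at hr₁ hr₂
  generalize ((C n₁).user₁.a + (C n₁).user₁.b k₀ : ℕ) = m₁ at i₁ i₃ hr₁
  generalize ((C n₁).user₂.a + (C n₁).user₂.b k₀ : ℕ) = m₂ at i₂ i₃ hr₂
  change ((1 - δ n₁) * m₁ - 1) * Real.log 2 ≤ _ at i₁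
  change ((1 - δ n₁) * m₂ - 1) * Real.log 2 ≤ _ at i₂
  change ((1 - δ n₁) * ((m₁ : ℝ) + m₂) - 1) * Real.log 2 ≤ _ at i₃
  change R.1 * (n n₁ : ℕ) ≤ _ at hr₁
  change R.2 * (n n₁ : ℕ) ≤ _ at hr₂
  have hA0 : 0 ≤ ∑ t, macInfo V.bob (p t) (q t) :=
    sum_nonneg fun t _ => macInfo_nonneg V.bob_mem (hp t) (hq t)
  have hB0 : 0 ≤ ∑ t, macInfo (fun b a => V.bob a b) (q t) (p t) :=
    sum_nonneg fun t _ => macInfo_nonneg (fun b a => V.bob_mem a b) (hq t) (hp t)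
  have hAC : ∑ t, macInfo V.bob (p t) (q t) ≤ ∑ t, macSumInfo V.bob (p t) (q t) :=
    sum_le_sum fun t _ => macInfo_le_sum V.bob_mem (hp t) (hq t)
  have hBC : ∑ t, macInfo (fun b a => V.bob a b) (q t) (p t) ≤ ∑ t, macSumInfo V.bob (p t) (q t) :=
    sum_le_sum fun t _ =>
      (macInfo_le_sum (fun b a => V.bob_mem a b) (hq t) (hp t)).trans_eq macSumInfo_swap
  have hδ0 : 0 ≤ 1 - δ n₁ := by linarith
  have hmul : ∀ r, ((1 - δ n₁) * r - 1 / (n n₁ : ℕ)) * (n n₁ : ℕ) = (1 - δ n₁) * (r * (n n₁ : ℕ)) - 1 := by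
    intro r
    field_simp
  have hle : ∀ (r m s : ℝ), r * (n n₁ : ℕ) ≤ m → ((1 - δ n₁) * m - 1) * Real.log 2 ≤ s →
      ((1 - δ n₁) * r - 1 / (n n₁ : ℕ)) * (n n₁ : ℕ) * Real.log 2 ≤ s := by
    intro r m s h1 h2
    rw [hmul]
    refine le_trans (mul_le_mul_of_nonneg_right ?_ hl2.le) h2
    linarith [mul_le_mul_of_nonneg_left h1 hδ0]
  have hmax : ∀ (r m s : ℝ), r * (n n₁ : ℕ) ≤ m → ((1 - δ n₁) * m - 1) * Real.log 2 ≤ s → 0 ≤ s →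
      ρ r n₁ * (n n₁ : ℕ) * Real.log 2 ≤ s := by
    intro r m s h1 h2 h3
    rcases le_total ((1 - δ n₁) * r - 1 / (n n₁ : ℕ)) 0 with h | h
    · simp only [hρ, max_eq_right h, zero_mul]; exact h3
    · simp only [hρ, max_eq_left h]
      exact hle r m s h1 h2
  refine average_mem hw₁ hw₂ h₁ h₂ hp hq (le_max_right _ _) (le_max_right _ _) ?_ ?_ ?_
  · rw [hcard]; exact hmax _ _ _ hr₁ i₁ hA0
  · rw [hcard]; exact hmax _ _ _ hr₂ i₂ hB0
  · rw [hcard]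
    have j₁ := hmax _ _ _ hr₁ i₁ hA0
    have j₂ := hmax _ _ _ hr₂ i₂ hB0
    rcases le_total ((1 - δ n₁) * R.1 - 1 / (n n₁ : ℕ)) 0 with h | h
    · have : ρ R.1 n₁ = 0 := max_eq_right h
      rw [this, zero_add]
      exact j₂.trans hBC
    rcases le_total ((1 - δ n₁) * R.2 - 1 / (n n₁ : ℕ)) 0 with h' | h'
    · have : ρ R.2 n₁ = 0 := max_eq_right h'
      rw [this, add_zero]
      exact j₁.trans hAC
    · have e₁ : ρ R.1 n₁ = _ := max_eq_left h
      have e₂ : ρ R.2 n₁ = _ := max_eq_left h'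
      have j₃ := hle (R.1 + R.2) (m₁ + m₂) _ (by linarith) i₃
      refine le_trans (mul_le_mul_of_nonneg_right (mul_le_mul_of_nonneg_right ?_ hn0.le) hl2.le) j₃
      have : (0 : ℝ) ≤ 1 / (n n₁ : ℕ) := by positivity
      rw [e₁, e₂]
      linarith

end ShannonRegion

theorem secrecyRegion_eq_shannonRegion {𝒳₁ 𝒳₂ 𝒴 𝒵 : Type*} [Fintype 𝒳₁] [Fintype 𝒳₂] [Fintype 𝒴] [Fintype 𝒵]
    (V : Channel 𝒳₁ 𝒳₂ 𝒴 𝒵)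
    (h₁ : ∃ p₁ ∈ stdSimplex ℝ 𝒳₁, ∃ p₂ ∈ stdSimplex ℝ 𝒳₂,
      V.infoEve₁ p₁ p₂ < V.infoBob₁ p₁ p₂)
    (h₂ : ∃ p₁ ∈ stdSimplex ℝ 𝒳₁, ∃ p₂ ∈ stdSimplex ℝ 𝒳₂,
      V.infoEve₂ p₁ p₂ < V.infoBob₂ p₁ p₂)
    (N₁ : ℕ) :
    V.secrecyRegion N₁ = V.shannonRegion := by
  have hl2 : 0 < Real.log 2 := Real.log_pos (by norm_num)
  have h₁' : ∃ p₁ ∈ stdSimplex ℝ 𝒳₁, ∃ p₂ ∈ stdSimplex ℝ 𝒳₂,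
      macInfo V.eve p₁ p₂ < macInfo V.bob p₁ p₂ := by
    obtain ⟨p₁, hp₁, p₂, hp₂, h⟩ := h₁
    rw [V.infoEve₁_eq hp₁, V.infoBob₁_eq hp₁] at h
    exact ⟨p₁, hp₁, p₂, hp₂, (div_lt_div_iff_of_pos_right hl2).1 h⟩
  have h₂' : ∃ p₂ ∈ stdSimplex ℝ 𝒳₂, ∃ p₁ ∈ stdSimplex ℝ 𝒳₁,
      macInfo (fun b a => V.eve a b) p₂ p₁ < macInfo (fun b a => V.bob a b) p₂ p₁ := by
    obtain ⟨p₁, hp₁, p₂, hp₂, h⟩ := h₂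
    rw [V.infoEve₂_eq hp₂, V.infoBob₂_eq hp₂] at h
    exact ⟨p₂, hp₂, p₁, hp₁, (div_lt_div_iff_of_pos_right hl2).1 h⟩
  refine Set.Subset.antisymm ?_ (closure_mono (convexHull_mono ?_))
  · obtain ⟨u₁, hu₁, u₂, hu₂, hu⟩ := h₁'
    obtain ⟨v₂, hv₂, v₁, hv₁, hv⟩ := h₂'
    have hu0 := (macInfo_nonneg V.eve_mem hu₁ hu₂).trans_lt hu
    have hv0 := (macInfo_nonneg (fun b a => V.eve_mem a b) hv₂ hv₁).trans_lt hv
    -- an even mixture of the two pairs of inputs lets both users transmit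
    have hw₁ : mix (1 / 2) v₁ u₁ ∈ stdSimplex ℝ 𝒳₁ := mix_mem hv₁ hu₁ (by norm_num) (by norm_num)
    have hw₂ : mix (1 / 2) v₂ u₂ ∈ stdSimplex ℝ 𝒳₂ := mix_mem hv₂ hu₂ (by norm_num) (by norm_num)
    have k₁ : 0 < macInfo V.bob (mix (1 / 2) v₁ u₁) (mix (1 / 2) v₂ u₂) :=
      lt_of_lt_of_le (by positivity)
        (mul_macInfo_le_mix V.bob_mem hv₁ hu₁ hv₂ hu₂ (t := 1 / 2) (by norm_num) (by norm_num))
    have k₂ : 0 < macInfo (fun b a => V.bob a b) (mix (1 / 2) v₂ u₂) (mix (1 / 2) v₁ u₁) := by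
      rw [mix_half_comm v₂, mix_half_comm v₁]
      exact lt_of_lt_of_le (by positivity) (mul_macInfo_le_mix (fun b a => V.bob_mem a b) hu₂ hv₂
        hu₁ hv₁ (t := 1 / 2) (by norm_num) (by norm_num))
    exact closure_minimal (convexHull_min
      (fun R hR => mem_shannonRegion_of_isAchievable hw₁ hw₂ k₁ k₂ hR) convex_shannonRegion)
      isClosed_shannonRegion
  · rintro R ⟨hR₁, hR₂, p₁, hp₁, p₂, hp₂, r₁, r₂, r₃⟩
    rw [V.infoBob₁_eq hp₁, lt_div_iff₀ hl2] at r₁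
    rw [V.infoBob₂_eq hp₂, lt_div_iff₀ hl2] at r₂
    rw [V.infoBob_eq hp₁ hp₂, lt_div_iff₀ hl2] at r₃
    exact isAchievable_of_lt V h₁' h₂' hp₁ hp₂ hR₁ hR₂ r₁ r₂ r₃ N₁

end MACWT

end

theorem theorem3 {𝒳₁ 𝒳₂ 𝒴 𝒵 : Type*} [Fintype 𝒳₁] [Fintype 𝒳₂] [Fintype 𝒴] [Fintype 𝒵]
    (V : MACWT.Channel 𝒳₁ 𝒳₂ 𝒴 𝒵)
    (h₁ : ∃ p₁ ∈ stdSimplex ℝ 𝒳₁, ∃ p₂ ∈ stdSimplex ℝ 𝒳₂,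
      V.infoEve₁ p₁ p₂ < V.infoBob₁ p₁ p₂)
    (h₂ : ∃ p₁ ∈ stdSimplex ℝ 𝒳₁, ∃ p₂ ∈ stdSimplex ℝ 𝒳₂,
      V.infoEve₂ p₁ p₂ < V.infoBob₂ p₁ p₂)
    (N₁ : ℕ) :
    V.secrecyRegion N₁ = V.shannonRegion :=
  MACWT.secrecyRegion_eq_shannonRegion V h₁ h₂ N₁
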